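/- **Setup.** Let $\mathfrak h$ be a finite-dimensional complex vector space and $G\subseteq GL(\mathfrak h)$ a finite group generated by complex reflections and acting irreducibly on $\mathfrak h$; let $\mathcal S\subseteq G$ be its set of reflections. For $s\in\mathcal S$ let $\lambda_s\neq 1$ and $\lambda_s^{-1}$ be the nontrivial eigenvalues of $s$ on $\mathfrak h^*$ and on $\mathfrak h$, choose eigenvectors $\alpha_s\in\mathfrak h^*$, $\alpha_s^\vee\in\mathfrak h$ for them with $\alpha_s(\alpha_s^\vee)=2$, and put $d_s=\frac{1-\lambda_s}2$, $d_s^\vee=\frac{1-\lambda_s^{-1}}2$. Let $t\in\mathbb C$ and let $c:\mathcal S\to\mathbb C$ be conjugation invariant. The rational Cherednik algebra $\mathsf H_{t,c}$ is generated by $\mathfrak h$, $\mathfrak h^*$ and $\mathbb CG$ with relations $[y,y']=0=[x,x']$, $gy=g(y)g$, $gx=g(x)g$ and $[y,x]=t\,x(y)-\sum_{s}c(s)\alpha_s(y)x(\alpha_s^\vee)s$, for $x,x'\in\mathfrak h^*$, $y,y'\in\mathfrak h$, $g\in G$. Let $\mathcal O^{\rm ln}_{t,c}$ be the category of locally $\mathfrak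 h$-nilpotent $\mathsf H_{t,c}$-modules (every vector is killed by all sufficiently long products of elements of $\mathfrak h$) and $\mathcal O_{t,c}\subseteq\mathcal O^{\rm ln}_{t,c}$ the category of those that are finitely generated over $\mathbb C[\mathfrak h]$. For a full subcategory $\mathcal A$ of $\mathsf H_{t,c}$-modules, $K_0(\mathcal A)$ is the abelian group generated by the objects of $\mathcal A$ with a relation $[X_2]=[X_1]+[X_3]$ for every short exact sequence $0\to X_1\to X_2\to X_3\to0$ of modules in $\mathcal A$. Define integral operators on $\mathbb C[\mathfrak h]$ and $\mathbb C[\mathfrak h^*]$ by $$(I_sp)(y)=\int_{-d_s\alpha_s(y)}^0p(y+T\alpha_s^\vee)\,dT,\qquad (I_s^\vee q)(x)=\int_{-d_s^\vee x(\alpha_s^\vee)}^0q(x+T\alpha_s)\,dT ,$$ and let $\mu$ denote multiplication operators. For a representation $\tau$ of $G$, $\mathsf H_{t,c}$ acts on $\mathfrak M_{t,c}(\tau)=\mathbb C[\mathfrak h]\otimes\tau$ by $y\mapsto\partial_y\otimes1$, $g\mapsto g\otimes g$, $x\mapsto t\mu_x\otimes1-\sum_s\frac{c(s)}{d_s}x(\alpha_s^\vee)I_s\otimes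 s$ (this is the costandard module of $\tau$), and on $\mathfrak X_{t,c}(\tau)=\mathbb C[\mathfrak h]\otimes\mathbb C[\mathfrak h^*]\otimes\tau$ by $y\mapsto\partial_y\otimes1\otimes1$, $g\mapsto g\otimes g\otimes g$, $x\mapsto1\otimes\partial_x\otimes1+t\mu_x\otimes1\otimes1-\sum_s\frac{c(s)}{d_s}x(\alpha_s^\vee)I_s\otimes s\otimes s$. Let $S=\bigwedge\mathfrak h=S^+\oplus S^-$ (even and odd part) be the spin module, with $\mathfrak s(y)\omega=y\wedge\omega$ and $\mathfrak s(x)\omega=-2\partial_x\omega$, where $\partial_x$ is the odd derivation extending $y\mapsto x(y)$. For dual bases $(y_j)$, $(x_j)$ of $\mathfrak h$, $\mathfrak h^*$ the global Dirac operator $D_\tau$ on $\mathfrak X_{t,c}(\tau\otimes S)$ is $$-D_\tau=\sum_j\Big(\partial_{y_j}\otimes1\otimes1\otimes\mathfrak s(x_j)+1\otimes\partial_{x_j}\otimes1\otimes\mathfrak s(y_j)+1\otimes T_{y_j}^\vee(\tau)\otimes\mathfrak s(x_j)\Big),\qquad T_y^\vee(\tau)=t\mu_y\otimes1+\sum_s\frac{c(s)}{d_s}\alpha_s(y)I_s^\vee\otimes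 s .$$ It is $\mathsf H_{t,c}$-linear and restricts to $D_\tau^{+}:\mathfrak X^+\to\mathfrak X^-$, where $\mathfrak X^\pm=\mathfrak X_{t,c}(\tau\otimes S^\pm)$. The global Dirac index of $\tau$ is $$I(\tau)=[\ker D_\tau^+]-[\operatorname{coker}D_\tau^+]\in K_0(\mathcal O^{\rm ln}_{t,c}).$$ **Statement.** For every irreducible representation $\tau$ of $G$ and all parameters $t,c$: 1. $I(\tau)=[\mathfrak M_{t,c}(\tau)]$ in $K_0(\mathcal O^{\rm ln}_{t,c})$. 2. $I(\tau)$ lies in the image of $K_0(\mathcal O_{t,c})\to K_0(\mathcal O^{\rm ln}_{t,c})$. 3. More precisely, if $\mathcal A$ is any Serre subcategory of the category of $\mathsf H_{t,c}$-modules that contains $\mathfrak X^+$ and $\mathfrak X^-$, then $\mathcal A$ contains $\ker D_\tau^+$, $\operatorname{coker}D_\tau^+$ and $\mathfrak M_{t,c}(\tau)$, and $[\ker D_\tau^+]-[\operatorname{coker}D_\tau^+]=[\mathfrak M_{t,c}(\tau)]$ in $K_0(\mathcal A)$. 4. If $t\neq0$, then $\ker D_\tau^+$, $\operatorname{coker}D_\tau^+$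 and $\mathfrak M_{t,c}(\tau)$ are objects of $\mathcal O_{t,c}$, and $[\ker D_\tau^+]-[\operatorname{coker}D_\tau^+]=[\mathfrak M_{t,c}(\tau)]$ already in $K_0(\mathcal O_{t,c})$. 5. The value $\mathfrak M_{t,c}(\tau)$ of the index is independent of the parameters in the following sense: for any other parameters $t',c'$ (and any choices of eigenvectors) there is a linear isomorphism $\mathfrak M_{t,c}(\tau)\cong\mathfrak M_{t',c'}(\tau)$ that commutes with the actions of $\mathfrak h$ and of $G$. -/

import Mathlib

universe u

open scoped TensorProduct Polynomial

noncomputable section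

namespace RCA

/-! ### Calculus on symmetric algebras

For a complex vector space `W`, `SymmetricAlgebra ℂ W` is the algebra of polynomial functions on
`W*`; so `ℂ[𝔥] = SymmetricAlgebra ℂ (Module.Dual ℂ V)` and `ℂ[𝔥*] = SymmetricAlgebra ℂ V`
for `𝔥 = V`. -/

section Calculus

variable {W W' : Type u} [AddCommGroup W] [Module ℂ W] [AddCommGroup W'] [Module ℂ W']

/-- The symmetric algebra. -/
abbrev Sy (W : Type u) [AddCommGroup W] [Module ℂ W] : Type u := SymmetricAlgebra ℂ W

/-- Generators of the symmetric algebra. -/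
abbrev sι : W →ₗ[ℂ] Sy W := SymmetricAlgebra.ι ℂ W

theorem sy_induction {motive : Sy W → Prop} (one : motive 1)
    (add : ∀ p q, motive p → motive q → motive (p + q))
    (smul : ∀ (r : ℂ) p, motive p → motive (r • p))
    (mul : ∀ (w : W) p, motive p → motive (sι w * p)) (p : Sy W) : motive p := by
  suffices h : ∀ q, motive q → motive (p * q) by simpa using h 1 one
  induction p using SymmetricAlgebra.induction with
  | algebraMap r => intro q hq; rw [← Algebra.smul_def]; exact smul r q hq
  | ι w => intro q hq; exact mul w q hq
  | mul a b ha hb => intro q hq; rw [mul_assoc]; exact ha _ (hb _ hq)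
  | add a b ha hb => intro q hq; rw [add_mul]; exact add _ _ (ha _ hq) (hb _ hq)

/-- The algebra map `Sym W → Sym W'` induced by a linear map; for the transpose of `a : W'* → W*`
this is composition of polynomial functions with `a`. -/
def symMap (e : W →ₗ[ℂ] W') : Sy W →ₐ[ℂ] Sy W' := SymmetricAlgebra.lift (sι ∘ₗ e)

@[simp] theorem symMap_ι (e : W →ₗ[ℂ] W') (w : W) : symMap e (sι w) = sι (e w) := by
  simp [symMap]

/-- `p ↦ p(· + T f)`, for a point `f ∈ W*` and a formal parameter `T`. -/
def shift (f : W →ₗ[ℂ] ℂ) : Sy W →ₐ[ℂ] (Sy W)[X] :=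
  SymmetricAlgebra.lift
    { toFun := fun w => Polynomial.C (sι w) + Polynomial.C (algebraMap ℂ (Sy W) (f w)) * Polynomial.X
      map_add' := fun a b => by simp only [map_add]; ring
      map_smul' := fun r a => by
        simp only [map_smul, smul_eq_mul, map_mul, RingHom.id_apply, Algebra.smul_def,
          Polynomial.algebraMap_apply]
        ring }

@[simp] theorem shift_ι (f : W →ₗ[ℂ] ℂ) (w : W) : shift f (sι w) =
    Polynomial.C (sι w) + Polynomial.C (algebraMap ℂ (Sy W) (f w)) * Polynomial.X := by
  simp [shift]

theorem shift_coeff_zero (f : W →ₗ[ℂ] ℂ) (p : Sy W) : (shift f p).coeff 0 = p := by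
  induction p using sy_induction with
  | one => simp
  | add p q hp hq => simp [hp, hq]
  | smul r p hp => simp [hp]
  | mul w p hp => simp [hp]

/-- The directional derivative `∂_f` of polynomial functions on `W*` in the direction `f ∈ W*`:
the coefficient of `T` in `p(· + T f)`. -/
def dd (f : W →ₗ[ℂ] ℂ) : Sy W →ₗ[ℂ] Sy W where
  toFun p := (shift f p).coeff 1
  map_add' p q := by simp
  map_smul' r p := by simp

theorem dd_apply (f : W →ₗ[ℂ] ℂ) (p : Sy W) : dd f p = (shift f p).coeff 1 := rfl

@[simp] theorem dd_one (f : W →ₗ[ℂ] ℂ) : dd f 1 = 0 := by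
  simp [dd_apply, Polynomial.coeff_one]

@[simp] theorem dd_ι (f : W →ₗ[ℂ] ℂ) (w : W) : dd f (sι w) = algebraMap ℂ (Sy W) (f w) := by
  simp [dd_apply, -Polynomial.coeff_C_succ, Polynomial.coeff_C]

theorem dd_ι_mul (f : W →ₗ[ℂ] ℂ) (w : W) (p : Sy W) :
    dd f (sι w * p) = sι w * dd f p + f w • p := by
  simp only [dd_apply, map_mul, Polynomial.mul_coeff_one, shift_coeff_zero]
  rw [← dd_apply, ← dd_apply, dd_ι, Algebra.smul_def]

theorem dd_mul (f : W →ₗ[ℂ] ℂ) (p q : Sy W) : dd f (p * q) = p * dd f q + dd f p * q := by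
  simp only [dd_apply, map_mul, Polynomial.mul_coeff_one, shift_coeff_zero]

theorem dd_pow_succ (f : W →ₗ[ℂ] ℂ) (p : Sy W) (n : ℕ) :
    dd f (p ^ (n + 1)) = ((n : ℂ) + 1) • (p ^ n * dd f p) := by
  induction n with
  | zero => simp
  | succ n ih =>
    rw [pow_succ, dd_mul, ih]
    simp only [Algebra.smul_def]
    simp only [Nat.cast_add, Nat.cast_one, map_add, map_one]
    ring

theorem dd_add (f g : W →ₗ[ℂ] ℂ) (p : Sy W) : dd (f + g) p = dd f p + dd g p := by
  induction p using sy_induction with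
  | one => simp
  | add p q hp hq => simp only [map_add, hp, hq]; abel
  | smul r p hp => simp only [map_smul, hp, smul_add]
  | mul w p hp => simp only [dd_ι_mul, hp, LinearMap.add_apply, add_smul, mul_add]; abel

theorem dd_smul (r : ℂ) (f : W →ₗ[ℂ] ℂ) (p : Sy W) : dd (r • f) p = r • dd f p := by
  induction p using sy_induction with
  | one => simp
  | add p q hp hq => simp only [map_add, hp, hq, smul_add]
  | smul a p hp => simp only [map_smul, hp, smul_comm a r]
  | mul w p hp =>
    simp only [dd_ι_mul, hp, LinearMap.smul_apply, smul_add, mul_smul_comm, smul_eq_mul, mul_smul]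

theorem dd_comm (f g : W →ₗ[ℂ] ℂ) (p : Sy W) : dd f (dd g p) = dd g (dd f p) := by
  induction p using sy_induction with
  | one => simp
  | add p q hp hq => simp only [map_add, hp, hq]
  | smul r p hp => simp only [map_smul, hp]
  | mul w p hp => simp only [dd_ι_mul, map_add, map_smul, hp]; abel

theorem symMap_dd (e : W →ₗ[ℂ] W') (f : W →ₗ[ℂ] ℂ) (f' : W' →ₗ[ℂ] ℂ) (h : ∀ w, f' (e w) = f w)
    (p : Sy W) : symMap e (dd f p) = dd f' (symMap e p) := by
  induction p using sy_induction with
  | one => simp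
  | add p q hp hq => simp only [map_add, hp, hq]
  | smul r p hp => simp only [map_smul, hp]
  | mul w p hp => simp only [dd_ι_mul, map_add, map_smul, map_mul, hp, symMap_ι, h]

/-- Formal integration `P ↦ ∫_a^0 P(T) dT`, for `P ∈ (Sym W)[T]` and a limit `a ∈ Sym W`. -/
def intZero (a : Sy W) : (Sy W)[X] →ₗ[ℂ] Sy W :=
  Polynomial.lsum fun n => (-(1 / ((n : ℂ) + 1))) • LinearMap.mulLeft ℂ (a ^ (n + 1))

/-- The line integral `(I p)(v) = ∫_{-d a(v)}^0 p(v + T f) dT` on polynomial functions on `W*`,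
for `a ∈ W`, a direction `f ∈ W*` and a scalar `d`. -/
def lineInt (d : ℂ) (a : W) (f : W →ₗ[ℂ] ℂ) : Sy W →ₗ[ℂ] Sy W :=
  intZero (-(d • sι a)) ∘ₗ (shift f).toLinearMap

/-- The moments `∫_a^0 T^n p(· + T f) dT`. -/
def mom (a : Sy W) (f : W →ₗ[ℂ] ℂ) (n : ℕ) : Sy W →ₗ[ℂ] Sy W :=
  intZero a ∘ₗ LinearMap.mulLeft ℂ (Polynomial.X ^ n) ∘ₗ (shift f).toLinearMap

theorem lineInt_eq (d : ℂ) (a : W) (f : W →ₗ[ℂ] ℂ) (p : Sy W) :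
    lineInt d a f p = mom (-(d • sι a)) f 0 p := by
  simp [lineInt, mom]

theorem intZero_C_mul (a q : Sy W) (P : (Sy W)[X]) :
    intZero a (Polynomial.C q * P) = q * intZero a P := by
  induction P using Polynomial.induction_on' with
  | add P Q hP hQ => simp only [mul_add, map_add, hP, hQ]
  | monomial n r =>
    rw [Polynomial.C_mul_monomial]
    simp only [intZero, Polynomial.lsum_apply]
    rw [Polynomial.sum_monomial_index _ _ (by simp), Polynomial.sum_monomial_index _ _ (by simp)]
    simp only [LinearMap.smul_apply, LinearMap.mulLeft_apply, mul_smul_comm]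
    congr 1; ring

theorem mom_one (a : Sy W) (f : W →ₗ[ℂ] ℂ) (n : ℕ) :
    mom a f n 1 = (-(1 / ((n : ℂ) + 1))) • a ^ (n + 1) := by
  simp only [mom, LinearMap.comp_apply, AlgHom.toLinearMap_apply, map_one,
    LinearMap.mulLeft_apply, mul_one, intZero, Polynomial.lsum_apply]
  rw [← Polynomial.monomial_one_right_eq_X_pow, Polynomial.sum_monomial_index _ _ (by simp)]
  simp

theorem mom_ι_mul (a : Sy W) (f : W →ₗ[ℂ] ℂ) (n : ℕ) (w : W) (p : Sy W) :
    mom a f n (sι w * p) = sι w * mom a f n p + f w • mom a f (n + 1) p := by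
  simp only [mom, LinearMap.comp_apply, AlgHom.toLinearMap_apply, map_mul, shift_ι,
    LinearMap.mulLeft_apply]
  rw [Algebra.smul_def, ← intZero_C_mul, ← intZero_C_mul, ← map_add]
  congr 1
  ring

/-- Differentiation under the integral sign. -/
theorem dd_mom (a : Sy W) (f y : W →ₗ[ℂ] ℂ) (b : ℂ) (hb : dd y a = algebraMap ℂ _ b)
    (e : W →ₗ[ℂ] W) (he : ∀ w, sι (e w) = sι w + f w • a) (p : Sy W) : ∀ n,
    dd y (mom a f n p) = mom a f n (dd y p) - b • (a ^ n * symMap e p) := by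
  induction p using sy_induction with
  | one =>
    intro n
    have h : ((n : ℂ) + 1) ≠ 0 := by exact_mod_cast Nat.succ_ne_zero n
    rw [mom_one, map_smul, dd_pow_succ, hb, smul_smul,
      show -(1 / ((n : ℂ) + 1)) * ((n : ℂ) + 1) = -1 by field_simp]
    simp [Algebra.smul_def, mul_comm]
  | add p q hp hq => intro n; simp only [map_add, hp, hq, mul_add, smul_add]; abel
  | smul r p hp =>
    intro n
    simp only [map_smul, hp, smul_sub, mul_smul_comm, smul_comm b r]
  | mul w p hp =>
    intro n
    simp only [mom_ι_mul, dd_ι_mul, map_add, map_smul, hp, map_mul, symMap_ι, he]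
    simp only [Algebra.smul_def]
    ring

theorem symMap_mom (e : W →ₗ[ℂ] W') (a : Sy W) (f : W →ₗ[ℂ] ℂ) (f' : W' →ₗ[ℂ] ℂ)
    (h : ∀ w, f' (e w) = f w) (p : Sy W) : ∀ n,
    symMap e (mom a f n p) = mom (symMap e a) f' n (symMap e p) := by
  induction p using sy_induction with
  | one => intro n; simp [mom_one]
  | add p q hp hq => intro n; simp only [map_add, hp, hq]
  | smul r p hp => intro n; simp only [map_smul, hp]
  | mul w p hp => intro n; simp only [mom_ι_mul, map_add, map_smul, map_mul, hp, symMap_ι, h]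

theorem mom_scale (a : Sy W) (f : W →ₗ[ℂ] ℂ) (k : ℂ) (p : Sy W) : ∀ n,
    k ^ (n + 1) • mom a (k • f) n p = mom (k • a) f n p := by
  induction p using sy_induction with
  | one => intro n; simp only [mom_one, smul_pow, smul_comm (k ^ (n + 1))]
  | add p q hp hq => intro n; simp only [map_add, smul_add, hp, hq]
  | smul r p hp => intro n; simp only [map_smul, smul_comm (k ^ (n + 1)) r, hp]
  | mul w p hp =>
    intro n
    rw [mom_ι_mul, mom_ι_mul, ← hp, ← hp, smul_add, mul_smul_comm, LinearMap.smul_apply,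
      smul_smul, smul_smul, smul_eq_mul]
    congr 2; ring

theorem mom_eval_zero (a : Sy W) (ha : SymmetricAlgebra.algebraMapInv a = 0) (f : W →ₗ[ℂ] ℂ)
    (p : Sy W) : ∀ n, SymmetricAlgebra.algebraMapInv (mom a f n p) = 0 := by
  induction p using sy_induction with
  | one => intro n; simp [mom_one, ha]
  | add p q hp hq => intro n; simp only [map_add, hp, hq, add_zero]
  | smul r p hp => intro n; simp only [map_smul, hp, smul_zero]
  | mul w p hp => intro n; simp only [mom_ι_mul, map_add, map_smul, map_mul, hp]; simp

theorem lineInt_dd (d : ℂ) (a : W) (f y : W →ₗ[ℂ] ℂ) (e : W →ₗ[ℂ] W)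
    (he : ∀ w, e w = w - (d * f w) • a) (p : Sy W) :
    dd y (lineInt d a f p) = lineInt d a f (dd y p) + (d * y a) • symMap e p := by
  rw [lineInt_eq, lineInt_eq, dd_mom _ f y (-(d * y a)) _ e]
  · simp
  · intro w; rw [he]; simp [sub_eq_add_neg, mul_comm d, mul_smul]
  · rw [map_neg, map_smul, dd_ι, map_neg, map_mul, Algebra.smul_def]

theorem lineInt_map (e : W →ₗ[ℂ] W') (d : ℂ) (a : W) (f : W →ₗ[ℂ] ℂ) (f' : W' →ₗ[ℂ] ℂ)
    (h : ∀ w, f' (e w) = f w) (p : Sy W) :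
    symMap e (lineInt d a f p) = lineInt d (e a) f' (symMap e p) := by
  rw [lineInt_eq, lineInt_eq, symMap_mom e _ f f' h]; simp

theorem lineInt_scale (d : ℂ) (a : W) (f : W →ₗ[ℂ] ℂ) (k : ℂ) (p : Sy W) :
    lineInt d (k • a) f p = k • lineInt d a (k • f) p := by
  rw [lineInt_eq, lineInt_eq]
  have := mom_scale (-(d • sι a)) f k p 0
  rw [zero_add, pow_one] at this
  rw [this]; simp [smul_comm d k]

theorem lineInt_eval_zero (d : ℂ) (a : W) (f : W →ₗ[ℂ] ℂ) (p : Sy W) :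
    SymmetricAlgebra.algebraMapInv (lineInt d a f p) = 0 := by
  rw [lineInt_eq]; apply mom_eval_zero; simp [SymmetricAlgebra.algebraMapInv]

/-- `killed n p`: all `n`-fold derivatives of `p` vanish. -/
def killed : ℕ → Sy W → Prop
  | 0, p => p = 0
  | n + 1, p => ∀ f, killed n (dd f p)

theorem killed_zero (n : ℕ) : killed n (0 : Sy W) := by
  induction n with
  | zero => rfl
  | succ n ih => intro f; simpa using ih

theorem killed_add (n : ℕ) : ∀ {p q : Sy W}, killed n p → killed n q → killed n (p + q) := by
  induction n with
  | zero => intro p q hp hq; simp_all [killed]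
  | succ n ih => intro p q hp hq f; rw [map_add]; exact ih (hp f) (hq f)

theorem killed_smul (n : ℕ) (r : ℂ) : ∀ {p : Sy W}, killed n p → killed n (r • p) := by
  induction n with
  | zero => intro p hp; simp_all [killed]
  | succ n ih => intro p hp f; rw [map_smul]; exact ih (hp f)

theorem killed_succ (n : ℕ) : ∀ {p : Sy W}, killed n p → killed (n + 1) p := by
  induction n with
  | zero => intro p hp f; simp_all [killed]
  | succ n ih => intro p hp f; exact ih (hp f)

theorem killed_mono {m n : ℕ} (h : m ≤ n) {p : Sy W} (hp : killed m p) : killed n p := by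
  induction n, h using Nat.le_induction with
  | base => exact hp
  | succ n _ ih => exact killed_succ n ih

theorem killed_mul (w : W) (n : ℕ) : ∀ {p : Sy W}, killed n p → killed (n + 1) (sι w * p) := by
  induction n with
  | zero => intro p hp f; simp_all [killed]
  | succ n ih =>
    intro p hp f
    rw [dd_ι_mul]
    exact killed_add _ (ih (hp f)) (killed_smul _ _ hp)

theorem exists_killed (p : Sy W) : ∃ n, killed n p := by
  induction p using sy_induction with
  | one => exact ⟨1, fun f => by simp [killed]⟩
  | add p q hp hq =>
    obtain ⟨m, hm⟩ := hp
    obtain ⟨n, hn⟩ := hq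
    exact ⟨max m n, killed_add _ (killed_mono (le_max_left _ _) hm)
      (killed_mono (le_max_right _ _) hn)⟩
  | smul r p hp => obtain ⟨m, hm⟩ := hp; exact ⟨m, killed_smul _ _ hm⟩
  | mul w p hp => obtain ⟨m, hm⟩ := hp; exact ⟨m + 1, killed_mul w m hm⟩

/-- A polynomial function all of whose derivatives vanish is constant. -/
theorem eq_const [FiniteDimensional ℂ W] (p : Sy W) (h : ∀ f, dd f p = 0) :
    p = algebraMap ℂ _ (SymmetricAlgebra.algebraMapInv p) := by
  classical
  let b := Module.finBasis ℂ W
  let S : W →ₗ[ℂ] (Sy W)[X] :=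
    { toFun := fun w => Polynomial.C (sι w) * Polynomial.X
      map_add' := fun a b => by simp only [map_add]; ring
      map_smul' := fun r a => by
        simp only [map_smul, RingHom.id_apply, Algebra.smul_def,
          Polynomial.algebraMap_apply, mul_assoc, map_mul] }
  let φ : Sy W →ₐ[ℂ] (Sy W)[X] := SymmetricAlgebra.lift S
  have hφ : ∀ w, φ (sι w) = Polynomial.C (sι w) * Polynomial.X := fun w => by simp [φ, S]
  have key : ∀ q : Sy W, Polynomial.X * Polynomial.derivative (φ q) =
      φ (∑ i, sι (b i) * dd (b.coord i) q) := by
    intro q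
    induction q using sy_induction with
    | one => simp
    | add p q hp hq =>
      simp only [map_add, mul_add, hp, hq, Finset.sum_add_distrib]
    | smul r p hp =>
      simp only [map_smul, Polynomial.derivative_smul, mul_smul_comm, hp, map_sum, Finset.smul_sum,
        map_mul]
    | mul w p hp =>
      have e1 : ∑ i, sι (b i) * dd (b.coord i) (sι w * p) =
          sι w * ∑ i, sι (b i) * dd (b.coord i) p + sι w * p := by
        have hw : sι w = ∑ i, (b.coord i w) • sι (b i) := by
          conv_lhs => rw [← b.sum_repr w]
          simp only [map_sum, map_smul, Module.Basis.coord_apply]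
        conv_rhs => rw [Finset.mul_sum, hw, Finset.sum_mul (f := fun i => (b.coord i w) • sι (b i)),
          ← hw, ← Finset.sum_add_distrib]
        refine Finset.sum_congr rfl fun i _ => ?_
        rw [dd_ι_mul]
        simp only [Algebra.smul_def]
        ring
      rw [e1, map_add, map_mul φ, map_mul φ, ← hp, hφ]
      simp only [Polynomial.derivative_mul, Polynomial.derivative_C, Polynomial.derivative_X]
      ring
  have h0 := key p
  simp only [h, mul_zero, Finset.sum_const_zero, map_zero] at h0
  have h1 : Polynomial.derivative (φ p) = 0 := by
    ext n
    have := congrArg (fun P => P.coeff (n + 1)) h0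
    simpa [Polynomial.coeff_X_mul] using this
  have h2 : φ p = Polynomial.C ((φ p).coeff 0) := by
    ext n
    cases n with
    | zero => simp
    | succ n =>
      have h3 := congrArg (fun P => P.coeff n) h1
      simp only [Polynomial.coeff_derivative, Polynomial.coeff_zero] at h3
      rw [Polynomial.coeff_C_succ]
      have h4 : ((n : Sy W) + 1) = algebraMap ℂ (Sy W) ((n : ℂ) + 1) := by simp
      rw [h4, mul_comm, ← Algebra.smul_def] at h3
      exact (smul_eq_zero.mp h3).resolve_left (by exact_mod_cast Nat.succ_ne_zero n)
  have e1 : ∀ q : Sy W, (φ q).eval 1 = q := by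
    intro q
    induction q using sy_induction with
    | one => simp
    | add p q hp hq => simp [hp, hq]
    | smul r p hp => simp [hp]
    | mul w p hp => simp [hp, hφ]
  have e2 : ∀ q : Sy W, (φ q).coeff 0 = algebraMap ℂ _ (SymmetricAlgebra.algebraMapInv q) := by
    intro q
    induction q using sy_induction with
    | one => simp
    | add p q hp hq => simp [hp, hq]
    | smul r p hp => simp [hp, Algebra.smul_def]
    | mul w p hp => simp [hφ, SymmetricAlgebra.algebraMapInv]
  rw [← e2]
  conv_lhs => rw [← e1 p, h2]
  simp

end Calculus

/-! ### Reflection groups and parameters -/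

section Group

variable {V : Type u} [AddCommGroup V] [Module ℂ V]

/-- A complex reflection: `s - 1` has rank one. -/
def IsReflection (s : V ≃ₗ[ℂ] V) : Prop :=
  Module.finrank ℂ (LinearMap.range (s.toLinearMap - LinearMap.id)) = 1

/-- The set `𝒮` of reflections of `G`. -/
abbrev Refl (G : Subgroup (V ≃ₗ[ℂ] V)) : Type u := {s : G // IsReflection (s : V ≃ₗ[ℂ] V)}

instance (G : Subgroup (V ≃ₗ[ℂ] V)) [Finite G] : Fintype (Refl G) := Fintype.ofFinite _

/-- The tautological representation of `G` on `𝔥 = V`. -/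
def std (G : Subgroup (V ≃ₗ[ℂ] V)) : Representation ℂ G V :=
  LinearEquiv.automorphismGroup.toLinearMapMonoidHom.comp G.subtype

@[simp] theorem std_apply (G : Subgroup (V ≃ₗ[ℂ] V)) (g : G) (v : V) :
    std G g v = (g : V ≃ₗ[ℂ] V) v := rfl

/-- The action of `G` on `𝔥*`: `(g x)(y) = x(g⁻¹ y)`. -/
abbrev costd (G : Subgroup (V ≃ₗ[ℂ] V)) : Representation ℂ G (Module.Dual ℂ V) := (std G).dual

theorem costd_apply (G : Subgroup (V ≃ₗ[ℂ] V)) (g : G) (x : Module.Dual ℂ V) (y : V) :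
    costd G g x y = x (std G g⁻¹ y) := rfl

/-- The data entering the rational Cherednik algebra of `G`: for every reflection `s` its
nontrivial eigenvalue `λ_s` on `𝔥*` (so `λ_s⁻¹` on `𝔥`) with eigenvectors
`α_s ∈ 𝔥*`, `α_s^∨ ∈ 𝔥`, normalised by `α_s(α_s^∨) = 2`; a number `t`; and a conjugation invariant
function `c` on the reflections. -/
structure Datum (G : Subgroup (V ≃ₗ[ℂ] V)) where
  lam : Refl G → ℂ
  root : Refl G → Module.Dual ℂ V
  coroot : Refl G → V
  lam_ne_one : ∀ s, lam s ≠ 1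
  root_eigen : ∀ s, costd G s.1 (root s) = lam s • root s
  coroot_eigen : ∀ s, std G s.1 (coroot s) = (lam s)⁻¹ • coroot s
  root_coroot : ∀ s, root s (coroot s) = 2
  t : ℂ
  c : Refl G → ℂ
  c_conj : ∀ (g : G) (s s' : Refl G), s'.1 = g * s.1 * g⁻¹ → c s' = c s

/-- `g s g⁻¹` is a reflection. -/
theorem isReflection_conj (g s : V ≃ₗ[ℂ] V) (h : IsReflection s) : IsReflection (g * s * g⁻¹) := by
  unfold IsReflection at *
  rw [← h]
  have e : (LinearMap.range ((g * s * g⁻¹ : V ≃ₗ[ℂ] V).toLinearMap - LinearMap.id)) =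
      (LinearMap.range (s.toLinearMap - LinearMap.id)).map g.toLinearMap := by
    ext v
    constructor
    · rintro ⟨w, rfl⟩
      refine ⟨_, ⟨g⁻¹ w, rfl⟩, ?_⟩
      simp only [LinearMap.sub_apply, LinearEquiv.coe_coe, map_sub, LinearMap.id_apply,
        LinearEquiv.mul_apply]
      congr 1
      exact LinearEquiv.apply_symm_apply g w
    · rintro ⟨_, ⟨w, rfl⟩, rfl⟩
      refine ⟨g w, ?_⟩
      simp only [LinearMap.sub_apply, LinearEquiv.coe_coe, map_sub, LinearMap.id_apply,
        LinearEquiv.mul_apply]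
      congr 3
      exact LinearEquiv.symm_apply_apply g w
  rw [e]
  exact LinearEquiv.finrank_map_eq g _

/-- Conjugation of reflections by a group element. -/
def conj {G : Subgroup (V ≃ₗ[ℂ] V)} (g : G) : Refl G ≃ Refl G where
  toFun s := ⟨g * s.1 * g⁻¹, isReflection_conj _ _ s.2⟩
  invFun s := ⟨g⁻¹ * s.1 * g, by simpa using isReflection_conj (g : V ≃ₗ[ℂ] V)⁻¹ _ s.2⟩
  left_inv s := by ext1; simp [mul_assoc]
  right_inv s := by ext1; simp [mul_assoc]

variable {G : Subgroup (V ≃ₗ[ℂ] V)} (D : Datum G)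

namespace Datum

/-- `d_s = (1 - λ_s) / 2`. -/
def d (s : Refl G) : ℂ := (1 - D.lam s) / 2

/-- `d_s^∨ = (1 - λ_s⁻¹) / 2`. -/
def dv (s : Refl G) : ℂ := (1 - (D.lam s)⁻¹) / 2

theorem d_ne_zero (s : Refl G) : D.d s ≠ 0 := by
  have := D.lam_ne_one s
  unfold d
  exact div_ne_zero (sub_ne_zero.mpr this.symm) two_ne_zero

theorem coroot_ne_zero (s : Refl G) : D.coroot s ≠ 0 := by
  intro h
  have := D.root_coroot s
  simp [h] at this

theorem root_ne_zero (s : Refl G) : D.root s ≠ 0 := by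
  intro h
  have := D.root_coroot s
  simp [h] at this

theorem lam_ne_zero (s : Refl G) : D.lam s ≠ 0 := by
  intro h
  have h1 := D.coroot_eigen s
  rw [h, inv_zero, zero_smul] at h1
  exact D.coroot_ne_zero s ((LinearEquiv.map_eq_zero_iff (s.1 : V ≃ₗ[ℂ] V)).mp h1)

/-- `d_s^∨ = - λ_s⁻¹ d_s`. -/
theorem dv_eq (s : Refl G) : D.dv s = -(D.lam s)⁻¹ * D.d s := by
  have := D.lam_ne_zero s
  unfold d dv; field_simp; ring

/-- `α_s(s y) = λ_s⁻¹ α_s(y)`. -/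
theorem root_refl (s : Refl G) (y : V) : D.root s (std G s.1 y) = (D.lam s)⁻¹ * D.root s y := by
  have h := congrArg (fun x => x (std G s.1 y)) (D.root_eigen s)
  simp only [costd_apply, LinearMap.smul_apply, smul_eq_mul] at h
  have h2 : std G (s.1)⁻¹ (std G s.1 y) = y := by
    rw [← Module.End.mul_apply, ← map_mul]; simp
  rw [h2] at h
  rw [h, inv_mul_cancel_left₀ (D.lam_ne_zero s)]

/-- `s(y) = y - d_s^∨ α_s(y) α_s^∨`. -/
theorem refl_apply (s : Refl G) (y : V) :
    std G s.1 y = y - (D.dv s * D.root s y) • D.coroot s := by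
  have hs := s.2
  unfold IsReflection at hs
  have hl : (D.lam s)⁻¹ - 1 ≠ 0 := sub_ne_zero.mpr (by
    intro h; exact D.lam_ne_one s (by rw [← inv_inv (D.lam s), h, inv_one]))
  have hm : D.coroot s ∈ LinearMap.range ((s.1 : V ≃ₗ[ℂ] V).toLinearMap - LinearMap.id) := by
    refine ⟨((D.lam s)⁻¹ - 1)⁻¹ • D.coroot s, ?_⟩
    have h1 := D.coroot_eigen s
    rw [std_apply] at h1
    rw [map_smul, LinearMap.sub_apply, LinearEquiv.coe_coe, h1, LinearMap.id_apply]
    nth_rewrite 2 [← one_smul ℂ (D.coroot s)]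
    rw [← sub_smul, smul_smul, inv_mul_cancel₀ hl, one_smul]
  have hne : (⟨D.coroot s, hm⟩ : LinearMap.range ((s.1 : V ≃ₗ[ℂ] V).toLinearMap -
      LinearMap.id)) ≠ 0 := fun h => D.coroot_ne_zero s (congrArg Subtype.val h)
  obtain ⟨k, hk⟩ := (finrank_eq_one_iff_of_nonzero' _ hne).mp hs ⟨std G s.1 y - y, ⟨y, rfl⟩⟩
  have hk' : k • D.coroot s = std G s.1 y - y := congrArg Subtype.val hk
  have h2 := congrArg (D.root s) hk'
  rw [map_smul, map_sub, root_refl, D.root_coroot, smul_eq_mul] at h2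
  have h3 : k = -(D.dv s * D.root s y) := by unfold dv; linear_combination h2 / 2
  have h4 : std G s.1 y = y + k • D.coroot s := by rw [hk']; abel
  rw [h4, h3, neg_smul]; abel

/-- `s(x) = x - d_s x(α_s^∨) α_s`. -/
theorem refl_apply_dual (s : Refl G) (x : Module.Dual ℂ V) :
    costd G s.1 x = x - (D.d s * x (D.coroot s)) • D.root s := by
  ext y
  obtain ⟨y, rfl⟩ : ∃ z, y = std G s.1 z := ⟨std G (s.1)⁻¹ y, by
    rw [← Module.End.mul_apply, ← map_mul]; simp⟩
  rw [costd_apply, ← Module.End.mul_apply, ← map_mul, inv_mul_cancel, map_one,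
    Module.End.one_apply, LinearMap.sub_apply, LinearMap.smul_apply, root_refl, refl_apply D,
    map_sub, map_smul, dv_eq]
  simp only [smul_eq_mul]; ring

/-- Comparison of the eigenvectors of `s` and of `g s g⁻¹`. -/
theorem exists_scale (g : G) (s : Refl G) : ∃ k : ℂ, k ≠ 0 ∧
    std G g (D.coroot s) = k • D.coroot (conj g s) ∧
    k • costd G g (D.root s) = D.root (conj g s) ∧ D.lam (conj g s) = D.lam s := by
  set s' := conj g s with hs'
  have hconj : ∀ y, std G s'.1 (std G g y) = std G g (std G s.1 y) := by
    intro y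
    rw [← Module.End.mul_apply, ← Module.End.mul_apply, ← map_mul, ← map_mul]
    simp [hs', conj]
  have hl : (D.lam s)⁻¹ - 1 ≠ 0 := sub_ne_zero.mpr (by
    intro h; exact D.lam_ne_one s (by rw [← inv_inv (D.lam s), h, inv_one]))
  have h1 := hconj (D.coroot s)
  rw [D.coroot_eigen, map_smul, refl_apply D] at h1
  have h2 : std G g (D.coroot s) = (-(((D.lam s)⁻¹ - 1)⁻¹ * (D.dv s' *
      D.root s' (std G g (D.coroot s))))) • D.coroot s' := by
    have h3 : ((D.lam s)⁻¹ - 1) • std G g (D.coroot s) =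
      -((D.dv s' * D.root s' (std G g (D.coroot s))) • D.coroot s') := by
      rw [sub_smul, one_smul, ← h1]; abel
    rw [neg_smul, mul_smul, ← smul_neg, ← h3, smul_smul, inv_mul_cancel₀ hl, one_smul]
  set k := -(((D.lam s)⁻¹ - 1)⁻¹ * (D.dv s' * D.root s' (std G g (D.coroot s)))) with hk
  have hgi : ∀ y, std G g⁻¹ (std G g y) = y := fun y => by
    rw [← Module.End.mul_apply, ← map_mul]; simp
  have hgi' : ∀ y, std G g (std G g⁻¹ y) = y := fun y => by
    rw [← Module.End.mul_apply, ← map_mul]; simp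
  have hk0 : k ≠ 0 := by
    intro h0
    rw [h0, zero_smul] at h2
    apply D.coroot_ne_zero s
    rw [← hgi (D.coroot s), h2, map_zero]
  have hlam : D.lam s' = D.lam s := by
    have h4 := hconj (D.coroot s)
    rw [D.coroot_eigen, map_smul, h2, map_smul, D.coroot_eigen, smul_smul, smul_smul] at h4
    have h5 := smul_left_injective ℂ (D.coroot_ne_zero s') h4
    rw [mul_comm] at h5
    exact inv_injective (mul_right_cancel₀ hk0 h5)
  refine ⟨k, hk0, h2, ?_, hlam⟩
  ext y
  have h6 := hconj (std G g⁻¹ y)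
  rw [hgi', refl_apply D, refl_apply D, map_sub, hgi', map_smul, h2, smul_smul] at h6
  have h7 := smul_left_injective ℂ (D.coroot_ne_zero s') (sub_right_injective h6)
  have hdv : D.dv s' = D.dv s := by unfold dv; rw [hlam]
  have hdv0 : D.dv s ≠ 0 := by
    rw [dv_eq]
    exact mul_ne_zero (neg_ne_zero.mpr (inv_ne_zero (D.lam_ne_zero s))) (D.d_ne_zero s)
  rw [hdv, mul_assoc] at h7
  rw [LinearMap.smul_apply, costd_apply, smul_eq_mul, mul_comm]
  exact (mul_left_cancel₀ hdv0 h7).symm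

end Datum

/-! ### The rational Cherednik algebra -/

/-- Generators: `y ∈ 𝔥`, `x ∈ 𝔥*` and `g ∈ G`. -/
inductive Gen (G : Subgroup (V ≃ₗ[ℂ] V)) : Type u
  | y (v : V) : Gen G
  | x (f : Module.Dual ℂ V) : Gen G
  | g (g : G) : Gen G

/-- A generator in the free algebra. -/
abbrev gen (a : Gen G) : FreeAlgebra ℂ (Gen G) := FreeAlgebra.ι ℂ a

/-- The relations: linearity of the generators in `𝔥` and `𝔥*`, multiplicativity of those in `G`,
and the defining relations of the rational Cherednik algebra. -/
inductive Rel [Finite G] : FreeAlgebra ℂ (Gen G) → FreeAlgebra ℂ (Gen G) → Prop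
  | y_add (v w : V) : Rel (gen (.y (v + w))) (gen (.y v) + gen (.y w))
  | y_smul (r : ℂ) (v : V) : Rel (gen (.y (r • v))) (r • gen (.y v))
  | x_add (v w : Module.Dual ℂ V) : Rel (gen (.x (v + w))) (gen (.x v) + gen (.x w))
  | x_smul (r : ℂ) (v : Module.Dual ℂ V) : Rel (gen (.x (r • v))) (r • gen (.x v))
  | g_one : Rel (gen (.g 1)) 1
  | g_mul (g h : G) : Rel (gen (.g (g * h))) (gen (.g g) * gen (.g h))
  | yy (v w : V) : Rel (gen (.y v) * gen (.y w)) (gen (.y w) * gen (.y v))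
  | xx (v w : Module.Dual ℂ V) : Rel (gen (.x v) * gen (.x w)) (gen (.x w) * gen (.x v))
  | gy (g : G) (v : V) : Rel (gen (.g g) * gen (.y v)) (gen (.y (std G g v)) * gen (.g g))
  | gx (g : G) (v : Module.Dual ℂ V) :
      Rel (gen (.g g) * gen (.x v)) (gen (.x (costd G g v)) * gen (.g g))
  | yx (v : V) (w : Module.Dual ℂ V) :
      Rel (gen (.y v) * gen (.x w) - gen (.x w) * gen (.y v))
        ((D.t * w v) • 1 -
          ∑ s : Refl G, (D.c s * D.root s v * w (D.coroot s)) • gen (.g s.1))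

/-- The rational Cherednik algebra `H_{t,c}(G, 𝔥)`. -/
def H [Finite G] : Type u := RingQuot (Rel D)

variable [Finite G]

instance : Ring (H D) := inferInstanceAs (Ring (RingQuot (Rel D)))

instance : Algebra ℂ (H D) := inferInstanceAs (Algebra ℂ (RingQuot (Rel D)))

/-- The element of `H_{t,c}` given by a generator. -/
def H.of (a : Gen G) : H D := RingQuot.mkAlgHom ℂ (Rel D) (gen a)

end Group

/-! ### Integral-reflection modules -/

section Action

variable {V : Type u} [AddCommGroup V] [Module ℂ V]

/-- `ℂ[𝔥]`. -/
abbrev Pol (V : Type u) [AddCommGroup V] [Module ℂ V] : Type u := Sy (Module.Dual ℂ V)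

/-- `∂_y` on `ℂ[𝔥]`. -/
abbrev dy (y : V) : Pol V →ₗ[ℂ] Pol V := dd (Module.Dual.eval ℂ V y)

/-- `∂_x` on `ℂ[𝔥*]`. -/
abbrev dx (x : Module.Dual ℂ V) : Sy V →ₗ[ℂ] Sy V := dd x

/-- The representation of a group on the symmetric algebra of a representation. -/
def symRep {Γ W : Type u} [Group Γ] [AddCommGroup W] [Module ℂ W] (ρ : Representation ℂ Γ W) :
    Representation ℂ Γ (Sy W) where
  toFun g := (symMap (ρ g)).toLinearMap
  map_one' := by
    ext p
    induction p using sy_induction with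
    | one => simp
    | add p q hp hq => rw [map_add, hp, hq, map_add]
    | smul r p hp => rw [map_smul, hp, map_smul]
    | mul w p hp =>
      simp only [AlgHom.toLinearMap_apply, Module.End.one_apply, map_mul, symMap_ι] at hp ⊢
      rw [hp]; simp
  map_mul' g h := by
    ext p
    induction p using sy_induction with
    | one => simp
    | add p q hp hq => rw [map_add, hp, hq, map_add]
    | smul r p hp => rw [map_smul, hp, map_smul]
    | mul w p hp =>
      simp only [AlgHom.toLinearMap_apply, Module.End.mul_apply, map_mul, symMap_ι] at hp ⊢
      rw [hp]

theorem symRep_apply {Γ W : Type u} [Group Γ] [AddCommGroup W] [Module ℂ W]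
    (ρ : Representation ℂ Γ W) (g : Γ) (p : Sy W) : symRep ρ g p = symMap (ρ g) p := rfl

variable {G : Subgroup (V ≃ₗ[ℂ] V)} (D : Datum G)

/-- The integral operator `I_s` on `ℂ[𝔥]`:
`(I_s p)(y) = ∫_{-d_s α_s(y)}^0 p(y + T α_s^∨) dT`. -/
def Datum.int (s : Refl G) : Pol V →ₗ[ℂ] Pol V :=
  lineInt (D.d s) (D.root s) (Module.Dual.eval ℂ V (D.coroot s))

/-- The integral operator `I_s^∨` on `ℂ[𝔥*]`:
`(I_s^∨ q)(x) = ∫_{-d_s^∨ x(α_s^∨)}^0 q(x + T α_s) dT`. -/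
def Datum.intv (s : Refl G) : Sy V →ₗ[ℂ] Sy V :=
  lineInt (D.dv s) (D.coroot s) (D.root s)

/-- `[∂_y, I_s] = d_s α_s(y) s`. -/
theorem Datum.dy_int (s : Refl G) (y : V) (p : Pol V) :
    dy y (D.int s p) = D.int s (dy y p) + (D.d s * D.root s y) • symRep (costd G) s.1 p := by
  have h := lineInt_dd (D.d s) (D.root s) (Module.Dual.eval ℂ V (D.coroot s))
    (Module.Dual.eval ℂ V y) (costd G s.1)
    (fun w => by rw [D.refl_apply_dual, Module.Dual.eval_apply]) p
  rw [Module.Dual.eval_apply] at h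
  exact h

/-- `[∂_x, I_s^∨] = d_s^∨ x(α_s^∨) s`. -/
theorem Datum.dx_intv (s : Refl G) (x : Module.Dual ℂ V) (q : Sy V) :
    dx x (D.intv s q) = D.intv s (dx x q) + (D.dv s * x (D.coroot s)) • symRep (std G) s.1 q := by
  exact lineInt_dd (D.dv s) (D.coroot s) (D.root s) x (std G s.1) (fun w => D.refl_apply s w) q

theorem std_inv_std (g : G) (y : V) : std G g⁻¹ (std G g y) = y := by
  rw [← Module.End.mul_apply, ← map_mul]; simp

theorem std_std_inv (g : G) (y : V) : std G g (std G g⁻¹ y) = y := by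
  rw [← Module.End.mul_apply, ← map_mul]; simp

theorem costd_std (g : G) (x : Module.Dual ℂ V) (y : V) : costd G g x (std G g y) = x y := by
  rw [costd_apply, std_inv_std]

theorem Datum.symRep_int (g : G) (s : Refl G) (x : Module.Dual ℂ V) (p : Pol V) :
    (D.c s / D.d s * x (D.coroot s)) • symRep (costd G) g (D.int s p) =
    (D.c (conj g s) / D.d (conj g s) * costd G g x (D.coroot (conj g s))) •
      D.int (conj g s) (symRep (costd G) g p) := by
  obtain ⟨k, hk, h1, h2, h3⟩ := D.exists_scale g s
  have hc : D.c (conj g s) = D.c s := D.c_conj g s _ rfl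
  have hd : D.d (conj g s) = D.d s := by unfold Datum.d; rw [h3]
  have h4 : x (D.coroot s) = k * costd G g x (D.coroot (conj g s)) := by
    rw [← costd_std g x (D.coroot s), h1, map_smul, smul_eq_mul]
  unfold Datum.int
  rw [symRep_apply, symRep_apply, hc, hd, h4, ← h2, lineInt_scale, smul_smul,
    lineInt_map _ _ _ _ (k • Module.Dual.eval ℂ V (D.coroot (conj g s)))]
  · congr 1; ring
  · intro w
    rw [LinearMap.smul_apply, Module.Dual.eval_apply, Module.Dual.eval_apply, ← map_smul, ← h1,
      costd_std]

theorem Datum.symRep_intv (g : G) (s : Refl G) (p : Sy V) :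
    ∃ k : ℂ, symRep (std G) g (D.intv s p) = k • D.intv (conj g s) (symRep (std G) g p) ∧
      k • costd G g (D.root s) = D.root (conj g s) ∧ D.d (conj g s) = D.d s := by
  obtain ⟨k, hk, h1, h2, h3⟩ := D.exists_scale g s
  have hd : D.d (conj g s) = D.d s := by unfold Datum.d; rw [h3]
  have hdv : D.dv (conj g s) = D.dv s := by unfold Datum.dv; rw [h3]
  refine ⟨k, ?_, h2, hd⟩
  unfold Datum.intv
  rw [symRep_apply, symRep_apply, hdv, ← h2]
  rw [lineInt_map _ _ _ _ (costd G g (D.root s)) (fun w => costd_std g _ w), h1, lineInt_scale]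

variable {U : Type u} [AddCommGroup U] [Module ℂ U] (ρ : Representation ℂ G U)
  (E : Module.Dual ℂ V →ₗ[ℂ] Module.End ℂ U)

/-- `Q(y) = ∂_y ⊗ 1`. -/
def Qy (U : Type u) [AddCommGroup U] [Module ℂ U] (y : V) : Module.End ℂ (Pol V ⊗[ℂ] U) :=
  (dy y).rTensor U

/-- `Q(g) = g ⊗ g`. -/
def Qg (g : G) : Module.End ℂ (Pol V ⊗[ℂ] U) :=
  TensorProduct.map (symRep (costd G) g) (ρ g)

/-- `Q(x) = 1 ⊗ E_x + t μ_x ⊗ 1 - ∑_s (c(s) / d_s) x(α_s^∨) I_s ⊗ s`. -/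
def Qx [Finite G] (x : Module.Dual ℂ V) : Module.End ℂ (Pol V ⊗[ℂ] U) :=
  (E x).lTensor (Pol V) + D.t • (LinearMap.mulLeft ℂ (sι x)).rTensor U -
    ∑ s : Refl G, (D.c s / D.d s * x (D.coroot s)) • TensorProduct.map (D.int s) (ρ s.1)

theorem Qy_tmul (y : V) (p : Pol V) (u : U) : Qy U y (p ⊗ₜ u) = dy y p ⊗ₜ u := rfl

theorem Qg_tmul (g : G) (p : Pol V) (u : U) :
    Qg ρ g (p ⊗ₜ u) = symRep (costd G) g p ⊗ₜ ρ g u := rfl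

theorem Qx_tmul [Finite G] (x : Module.Dual ℂ V) (p : Pol V) (u : U) : Qx D ρ E x (p ⊗ₜ u) =
    p ⊗ₜ E x u + D.t • ((sι x * p) ⊗ₜ u) -
      ∑ s : Refl G, (D.c s / D.d s * x (D.coroot s)) • (D.int s p ⊗ₜ ρ s.1 u) := by
  simp [Qx]

/-- Evaluation at `0 ∈ 𝔥`. -/
def ev (V U : Type u) [AddCommGroup V] [Module ℂ V] [AddCommGroup U] [Module ℂ U] :
    Pol V ⊗[ℂ] U →ₗ[ℂ] U :=
  (TensorProduct.lid ℂ U).toLinearMap ∘ₗ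
    (SymmetricAlgebra.algebraMapInv (R := ℂ) (M := Module.Dual ℂ V)).toLinearMap.rTensor U

theorem ev_tmul (p : Pol V) (u : U) :
    ev V U (p ⊗ₜ u) = SymmetricAlgebra.algebraMapInv p • u := by simp [ev]

theorem ev_Qx [Finite G] (x : Module.Dual ℂ V) (w : Pol V ⊗[ℂ] U) :
    ev V U (Qx D ρ E x w) = E x (ev V U w) := by
  induction w using TensorProduct.induction_on with
  | zero => simp
  | add a b ha hb => rw [map_add, map_add, ha, hb, map_add, map_add]
  | tmul p u =>
    rw [Qx_tmul]
    simp only [map_sub, map_add, map_sum, map_smul, ev_tmul, map_mul,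
      SymmetricAlgebra.algebraMapInv_ι, zero_mul, zero_smul, smul_zero, add_zero, Datum.int,
      lineInt_eval_zero, Finset.sum_const_zero, sub_zero]

theorem ev_Qg (g : G) (w : Pol V ⊗[ℂ] U) : ev V U (Qg ρ g w) = ρ g (ev V U w) := by
  induction w using TensorProduct.induction_on with
  | zero => simp
  | add a b ha hb => rw [map_add, map_add, ha, hb, map_add, map_add]
  | tmul p u =>
    rw [Qg_tmul, ev_tmul, ev_tmul, map_smul]
    congr 1
    rw [symRep_apply]
    induction p using sy_induction with
    | one => simp
    | add p q hp hq => simp only [map_add, hp, hq]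
    | smul r p hp => simp only [map_smul, hp]
    | mul w p hp => simp only [map_mul, symMap_ι, SymmetricAlgebra.algebraMapInv_ι, zero_mul]

/-- An element killed by all `∂_y` is constant along `𝔥`. -/
theorem eq_one_tmul [FiniteDimensional ℂ V] (w : Pol V ⊗[ℂ] U) (h : ∀ y, Qy U y w = 0) :
    w = 1 ⊗ₜ ev V U w := by
  classical
  let b := Module.Basis.ofVectorSpace ℂ U
  let e := TensorProduct.equivFinsuppOfBasisRight (M := Pol V) b
  have he : ∀ y w i, e (Qy U y w) i = dy y (e w i) := by
    intro y w i
    induction w using TensorProduct.induction_on with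
    | zero => simp
    | add a c ha hc => simp only [map_add, Finsupp.add_apply, ha, hc]
    | tmul p u => rw [Qy_tmul]; simp [e]
  have hc : ∀ w i, e ((1 : Pol V) ⊗ₜ[ℂ] ev V U w) i =
      algebraMap ℂ _ (SymmetricAlgebra.algebraMapInv (e w i)) := by
    intro w i
    induction w using TensorProduct.induction_on with
    | zero => simp
    | add a c ha hc => simp only [map_add, TensorProduct.tmul_add, Finsupp.add_apply, ha, hc]
    | tmul p u =>
      rw [ev_tmul]
      simp [e, Algebra.smul_def, mul_comm]
  apply e.injective
  ext1 i
  rw [hc]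
  apply eq_const
  intro f
  obtain ⟨y, rfl⟩ := (Module.evalEquiv ℂ V).surjective f
  have := he y w i
  rw [h y, map_zero] at this
  simpa using this.symm

/-- Local nilpotency of the operators `Q(y)`. -/
theorem exists_Qy_nilpotent (w : Pol V ⊗[ℂ] U) :
    ∃ n, ∀ l : List V, l.length = n → (l.map (Qy U)).prod w = 0 := by
  have key : ∀ n (p : Pol V) (u : U), killed n p →
      ∀ l : List V, n ≤ l.length → (l.reverse.map (Qy U)).prod (p ⊗ₜ u) = 0 := by
    intro n
    induction n with
    | zero => intro p u hp l _; simp [show p = 0 from hp]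
    | succ n ih =>
      intro p u hp l hl
      cases l with
      | nil => simp at hl
      | cons y l =>
        simp only [List.reverse_cons, List.map_append, List.map_cons, List.map_nil,
          List.prod_append, List.prod_cons, List.prod_nil, mul_one, Module.End.mul_apply, Qy_tmul]
        exact ih _ _ (hp _) l (by simpa using hl)
  suffices h : ∃ n, ∀ l : List V, n ≤ l.length → (l.reverse.map (Qy U)).prod w = 0 by
    obtain ⟨n, hn⟩ := h
    exact ⟨n, fun l hl => by have := hn l.reverse (by simp [hl]); rwa [List.reverse_reverse] at this⟩
  induction w using TensorProduct.induction_on with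
  | zero => exact ⟨0, fun l _ => by simp⟩
  | tmul p u => obtain ⟨n, hn⟩ := exists_killed p; exact ⟨n, key n p u hn⟩
  | add a b ha hb =>
    obtain ⟨m, hm⟩ := ha
    obtain ⟨n, hn⟩ := hb
    exact ⟨max m n, fun l hl => by
      rw [map_add, hm l (le_trans (le_max_left _ _) hl), hn l (le_trans (le_max_right _ _) hl),
        add_zero]⟩

/-- An operator commuting with all `∂_y` is determined by its composition with evaluation at `0`. -/
theorem eq_zero_of_ev [FiniteDimensional ℂ V] (C : Module.End ℂ (Pol V ⊗[ℂ] U))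
    (hC : ∀ y, C * Qy U y = Qy U y * C) (h0 : ∀ w, ev V U (C w) = 0) : C = 0 := by
  refine LinearMap.ext fun w => ?_
  suffices h : ∀ n w, (∀ l : List V, l.length = n → (l.map (Qy U)).prod w = 0) → C w = 0 by
    obtain ⟨n, hn⟩ := exists_Qy_nilpotent w
    exact h n w hn
  intro n
  induction n with
  | zero => intro w hw; have := hw [] rfl; simp at this; simp [this]
  | succ n ih =>
    intro w hw
    rw [eq_one_tmul (C w), h0, TensorProduct.tmul_zero]
    intro y
    rw [← Module.End.mul_apply, ← hC, Module.End.mul_apply]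
    apply ih
    intro l hl
    have := hw (l ++ [y]) (by simp [hl])
    simpa using this

theorem Qy_comm (y y' : V) : Qy U y * Qy U y' = Qy U y' * Qy U y := by
  apply TensorProduct.ext'
  intro p u
  simp only [Module.End.mul_apply, Qy_tmul]
  rw [dd_comm]

theorem Qg_Qy (g : G) (y : V) : Qg ρ g * Qy U y = Qy U (std G g y) * Qg ρ g := by
  apply TensorProduct.ext'
  intro p u
  simp only [Module.End.mul_apply, Qy_tmul, Qg_tmul]
  rw [symRep_apply, symRep_apply, symMap_dd _ _ (Module.Dual.eval ℂ V (std G g y))]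
  intro x
  exact costd_std g x y

theorem Qg_Qx [Finite G] (hEg : ∀ g x, ρ g * E x = E (costd G g x) * ρ g) (g : G) (x : Module.Dual ℂ V) :
    Qg ρ g * Qx D ρ E x = Qx D ρ E (costd G g x) * Qg ρ g := by
  apply TensorProduct.ext'
  intro p u
  simp only [Module.End.mul_apply, Qx_tmul, Qg_tmul, map_sub, map_add, map_smul, map_sum]
  congr 1
  · congr 1
    · rw [← Module.End.mul_apply, hEg, Module.End.mul_apply]
    · simp only [symRep_apply, map_mul, symMap_ι]
  · refine Fintype.sum_equiv (conj g) _ _ fun s => ?_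
    have hu : ρ g (ρ s.1 u) = ρ (conj g s).1 (ρ g u) := by
      rw [← Module.End.mul_apply, ← map_mul, ← Module.End.mul_apply, ← map_mul]
      simp [conj]
    rw [TensorProduct.smul_tmul', D.symRep_int g s x p, ← TensorProduct.smul_tmul', hu]

theorem Qy_Qx [Finite G] (y : V) (x : Module.Dual ℂ V) :
    Qy U y * Qx D ρ E x - Qx D ρ E x * Qy U y = (D.t * x y) • 1 -
      ∑ s : Refl G, (D.c s * D.root s y * x (D.coroot s)) • Qg ρ s.1 := by
  apply TensorProduct.ext'
  intro p u
  simp only [Module.End.mul_apply, Qx_tmul, Qg_tmul, Qy_tmul, map_sub, map_add, map_smul, map_sum,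
    LinearMap.sub_apply, LinearMap.smul_apply, LinearMap.sum_apply, Module.End.one_apply]
  have h1 : ∀ s : Refl G, (D.c s / D.d s * x (D.coroot s)) • (dy y (D.int s p) ⊗ₜ[ℂ] ρ s.1 u) =
      (D.c s / D.d s * x (D.coroot s)) • (D.int s (dy y p) ⊗ₜ[ℂ] ρ s.1 u) +
      (D.c s * D.root s y * x (D.coroot s)) • (symRep (costd G) s.1 p ⊗ₜ[ℂ] ρ s.1 u) := by
    intro s
    have := D.d_ne_zero s
    rw [D.dy_int, TensorProduct.add_tmul, smul_add, ← TensorProduct.smul_tmul', smul_smul]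
    congr 2
    field_simp
  simp only [h1, Finset.sum_add_distrib, dd_ι_mul, Module.Dual.eval_apply, TensorProduct.add_tmul,
    smul_add, ← TensorProduct.smul_tmul', smul_smul]
  abel

theorem Qx_add [Finite G] (x x' : Module.Dual ℂ V) :
    Qx D ρ E (x + x') = Qx D ρ E x + Qx D ρ E x' := by
  apply TensorProduct.ext'
  intro p u
  simp only [Qx_tmul, LinearMap.add_apply, map_add, TensorProduct.tmul_add, TensorProduct.add_tmul,
    add_mul, mul_add, add_smul, Finset.sum_add_distrib, smul_add]
  abel

theorem Qx_smul [Finite G] (r : ℂ) (x : Module.Dual ℂ V) : Qx D ρ E (r • x) = r • Qx D ρ E x := by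
  apply TensorProduct.ext'
  intro p u
  simp only [Qx_tmul, LinearMap.smul_apply, map_smul, smul_sub, smul_add, Finset.smul_sum,
    smul_smul, smul_eq_mul, TensorProduct.tmul_smul, smul_mul_assoc, ← TensorProduct.smul_tmul']
  congr 1
  · congr 2; ring
  · refine Finset.sum_congr rfl fun s _ => ?_
    congr 1; ring

theorem Qg_mul (g h : G) : Qg ρ (g * h) = Qg ρ g * Qg ρ h := by
  apply TensorProduct.ext'
  intro p u
  simp [Qg_tmul]

theorem Qg_one : Qg ρ (1 : G) = 1 := by
  apply TensorProduct.ext'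
  intro p u
  simp [Qg_tmul]

/-- Bookkeeping for the commutativity of the `Q(x)`. -/
theorem comm_aux {A ι : Type*} [Ring A] [Algebra ℂ A] [Fintype ι] (Y a b : A) (r g : ι → A)
    (ca cb : ℂ) (p q m n : ι → ℂ) (ha : Y * a = a * Y + (ca • 1 - ∑ s, (p s * m s) • g s))
    (hb : Y * b = b * Y + (cb • 1 - ∑ s, (p s * n s) • g s))
    (hga : ∀ s, g s * a = a * g s - (q s * m s) • (r s * g s))
    (hgb : ∀ s, g s * b = b * g s - (q s * n s) • (r s * g s)) :
    Y * (a * b) - Y * (b * a) = a * b * Y - b * a * Y := by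
  have h1 : Y * (a * b) = a * b * Y + (ca • b + cb • a - ∑ s, ((p s * m s) • (b * g s) +
      (p s * n s) • (a * g s) - (p s * m s * (q s * n s)) • (r s * g s))) := by
    rw [← mul_assoc, ha, add_mul, mul_assoc, hb, mul_add, sub_mul, mul_sub, Finset.sum_mul,
      Finset.mul_sum]
    simp only [smul_mul_assoc, mul_smul_comm, one_mul, mul_one, hgb, smul_sub, smul_smul,
      Finset.sum_add_distrib, Finset.sum_sub_distrib, mul_assoc]
    abel
  have h2 : Y * (b * a) = b * a * Y + (cb • a + ca • b - ∑ s, ((p s * n s) • (a * g s) +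
      (p s * m s) • (b * g s) - (p s * n s * (q s * m s)) • (r s * g s))) := by
    rw [← mul_assoc, hb, add_mul, mul_assoc, ha, mul_add, sub_mul, mul_sub, Finset.sum_mul,
      Finset.mul_sum]
    simp only [smul_mul_assoc, mul_smul_comm, one_mul, mul_one, hga, smul_sub, smul_smul,
      Finset.sum_add_distrib, Finset.sum_sub_distrib, mul_assoc]
    abel
  have h3 : ∑ s, ((p s * m s) • (b * g s) + (p s * n s) • (a * g s) -
      (p s * m s * (q s * n s)) • (r s * g s)) = ∑ s, ((p s * n s) • (a * g s) +
      (p s * m s) • (b * g s) - (p s * n s * (q s * m s)) • (r s * g s)) := by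
    refine Finset.sum_congr rfl fun s _ => ?_
    rw [show p s * m s * (q s * n s) = p s * n s * (q s * m s) by ring, add_comm ((p s * m s) • _)]
  rw [h1, h2, h3]
  abel

theorem Qx_comm [Finite G] [FiniteDimensional ℂ V] (hE : ∀ x x', E x * E x' = E x' * E x)
    (hEg : ∀ g x, ρ g * E x = E (costd G g x) * ρ g) (x x' : Module.Dual ℂ V) :
    Qx D ρ E x * Qx D ρ E x' = Qx D ρ E x' * Qx D ρ E x := by
  rw [← sub_eq_zero]
  apply eq_zero_of_ev
  · intro y
    have hs : ∀ (z : Module.Dual ℂ V) (s : Refl G), Qg ρ s.1 * Qx D ρ E z =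
        Qx D ρ E z * Qg ρ s.1 -
          (D.d s * z (D.coroot s)) • (Qx D ρ E (D.root s) * Qg ρ s.1) := by
      intro z s
      rw [Qg_Qx D ρ E hEg, D.refl_apply_dual, sub_eq_add_neg, ← neg_smul, Qx_add, Qx_smul, add_mul,
        smul_mul_assoc]
      have e1 := neg_smul (D.d s * z (D.coroot s)) (Qx D ρ E (D.root s) * Qg ρ s.1)
      have e2 := sub_eq_add_neg (Qx D ρ E z * Qg ρ s.1)
        ((D.d s * z (D.coroot s)) • (Qx D ρ E (D.root s) * Qg ρ s.1))
      exact (congrArg _ e1).trans e2.symm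
    have hy : ∀ z : Module.Dual ℂ V, Qy U y * Qx D ρ E z = Qx D ρ E z * Qy U y +
        ((D.t * z y) • 1 - ∑ s : Refl G, (D.c s * D.root s y * z (D.coroot s)) • Qg ρ s.1) :=
      fun z => by rw [← Qy_Qx D ρ E]; abel
    have h := comm_aux (Qy U y) (Qx D ρ E x) (Qx D ρ E x') _ _ _ _ _ _ _ _ (hy x) (hy x') (hs x)
      (hs x')
    have e1 := sub_mul (Qx D ρ E x * Qx D ρ E x') (Qx D ρ E x' * Qx D ρ E x) (Qy U y)
    have e2 := mul_sub (Qy U y) (Qx D ρ E x * Qx D ρ E x') (Qx D ρ E x' * Qx D ρ E x)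
    exact e1.trans (h.symm.trans e2.symm)
  · intro w
    rw [LinearMap.sub_apply, map_sub, Module.End.mul_apply, Module.End.mul_apply, ev_Qx, ev_Qx,
      ev_Qx, ev_Qx, ← Module.End.mul_apply, hE, Module.End.mul_apply, sub_self]

/-- The operators attached to the generators. -/
def Qgen [Finite G] : Gen G → Module.End ℂ (Pol V ⊗[ℂ] U)
  | .y v => Qy U v
  | .x f => Qx D ρ E f
  | .g g => Qg ρ g

/-- The action of `H_{t,c}` given by the operators `Q`. -/
def act [Finite G] [FiniteDimensional ℂ V] (hE : ∀ x x', E x * E x' = E x' * E x)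
    (hEg : ∀ g x, ρ g * E x = E (costd G g x) * ρ g) : H D →ₐ[ℂ] Module.End ℂ (Pol V ⊗[ℂ] U) :=
  RingQuot.liftAlgHom ℂ ⟨FreeAlgebra.lift ℂ (Qgen D ρ E), by
    intro a b h
    cases h with
    | y_add v w =>
      simp only [map_add, FreeAlgebra.lift_ι_apply, Qgen]
      apply TensorProduct.ext'; intro p u
      rw [LinearMap.add_apply, Qy_tmul, Qy_tmul, Qy_tmul, dy, map_add, dd_add,
        TensorProduct.add_tmul]
    | y_smul r v =>
      simp only [map_smul, FreeAlgebra.lift_ι_apply, Qgen]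
      apply TensorProduct.ext'; intro p u
      rw [LinearMap.smul_apply, Qy_tmul, Qy_tmul, dy, map_smul, dd_smul,
        TensorProduct.smul_tmul']
    | x_add v w => simp only [map_add, FreeAlgebra.lift_ι_apply, Qgen, Qx_add]
    | x_smul r v => simp only [map_smul, FreeAlgebra.lift_ι_apply, Qgen, Qx_smul]
    | g_one => simp only [map_one, FreeAlgebra.lift_ι_apply, Qgen, Qg_one]
    | g_mul g h => simp only [map_mul, FreeAlgebra.lift_ι_apply, Qgen, Qg_mul]
    | yy v w => simp only [map_mul, FreeAlgebra.lift_ι_apply, Qgen]; exact Qy_comm v w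
    | xx v w => simp only [map_mul, FreeAlgebra.lift_ι_apply, Qgen]; exact Qx_comm D ρ E hE hEg v w
    | gy g v => simp only [map_mul, FreeAlgebra.lift_ι_apply, Qgen]; exact Qg_Qy ρ g v
    | gx g v => simp only [map_mul, FreeAlgebra.lift_ι_apply, Qgen]; exact Qg_Qx D ρ E hEg g v
    | yx v w =>
      simp only [map_mul, map_sub, map_sum, map_smul, map_one, FreeAlgebra.lift_ι_apply, Qgen]
      exact Qy_Qx D ρ E v w⟩

theorem act_of [Finite G] [FiniteDimensional ℂ V] (hE : ∀ x x', E x * E x' = E x' * E x)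
    (hEg : ∀ g x, ρ g * E x = E (costd G g x) * ρ g) (a : Gen G) :
    act D ρ E hE hEg (H.of D a) = Qgen D ρ E a := by
  unfold act H.of
  erw [RingQuot.liftAlgHom_mkAlgHom_apply]
  simp

end Action

section Modules

variable {V : Type u} [AddCommGroup V] [Module ℂ V]
  {G : Subgroup (V ≃ₗ[ℂ] V)} [Finite G] (D : Datum G)

/-- `H_{t,c}` is generated by `𝔥`, `𝔥*` and `G`. -/
theorem H.induction {motive : H D → Prop} (algebraMap : ∀ r : ℂ, motive (algebraMap ℂ (H D) r))
    (of : ∀ a, motive (H.of D a)) (mul : ∀ a b, motive a → motive b → motive (a * b))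
    (add : ∀ a b, motive a → motive b → motive (a + b)) (h : H D) : motive h := by
  obtain ⟨a, rfl⟩ := RingQuot.mkAlgHom_surjective ℂ (Rel D) h
  induction a using FreeAlgebra.induction with
  | grade0 r => rw [AlgHom.commutes]; exact algebraMap r
  | grade1 a => exact of a
  | mul a b ha hb => rw [map_mul]; exact mul _ _ ha hb
  | add a b ha hb => rw [map_add]; exact add _ _ ha hb

/-- A `ℂ`-linear map commuting with the generators is `H_{t,c}`-linear. -/
def mkHLinear {M N : Type u} [AddCommGroup M] [Module ℂ M] [Module (H D) M]
    [IsScalarTower ℂ (H D) M] [AddCommGroup N] [Module ℂ N] [Module (H D) N]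
    [IsScalarTower ℂ (H D) N] (f : M →ₗ[ℂ] N)
    (hf : ∀ a m, f (H.of D a • m) = H.of D a • f m) : M →ₗ[H D] N where
  toFun := f
  map_add' := f.map_add
  map_smul' h := by
    induction h using H.induction with
    | algebraMap r => intro m; simp
    | of a => exact hf a
    | mul a b ha hb =>
      intro m
      simp only [RingHom.id_apply] at ha hb ⊢
      rw [mul_smul, ha, hb, mul_smul]
    | add a b ha hb =>
      intro m
      simp only [RingHom.id_apply] at ha hb ⊢
      rw [add_smul, map_add, ha, hb, add_smul]

variable {τ : Type u} [AddCommGroup τ] [Module ℂ τ] (ρ : Representation ℂ G τ)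

/-! #### The module `𝔐_{t,c}(τ)` -/

/-- The integral-reflection module `𝔐_{t,c}(τ) = ℂ[𝔥] ⊗ τ`. -/
@[nolint unusedArguments]
def MMod (_D : Datum G) (_ρ : Representation ℂ G τ) : Type u := Pol V ⊗[ℂ] τ

instance : AddCommGroup (MMod D ρ) := inferInstanceAs (AddCommGroup (Pol V ⊗[ℂ] τ))

instance : Module ℂ (MMod D ρ) := inferInstanceAs (Module ℂ (Pol V ⊗[ℂ] τ))

/-- `Q(x) = t μ_x ⊗ 1 - ∑_s (c(s) / d_s) x(α_s^∨) I_s ⊗ s`, `Q(y) = ∂_y ⊗ 1`, `Q(g) = g ⊗ g`. -/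
def actM [FiniteDimensional ℂ V] : H D →ₐ[ℂ] Module.End ℂ (MMod D ρ) :=
  act D ρ 0 (fun _ _ => rfl) (fun _ _ => by simp)

instance [FiniteDimensional ℂ V] : Module (H D) (MMod D ρ) :=
  Module.compHom (MMod D ρ) (actM D ρ).toRingHom

theorem MMod.smul_def [FiniteDimensional ℂ V] (h : H D) (v : MMod D ρ) : h • v = actM D ρ h v := rfl

instance [FiniteDimensional ℂ V] : IsScalarTower ℂ (H D) (MMod D ρ) where
  smul_assoc r h v := by rw [MMod.smul_def, map_smul]; rfl

/-! #### The module `𝔛_{t,c}(τ)` -/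

/-- The integral-reflection module `𝔛_{t,c}(τ) = ℂ[𝔥] ⊗ ℂ[𝔥*] ⊗ τ`. -/
@[nolint unusedArguments]
def XMod (_D : Datum G) (_ρ : Representation ℂ G τ) : Type u := Pol V ⊗[ℂ] (Sy V ⊗[ℂ] τ)

instance : AddCommGroup (XMod D ρ) := inferInstanceAs (AddCommGroup (Pol V ⊗[ℂ] (Sy V ⊗[ℂ] τ)))

instance : Module ℂ (XMod D ρ) := inferInstanceAs (Module ℂ (Pol V ⊗[ℂ] (Sy V ⊗[ℂ] τ)))

/-- The diagonal action of `G` on `ℂ[𝔥*] ⊗ τ`. -/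
def uRep : Representation ℂ G (Sy V ⊗[ℂ] τ) := (symRep (std G)).tprod ρ

theorem uRep_tmul (g : G) (q : Sy V) (z : τ) :
    uRep ρ g (q ⊗ₜ z) = symRep (std G) g q ⊗ₜ ρ g z := rfl

/-- `∂_x ⊗ 1` on `ℂ[𝔥*] ⊗ τ`. -/
def uD (V τ : Type u) [AddCommGroup V] [Module ℂ V] [AddCommGroup τ] [Module ℂ τ] :
    Module.Dual ℂ V →ₗ[ℂ] Module.End ℂ (Sy V ⊗[ℂ] τ) where
  toFun x := (dx x).rTensor τ
  map_add' x x' := by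
    apply TensorProduct.ext'; intro q z
    simp only [LinearMap.rTensor_tmul, LinearMap.add_apply, dd_add, TensorProduct.add_tmul]
  map_smul' r x := by
    apply TensorProduct.ext'; intro q z
    simp only [LinearMap.rTensor_tmul, LinearMap.smul_apply, dd_smul, RingHom.id_apply,
      TensorProduct.smul_tmul']

theorem uD_tmul (x : Module.Dual ℂ V) (q : Sy V) (z : τ) : uD V τ x (q ⊗ₜ z) = dx x q ⊗ₜ z := rfl

theorem uD_comm (x x' : Module.Dual ℂ V) : uD V τ x * uD V τ x' = uD V τ x' * uD V τ x := by
  apply TensorProduct.ext'; intro q z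
  simp only [Module.End.mul_apply, uD_tmul]
  rw [dd_comm]


theorem uRep_uD (g : G) (x : Module.Dual ℂ V) :
    uRep ρ g * uD V τ x = uD V τ (costd G g x) * uRep ρ g := by
  apply TensorProduct.ext'; intro q z
  simp only [Module.End.mul_apply, uD_tmul, uRep_tmul]
  rw [symRep_apply, symRep_apply, symMap_dd _ _ (costd G g x)]
  exact fun v => costd_std g x v

/-- `Q(x) = 1 ⊗ ∂_x ⊗ 1 + t μ_x ⊗ 1 ⊗ 1 - ∑_s (c(s) / d_s) x(α_s^∨) I_s ⊗ s ⊗ s`,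
`Q(y) = ∂_y ⊗ 1 ⊗ 1`, `Q(g) = g ⊗ g ⊗ g`. -/
def actX [FiniteDimensional ℂ V] : H D →ₐ[ℂ] Module.End ℂ (XMod D ρ) :=
  act D (uRep ρ) (uD V τ) uD_comm (uRep_uD ρ)

instance [FiniteDimensional ℂ V] : Module (H D) (XMod D ρ) :=
  Module.compHom (XMod D ρ) (actX D ρ).toRingHom

theorem XMod.smul_def [FiniteDimensional ℂ V] (h : H D) (v : XMod D ρ) : h • v = actX D ρ h v := rfl

theorem XMod.of_smul [FiniteDimensional ℂ V] (a : Gen G) (v : XMod D ρ) :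
    H.of D a • v = Qgen D (uRep ρ) (uD V τ) a v :=
  congrArg (fun f : Module.End ℂ (Pol V ⊗[ℂ] (Sy V ⊗[ℂ] τ)) => f v)
    (act_of D (uRep ρ) (uD V τ) uD_comm (uRep_uD ρ) a)

instance [FiniteDimensional ℂ V] : IsScalarTower ℂ (H D) (XMod D ρ) where
  smul_assoc r h v := by rw [XMod.smul_def, map_smul]; rfl

end Modules

/-! ### The spin module and the global Dirac operator -/

section Dirac

variable {V : Type u} [AddCommGroup V] [Module ℂ V]

/-- The spin module `S = ⋀ 𝔥`. -/
abbrev Spin (V : Type u) [AddCommGroup V] [Module ℂ V] : Type u := ExteriorAlgebra ℂ V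

/-- Clifford action of `y ∈ 𝔥`: `𝔰(y) ω = y ∧ ω`. -/
def cy (y : V) : Module.End ℂ (Spin V) := LinearMap.mulLeft ℂ (ExteriorAlgebra.ι ℂ y)

/-- Clifford action of `x ∈ 𝔥*`: `𝔰(x) ω = -2 ∂_x ω`, with `∂_x` the odd derivation extending
`y ↦ x(y)`. -/
def cx (x : Module.Dual ℂ V) : Module.End ℂ (Spin V) :=
  (-2 : ℂ) • CliffordAlgebra.contractLeft (Q := (0 : QuadraticForm ℂ V)) x

/-- The parity involution of `S`: `+1` on `S⁺ = ⋀^even 𝔥` and `-1` on `S⁻ = ⋀^odd 𝔥`. -/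
def parity (V : Type u) [AddCommGroup V] [Module ℂ V] : Module.End ℂ (Spin V) :=
  (CliffordAlgebra.involute (Q := (0 : QuadraticForm ℂ V))).toLinearMap

theorem spin_induction {motive : Spin V → Prop} (one : motive 1)
    (add : ∀ p q, motive p → motive q → motive (p + q))
    (smul : ∀ (r : ℂ) p, motive p → motive (r • p))
    (mul : ∀ (w : V) p, motive p → motive (ExteriorAlgebra.ι ℂ w * p)) (p : Spin V) :
    motive p := by
  induction p using CliffordAlgebra.left_induction with
  | algebraMap r => rw [Algebra.algebraMap_eq_smul_one]; exact smul r _ one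
  | add p q hp hq => exact add p q hp hq
  | ι_mul p w hp => exact mul w p hp

theorem cy_apply (y : V) (ω : Spin V) : cy y ω = ExteriorAlgebra.ι ℂ y * ω := rfl

theorem cx_one (x : Module.Dual ℂ V) : cx x (1 : Spin V) = 0 := by
  unfold cx
  rw [LinearMap.smul_apply, CliffordAlgebra.contractLeft_one, smul_zero]

theorem cx_mul (x : Module.Dual ℂ V) (w : V) (ω : Spin V) :
    cx x (ExteriorAlgebra.ι ℂ w * ω) = (-2 * x w) • ω - ExteriorAlgebra.ι ℂ w * cx x ω := by
  unfold cx
  rw [LinearMap.smul_apply, LinearMap.smul_apply, mul_smul_comm, mul_smul, ← smul_sub]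
  congr 1
  exact CliffordAlgebra.contractLeft_ι_mul x w ω

theorem parity_one : parity V 1 = 1 := map_one (CliffordAlgebra.involute (Q := (0 : QuadraticForm ℂ V)))

theorem parity_mul (w : V) (ω : Spin V) :
    parity V (ExteriorAlgebra.ι ℂ w * ω) = -(ExteriorAlgebra.ι ℂ w * parity V ω) := by
  have h : parity V (ExteriorAlgebra.ι ℂ w) = -ExteriorAlgebra.ι ℂ w :=
    CliffordAlgebra.involute_ι w
  have h2 : parity V (ExteriorAlgebra.ι ℂ w * ω) = parity V (ExteriorAlgebra.ι ℂ w) * parity V ω :=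
    map_mul (CliffordAlgebra.involute (Q := (0 : QuadraticForm ℂ V))) _ _
  rw [h2, h, neg_mul]

theorem parity_parity (ω : Spin V) : parity V (parity V ω) = ω :=
  CliffordAlgebra.involute_involute ω

theorem parity_cy (y : V) (ω : Spin V) : parity V (cy y ω) = -cy y (parity V ω) := parity_mul y ω

theorem parity_cx (x : Module.Dual ℂ V) (ω : Spin V) : parity V (cx x ω) = -cx x (parity V ω) := by
  induction ω using spin_induction with
  | one => rw [parity_one, cx_one, map_zero, neg_zero]
  | add p q hp hq => rw [map_add, map_add, hp, hq, map_add, map_add, neg_add]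
  | smul r p hp => rw [map_smul, map_smul, hp, map_smul, map_smul, smul_neg]
  | mul w p hp =>
    rw [parity_mul, cx_mul, map_sub, map_smul, parity_mul, hp, map_neg, cx_mul, mul_neg]
    abel

variable {G : Subgroup (V ≃ₗ[ℂ] V)}

/-- The action of `G` on `S = ⋀ 𝔥`. -/
def spin (G : Subgroup (V ≃ₗ[ℂ] V)) : Representation ℂ G (Spin V) where
  toFun g := (ExteriorAlgebra.map (std G g)).toLinearMap
  map_one' := by
    refine LinearMap.ext fun ω => ?_
    rw [map_one]
    exact congrArg (fun f : Spin V →ₐ[ℂ] Spin V => f ω) ExteriorAlgebra.map_id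
  map_mul' g h := by
    refine LinearMap.ext fun ω => ?_
    rw [map_mul]
    exact congrArg (fun f : Spin V →ₐ[ℂ] Spin V => f ω)
      (ExteriorAlgebra.map_comp_map (std G h) (std G g)).symm

theorem spin_one (g : G) : spin G g 1 = 1 := map_one (ExteriorAlgebra.map (std G g))

theorem spin_mul (g : G) (w : V) (ω : Spin V) :
    spin G g (ExteriorAlgebra.ι ℂ w * ω) = ExteriorAlgebra.ι ℂ (std G g w) * spin G g ω := by
  refine (map_mul (ExteriorAlgebra.map (std G g)) _ _).trans ?_
  rw [ExteriorAlgebra.map_apply_ι]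
  rfl

theorem spin_cy (g : G) (y : V) (ω : Spin V) : spin G g (cy y ω) = cy (std G g y) (spin G g ω) :=
  spin_mul g y ω

theorem spin_cx (g : G) (x : Module.Dual ℂ V) (ω : Spin V) :
    spin G g (cx x ω) = cx (costd G g x) (spin G g ω) := by
  induction ω using spin_induction with
  | one => rw [spin_one, cx_one, cx_one, map_zero]
  | add p q hp hq => rw [map_add, map_add, hp, hq, map_add, map_add]
  | smul r p hp => rw [map_smul, map_smul, hp, map_smul, map_smul]
  | mul w p hp => rw [spin_mul, cx_mul, cx_mul, map_sub, map_smul, spin_mul, hp, costd_std]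

theorem spin_parity (g : G) (ω : Spin V) : spin G g (parity V ω) = parity V (spin G g ω) := by
  induction ω using spin_induction with
  | one => rw [parity_one, spin_one, parity_one]
  | add p q hp hq => simp only [map_add, hp, hq]
  | smul r p hp => simp only [map_smul, hp]
  | mul w p hp => rw [parity_mul, map_neg, spin_mul, spin_mul, parity_mul, hp]

variable (D : Datum G)

/-- `s = 1 + (d_s^∨ / 2) 𝔰(α_s^∨) 𝔰(α_s)` on `S`. -/
theorem Datum.spin_refl (s : Refl G) (ω : Spin V) :
    spin G s.1 ω = ω + (D.dv s / 2) • cy (D.coroot s) (cx (D.root s) ω) := by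
  induction ω using spin_induction with
  | one => rw [spin_one, cx_one, map_zero, smul_zero, add_zero]
  | add p q hp hq => rw [map_add, hp, hq]; simp only [map_add, smul_add]; abel
  | smul r p hp => rw [map_smul, hp]; simp only [map_smul, smul_add, smul_comm r]
  | mul w p hp =>
    have h0 : ExteriorAlgebra.ι ℂ (D.coroot s) * ExteriorAlgebra.ι ℂ (D.coroot s) = 0 :=
      ExteriorAlgebra.ι_sq_zero _
    have h1 : ExteriorAlgebra.ι ℂ w * ExteriorAlgebra.ι ℂ (D.coroot s) =
        -(ExteriorAlgebra.ι ℂ (D.coroot s) * ExteriorAlgebra.ι ℂ w) :=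
      eq_neg_of_add_eq_zero_left (ExteriorAlgebra.ι_add_mul_swap _ _)
    rw [spin_mul, D.refl_apply, hp, cx_mul, cy_apply, cy_apply, map_sub, map_smul, sub_mul,
      mul_add, mul_add, mul_sub]
    simp only [mul_smul_comm, smul_mul_assoc, ← mul_assoc, h0, h1, zero_mul, smul_zero, add_zero,
      neg_mul, smul_sub, smul_smul, smul_neg]
    rw [show D.dv s / 2 * -(2 * (D.root s) w) = -(D.dv s * (D.root s) w) by ring, neg_smul]
    abel

theorem cx_cx (x : Module.Dual ℂ V) (ω : Spin V) : cx x (cx x ω) = 0 := by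
  unfold cx
  rw [LinearMap.smul_apply, LinearMap.smul_apply, map_smul, CliffordAlgebra.contractLeft_contractLeft,
    smul_zero, smul_zero]

/-- `(d_s^∨ / d_s) 𝔰(α_s) = - 𝔰(α_s) s` on `S`. -/
theorem Datum.cx_root (s : Refl G) (ω : Spin V) :
    cx (D.root s) (spin G s.1 ω) = -((D.dv s / D.d s) • cx (D.root s) ω) := by
  have hd := D.d_ne_zero s
  rw [D.spin_refl, map_add, map_smul, cy_apply, cx_mul, cx_cx, mul_zero, sub_zero, D.root_coroot,
    smul_smul, D.dv_eq, ← neg_smul]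
  nth_rewrite 1 [← one_smul ℂ (cx (D.root s) ω)]
  rw [← add_smul]
  congr 1
  have hl := D.lam_ne_zero s
  rw [mul_div_cancel_right₀ _ hd]
  unfold Datum.d
  field_simp
  ring

variable {τ : Type u} [AddCommGroup τ] [Module ℂ τ] (ρ : Representation ℂ G τ)

/-- The representation `τ ⊗ S`. -/
abbrev tauS : Representation ℂ G (τ ⊗[ℂ] Spin V) := ρ.tprod (spin G)

/-- `A ⊗ B ⊗ C` on `ℂ[𝔥*] ⊗ τ ⊗ S`. -/
abbrev op3 (A : Module.End ℂ (Sy V)) (B : Module.End ℂ τ) (C : Module.End ℂ (Spin V)) :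
    Module.End ℂ (Sy V ⊗[ℂ] (τ ⊗[ℂ] Spin V)) :=
  TensorProduct.map A (TensorProduct.map B C)

/-- `T_y^∨(τ) ⊗ 𝔰(x)` on `ℂ[𝔥*] ⊗ τ ⊗ S`, for the dual Dunkl operator
`T_y^∨(τ) = t μ_y ⊗ 1 + ∑_s (c(s) / d_s) α_s(y) I_s^∨ ⊗ s`. -/
def dualDunkl [Finite G] (y : V) (x : Module.Dual ℂ V) :
    Module.End ℂ (Sy V ⊗[ℂ] (τ ⊗[ℂ] Spin V)) :=
  D.t • op3 (LinearMap.mulLeft ℂ (sι y)) LinearMap.id (cx x) +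
    ∑ s : Refl G, (D.c s / D.d s * D.root s y) • op3 (D.intv s) (ρ s.1) (cx x)

variable [FiniteDimensional ℂ V]

/-- A basis `y_j` of `𝔥`, with dual basis `x_j`; the Dirac operator does not depend on it. -/
abbrev yb (V : Type u) [AddCommGroup V] [Module ℂ V] [FiniteDimensional ℂ V] :
    Module.Basis (Fin (Module.finrank ℂ V)) ℂ V := Module.finBasis ℂ V

/-- The part `∑_j (∂_{x_j} ⊗ 1 ⊗ 𝔰(y_j) + T_{y_j}^∨(τ) ⊗ 𝔰(x_j))` of `-D_τ`, which acts on
`ℂ[𝔥*] ⊗ τ ⊗ S`. -/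
def diracU [Finite G] : Module.End ℂ (Sy V ⊗[ℂ] (τ ⊗[ℂ] Spin V)) :=
  ∑ j, (op3 (dx ((yb V).coord j)) LinearMap.id (cy (yb V j)) +
    dualDunkl D ρ (yb V j) ((yb V).coord j))

/-- `D_τ` as a linear map:
`-D_τ = ∑_j (∂_{y_j} ⊗ 1 ⊗ 1 ⊗ 𝔰(x_j) + 1 ⊗ ∂_{x_j} ⊗ 1 ⊗ 𝔰(y_j) + 1 ⊗ T_{y_j}^∨(τ) ⊗ 𝔰(x_j))`. -/
def diracLin [Finite G] : Module.End ℂ (Pol V ⊗[ℂ] (Sy V ⊗[ℂ] (τ ⊗[ℂ] Spin V))) :=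
  -((∑ j, TensorProduct.map (dy (yb V j)) (op3 LinearMap.id LinearMap.id (cx ((yb V).coord j)))) +
    (diracU D ρ).lTensor (Pol V))

/-- Invariance of the canonical element `∑_j x_j ⊗ y_j`. -/
theorem sum_invariant {M : Type*} [AddCommGroup M] [Module ℂ M]
    (B : Module.Dual ℂ V →ₗ[ℂ] V →ₗ[ℂ] M) (g : G) :
    ∑ j, B (costd G g ((yb V).coord j)) (std G g (yb V j)) = ∑ j, B ((yb V).coord j) (yb V j) := by
  have h1 : ∀ j, std G g (yb V j) = ∑ i, (yb V).coord i (std G g (yb V j)) • yb V i := fun j => by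
    simp only [Module.Basis.coord_apply]; exact ((yb V).sum_repr _).symm
  have h2 : ∀ i, ∑ j, (yb V).coord i (std G g (yb V j)) • costd G g ((yb V).coord j) =
      (yb V).coord i := by
    intro i
    refine LinearMap.ext fun v => ?_
    have h3 : std G g⁻¹ v = ∑ j, (yb V).coord j (std G g⁻¹ v) • yb V j := by
      simp only [Module.Basis.coord_apply]; exact ((yb V).sum_repr _).symm
    conv_rhs => rw [← std_std_inv g v, h3]
    simp only [LinearMap.sum_apply, LinearMap.smul_apply, map_sum, map_smul, smul_eq_mul,
      costd_apply]
    exact Finset.sum_congr rfl fun j _ => mul_comm _ _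
  calc _ = ∑ j, ∑ i, B ((yb V).coord i (std G g (yb V j)) • costd G g ((yb V).coord j)) (yb V i) := by
        refine Finset.sum_congr rfl fun j _ => ?_
        conv_lhs => rw [h1 j]
        simp only [map_sum, map_smul, LinearMap.smul_apply]
    _ = _ := by
        rw [Finset.sum_comm]
        refine Finset.sum_congr rfl fun i _ => ?_
        conv_rhs => rw [← h2 i]
        simp only [map_sum, LinearMap.sum_apply]

/-- `∑_j x(y_j) x_j = x`. -/
theorem sum_coord (x : Module.Dual ℂ V) : ∑ j, x (yb V j) • (yb V).coord j = x := by
  refine LinearMap.ext fun v => ?_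
  conv_rhs => rw [← (yb V).sum_repr v]
  simp only [LinearMap.sum_apply, LinearMap.smul_apply, map_sum, map_smul, smul_eq_mul,
    Module.Basis.coord_apply]
  exact Finset.sum_congr rfl fun j _ => mul_comm _ _

/-- `𝔰` on `𝔥*` as a linear map. -/
def cxL (V : Type u) [AddCommGroup V] [Module ℂ V] : Module.Dual ℂ V →ₗ[ℂ] Module.End ℂ (Spin V) :=
  (-2 : ℂ) • CliffordAlgebra.contractLeft (Q := (0 : QuadraticForm ℂ V))


theorem cxL_apply (x : Module.Dual ℂ V) : cxL V x = cx x := rfl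

theorem sum_cx (x : Module.Dual ℂ V) (ω : Spin V) :
    ∑ j, x (yb V j) • cx ((yb V).coord j) ω = cx x ω := by
  conv_rhs => rw [← sum_coord x, ← cxL_apply]
  simp only [map_sum, map_smul, LinearMap.sum_apply, LinearMap.smul_apply, cxL_apply]

end Dirac

section Commute

variable {V : Type u} [AddCommGroup V] [Module ℂ V] [FiniteDimensional ℂ V]
  {G : Subgroup (V ≃ₗ[ℂ] V)} [Finite G] (D : Datum G)
  {τ : Type u} [AddCommGroup τ] [Module ℂ τ] (ρ : Representation ℂ G τ)

theorem ext3 {M : Type*} [AddCommGroup M] [Module ℂ M]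
    {f g : Sy V ⊗[ℂ] (τ ⊗[ℂ] Spin V) →ₗ[ℂ] M}
    (h : ∀ q z ω, f (q ⊗ₜ (z ⊗ₜ ω)) = g (q ⊗ₜ (z ⊗ₜ ω))) : f = g := by
  apply TensorProduct.ext'
  intro q w
  induction w using TensorProduct.induction_on with
  | zero => simp
  | tmul z ω => exact h q z ω
  | add a b ha hb => rw [TensorProduct.tmul_add, map_add, map_add, ha, hb]

theorem op3_tmul (A : Module.End ℂ (Sy V)) (B : Module.End ℂ τ) (C : Module.End ℂ (Spin V))
    (q : Sy V) (z : τ) (ω : Spin V) : op3 A B C (q ⊗ₜ (z ⊗ₜ ω)) = A q ⊗ₜ (B z ⊗ₜ C ω) := rfl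

/-- `1 ⊗ 1 ⊗ 𝔰(x)`. -/
def gam (V τ : Type u) [AddCommGroup V] [Module ℂ V] [AddCommGroup τ] [Module ℂ τ] :
    Module.Dual ℂ V →ₗ[ℂ] Module.End ℂ (Sy V ⊗[ℂ] (τ ⊗[ℂ] Spin V)) :=
  (LinearMap.lTensorHom (R := ℂ) (Sy V)) ∘ₗ (LinearMap.lTensorHom (R := ℂ) τ) ∘ₗ cxL V

theorem gam_apply (x : Module.Dual ℂ V) :
    gam V τ x = op3 LinearMap.id LinearMap.id (cx x) := rfl

theorem gam_tmul (x : Module.Dual ℂ V) (q : Sy V) (z : τ) (ω : Spin V) :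
    gam V τ x (q ⊗ₜ (z ⊗ₜ ω)) = q ⊗ₜ (z ⊗ₜ cx x ω) := rfl

theorem sum_gam (x : Module.Dual ℂ V) (u : Sy V ⊗[ℂ] (τ ⊗[ℂ] Spin V)) :
    ∑ j, x (yb V j) • gam V τ ((yb V).coord j) u = gam V τ x u := by
  conv_rhs => rw [← sum_coord x]
  simp only [map_sum, map_smul, LinearMap.sum_apply, LinearMap.smul_apply]

theorem uRep_tauS (g : G) (q : Sy V) (z : τ) (ω : Spin V) :
    uRep (tauS ρ) g (q ⊗ₜ (z ⊗ₜ ω)) = symRep (std G) g q ⊗ₜ (ρ g z ⊗ₜ spin G g ω) := rfl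

theorem uD_gam (x x' : Module.Dual ℂ V) (u : Sy V ⊗[ℂ] (τ ⊗[ℂ] Spin V)) :
    uD V (τ ⊗[ℂ] Spin V) x (gam V τ x' u) = gam V τ x' (uD V (τ ⊗[ℂ] Spin V) x u) := by
  have : uD V (τ ⊗[ℂ] Spin V) x ∘ₗ gam V τ x' = gam V τ x' ∘ₗ uD V (τ ⊗[ℂ] Spin V) x :=
    ext3 fun q z ω => rfl
  exact LinearMap.congr_fun this u

theorem uRep_gam (g : G) (x : Module.Dual ℂ V) (u : Sy V ⊗[ℂ] (τ ⊗[ℂ] Spin V)) :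
    uRep (tauS ρ) g (gam V τ x u) = gam V τ (costd G g x) (uRep (tauS ρ) g u) := by
  have : uRep (tauS ρ) g ∘ₗ gam V τ x = gam V τ (costd G g x) ∘ₗ uRep (tauS ρ) g :=
    ext3 fun q z ω => by
      simp only [LinearMap.comp_apply, gam_tmul, uRep_tauS, spin_cx]
  exact LinearMap.congr_fun this u

theorem diracU_tmul (q : Sy V) (z : τ) (ω : Spin V) : diracU D ρ (q ⊗ₜ (z ⊗ₜ ω)) =
    ∑ j, (dx ((yb V).coord j) q ⊗ₜ (z ⊗ₜ cy (yb V j) ω) +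
      (D.t • ((sι (yb V j) * q) ⊗ₜ[ℂ] (z ⊗ₜ[ℂ] cx ((yb V).coord j) ω)) +
      ∑ s : Refl G, (D.c s / D.d s * D.root s (yb V j)) •
        (D.intv s q ⊗ₜ[ℂ] (ρ s.1 z ⊗ₜ[ℂ] cx ((yb V).coord j) ω)))) := by
  simp only [diracU, dualDunkl, LinearMap.sum_apply, LinearMap.add_apply, LinearMap.smul_apply,
    op3_tmul, LinearMap.id_apply, LinearMap.mulLeft_apply]

theorem uD_diracU (x : Module.Dual ℂ V) (u : Sy V ⊗[ℂ] (τ ⊗[ℂ] Spin V)) :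
    uD V (τ ⊗[ℂ] Spin V) x (diracU D ρ u) = diracU D ρ (uD V (τ ⊗[ℂ] Spin V) x u) +
      (D.t • gam V τ x u - ∑ s : Refl G, (D.c s * x (D.coroot s)) •
        gam V τ (D.root s) (uRep (tauS ρ) s.1 u)) := by
  have : uD V (τ ⊗[ℂ] Spin V) x ∘ₗ diracU D ρ = diracU D ρ ∘ₗ uD V (τ ⊗[ℂ] Spin V) x +
      (D.t • gam V τ x - ∑ s : Refl G, (D.c s * x (D.coroot s)) •
        (gam V τ (D.root s) ∘ₗ uRep (tauS ρ) s.1)) := by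
    refine ext3 fun q z ω => ?_
    simp only [LinearMap.comp_apply, LinearMap.add_apply, LinearMap.sub_apply, LinearMap.smul_apply,
      LinearMap.sum_apply, uRep_tauS, gam_tmul, uD_tmul, diracU_tmul, map_sum, map_add, map_smul]
    have e1 : ∀ y : V, dx x (sι y * q) = sι y * dx x q + x y • q := by
      intro y
      rw [show dx x (sι y * q) = _ from dd_ι_mul _ _ _]
    have e2 : ∀ j, dx x (dx ((yb V).coord j) q) = dx ((yb V).coord j) (dx x q) := fun j =>
      dd_comm _ _ _
    simp only [e1, e2, D.dx_intv, TensorProduct.add_tmul, smul_add, Finset.sum_add_distrib]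
    have e3 : ∑ j, D.t • ((x (yb V j) • q) ⊗ₜ[ℂ] (z ⊗ₜ[ℂ] cx ((yb V).coord j) ω)) =
        D.t • (q ⊗ₜ[ℂ] (z ⊗ₜ[ℂ] cx x ω)) := by
      rw [← Finset.smul_sum, ← sum_cx x ω]
      simp only [TensorProduct.tmul_sum, TensorProduct.tmul_smul, ← TensorProduct.smul_tmul']
    have e4 : ∑ j, ∑ s : Refl G, (D.c s / D.d s * D.root s (yb V j)) •
        (((D.dv s * x (D.coroot s)) • symRep (std G) s.1 q) ⊗ₜ[ℂ]
          (ρ s.1 z ⊗ₜ[ℂ] cx ((yb V).coord j) ω)) =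
        -∑ s : Refl G, (D.c s * x (D.coroot s)) • (symRep (std G) s.1 q ⊗ₜ[ℂ]
          (ρ s.1 z ⊗ₜ[ℂ] cx (D.root s) (spin G s.1 ω))) := by
      rw [Finset.sum_comm, ← Finset.sum_neg_distrib]
      refine Finset.sum_congr rfl fun s _ => ?_
      rw [D.cx_root, ← sum_cx (D.root s) ω]
      simp only [TensorProduct.tmul_sum, TensorProduct.tmul_smul, TensorProduct.tmul_neg,
        ← TensorProduct.smul_tmul', smul_neg, neg_neg, Finset.smul_sum, smul_smul]
      refine Finset.sum_congr rfl fun j _ => ?_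
      congr 1
      ring
    rw [e3, e4]
    abel
  have h := LinearMap.congr_fun this u
  simpa only [LinearMap.comp_apply, LinearMap.add_apply, LinearMap.sub_apply, LinearMap.smul_apply,
      LinearMap.sum_apply] using h

theorem inv1 (g : G) (q : Sy V) (z : τ) (ω : Spin V) :
    ∑ j, dx (costd G g ((yb V).coord j)) q ⊗ₜ[ℂ] (z ⊗ₜ[ℂ] cy (std G g (yb V j)) ω) =
      ∑ j, dx ((yb V).coord j) q ⊗ₜ[ℂ] (z ⊗ₜ[ℂ] cy (yb V j) ω) :=
  sum_invariant (LinearMap.mk₂ ℂ (fun x y => dx x q ⊗ₜ[ℂ] (z ⊗ₜ[ℂ] cy y ω))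
    (fun x x' y => by simp only [dd_add, TensorProduct.add_tmul])
    (fun r x y => by simp only [dd_smul, TensorProduct.smul_tmul'])
    (fun x y y' => by simp only [cy_apply, map_add, add_mul, TensorProduct.tmul_add])
    (fun r x y => by simp only [cy_apply, map_smul, smul_mul_assoc, TensorProduct.tmul_smul])) g

theorem inv2 (g : G) (q : Sy V) (z : τ) (ω : Spin V) :
    ∑ j, D.t • ((sι (std G g (yb V j)) * q) ⊗ₜ[ℂ]
      (z ⊗ₜ[ℂ] cx (costd G g ((yb V).coord j)) ω)) =
      ∑ j, D.t • ((sι (yb V j) * q) ⊗ₜ[ℂ] (z ⊗ₜ[ℂ] cx ((yb V).coord j) ω)) :=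
  sum_invariant (LinearMap.mk₂ ℂ (fun x y => D.t • ((sι y * q) ⊗ₜ[ℂ] (z ⊗ₜ[ℂ] cx x ω)))
    (fun x x' y => by
      simp only [← cxL_apply, map_add, LinearMap.add_apply, TensorProduct.tmul_add, smul_add])
    (fun r x y => by
      simp only [← cxL_apply, map_smul, LinearMap.smul_apply, TensorProduct.tmul_smul,
        smul_comm r])
    (fun x y y' => by simp only [map_add, add_mul, TensorProduct.add_tmul, smul_add])
    (fun r x y => by
      simp only [map_smul, smul_mul_assoc, ← TensorProduct.smul_tmul', smul_comm r])) g

theorem inv3 (g : G) (r : ℂ) (x : Module.Dual ℂ V) (q : Sy V) (z : τ) (ω : Spin V) :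
    ∑ j, (r * x (yb V j)) • (q ⊗ₜ[ℂ] (z ⊗ₜ[ℂ] cx (costd G g ((yb V).coord j)) ω)) =
      r • (q ⊗ₜ[ℂ] (z ⊗ₜ[ℂ] cx (costd G g x) ω)) := by
  have h : ∑ j, x (yb V j) • cx (costd G g ((yb V).coord j)) ω = cx (costd G g x) ω := by
    conv_rhs => rw [← sum_coord x, ← cxL_apply]
    simp only [map_sum, map_smul, LinearMap.sum_apply, LinearMap.smul_apply, cxL_apply]
  rw [← h]
  simp only [TensorProduct.tmul_sum, TensorProduct.tmul_smul, Finset.smul_sum, smul_smul]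

theorem uRep_diracU_tmul (g : G) (q : Sy V) (z : τ) (ω : Spin V) :
    uRep (tauS ρ) g (diracU D ρ (q ⊗ₜ (z ⊗ₜ ω))) =
      diracU D ρ (symRep (std G) g q ⊗ₜ (ρ g z ⊗ₜ spin G g ω)) := by
  have a1 : ∀ x : Module.Dual ℂ V, symRep (std G) g (dx x q) =
      dx (costd G g x) (symRep (std G) g q) := fun x => by
    rw [symRep_apply, symRep_apply, symMap_dd _ _ (costd G g x)]
    exact fun v => costd_std g x v
  have a2 : ∀ y : V, symRep (std G) g (sι y * q) = sι (std G g y) * symRep (std G) g q :=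
    fun y => by simp only [symRep_apply, map_mul, symMap_ι]
  rw [diracU_tmul, diracU_tmul]
  simp only [map_sum, map_add, map_smul, uRep_tauS, spin_cx, spin_cy, Finset.sum_add_distrib, a1,
    a2]
  rw [inv1, inv2]
  refine congrArg₂ (· + ·) rfl (congrArg₂ (· + ·) rfl ?_)
  rw [Finset.sum_comm]
  conv_rhs => rw [Finset.sum_comm]
  refine Fintype.sum_equiv (conj g) _ _ fun s => ?_
  obtain ⟨k, h1, h2, h3⟩ := D.symRep_intv g s q
  have hc : D.c (conj g s) = D.c s := D.c_conj g s _ rfl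
  have hu : ρ g (ρ s.1 z) = ρ (conj g s).1 (ρ g z) := by
    rw [← Module.End.mul_apply, ← map_mul, ← Module.End.mul_apply, ← map_mul]
    simp [conj]
  have h4 := inv3 (1 : G) (D.c (conj g s) / D.d (conj g s)) (D.root (conj g s))
    (D.intv (conj g s) (symRep (std G) g q)) (ρ (conj g s).1 (ρ g z)) (spin G g ω)
  simp only [map_one, Module.End.one_apply] at h4
  rw [h4, inv3, h1, hu, hc, h3, ← h2, ← cxL_apply (k • _), map_smul, LinearMap.smul_apply,
    cxL_apply]
  simp only [← TensorProduct.smul_tmul', TensorProduct.tmul_smul]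

theorem uRep_diracU (g : G) (u : Sy V ⊗[ℂ] (τ ⊗[ℂ] Spin V)) :
    uRep (tauS ρ) g (diracU D ρ u) = diracU D ρ (uRep (tauS ρ) g u) := by
  have : uRep (tauS ρ) g ∘ₗ diracU D ρ = diracU D ρ ∘ₗ uRep (tauS ρ) g :=
    ext3 fun q z ω => uRep_diracU_tmul D ρ g q z ω
  exact LinearMap.congr_fun this u

end Commute

section GlobalDirac

variable {V : Type u} [AddCommGroup V] [Module ℂ V]
  {G : Subgroup (V ≃ₗ[ℂ] V)} {U : Type u} [AddCommGroup U] [Module ℂ U]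

theorem ev_lTensor (A : Module.End ℂ U) (w : Pol V ⊗[ℂ] U) :
    ev V U (A.lTensor (Pol V) w) = A (ev V U w) := by
  induction w using TensorProduct.induction_on with
  | zero => simp
  | add a b ha hb => rw [map_add, map_add, ha, hb, map_add, map_add]
  | tmul p u => rw [LinearMap.lTensor_tmul, ev_tmul, ev_tmul, map_smul]

theorem Qy_lTensor (y : V) (A : Module.End ℂ U) (w : Pol V ⊗[ℂ] U) :
    Qy U y (A.lTensor (Pol V) w) = A.lTensor (Pol V) (Qy U y w) := by
  have : Qy U y ∘ₗ A.lTensor (Pol V) = A.lTensor (Pol V) ∘ₗ Qy U y :=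
    TensorProduct.ext' fun p u => rfl
  exact LinearMap.congr_fun this w

theorem Qg_lTensor (ρ : Representation ℂ G U) (g : G) (A A' : Module.End ℂ U)
    (h : ∀ u, ρ g (A u) = A' (ρ g u)) (w : Pol V ⊗[ℂ] U) :
    Qg ρ g (A.lTensor (Pol V) w) = A'.lTensor (Pol V) (Qg ρ g w) := by
  have : Qg ρ g ∘ₗ A.lTensor (Pol V) = A'.lTensor (Pol V) ∘ₗ Qg ρ g :=
    TensorProduct.ext' fun p u => by
      simp only [LinearMap.comp_apply, LinearMap.lTensor_tmul, Qg_tmul, h]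
  exact LinearMap.congr_fun this w

theorem Qy_add (y y' : V) (w : Pol V ⊗[ℂ] U) : Qy U (y + y') w = Qy U y w + Qy U y' w := by
  have : Qy U (y + y') = Qy U y + Qy U y' := TensorProduct.ext' fun p u => by
    rw [LinearMap.add_apply, Qy_tmul, Qy_tmul, Qy_tmul, dy, map_add, dd_add, TensorProduct.add_tmul]
  rw [this, LinearMap.add_apply]

theorem Qy_smul (r : ℂ) (y : V) (w : Pol V ⊗[ℂ] U) : Qy U (r • y) w = r • Qy U y w := by
  have : Qy U (r • y) = r • Qy U y := TensorProduct.ext' fun p u => by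
    rw [LinearMap.smul_apply, Qy_tmul, Qy_tmul, dy, map_smul, dd_smul, TensorProduct.smul_tmul']
  rw [this, LinearMap.smul_apply]

variable [FiniteDimensional ℂ V] [Finite G] (D : Datum G)
  {τ : Type u} [AddCommGroup τ] [Module ℂ τ] (ρ : Representation ℂ G τ)

theorem diracLin_apply (w : Pol V ⊗[ℂ] (Sy V ⊗[ℂ] (τ ⊗[ℂ] Spin V))) : diracLin D ρ w =
    -(∑ j, (gam V τ ((yb V).coord j)).lTensor (Pol V) (Qy _ (yb V j) w) +
      (diracU D ρ).lTensor (Pol V) w) := by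
  have : diracLin D ρ = -(∑ j, (gam V τ ((yb V).coord j)).lTensor (Pol V) ∘ₗ Qy _ (yb V j) +
      (diracU D ρ).lTensor (Pol V)) := by
    apply TensorProduct.ext'
    intro p u
    simp only [diracLin, LinearMap.neg_apply, LinearMap.add_apply, LinearMap.sum_apply,
      LinearMap.comp_apply, Qy_tmul, LinearMap.lTensor_tmul, TensorProduct.map_tmul, gam_apply]
  have h := LinearMap.congr_fun this w
  simpa only [LinearMap.neg_apply, LinearMap.add_apply, LinearMap.sum_apply,
      LinearMap.comp_apply] using h

theorem diracLin_Qy (y : V) (w : Pol V ⊗[ℂ] (Sy V ⊗[ℂ] (τ ⊗[ℂ] Spin V))) :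
    diracLin D ρ (Qy _ y w) = Qy _ y (diracLin D ρ w) := by
  have h : ∀ j, Qy _ (yb V j) (Qy _ y w) = Qy _ y (Qy _ (yb V j) w) := fun j => by
    rw [← Module.End.mul_apply, Qy_comm, Module.End.mul_apply]
  simp only [diracLin_apply, map_neg, map_add, map_sum, Qy_lTensor, h]

theorem lTensor_gam_add (x x' : Module.Dual ℂ V) (w : Pol V ⊗[ℂ] (Sy V ⊗[ℂ] (τ ⊗[ℂ] Spin V))) :
    (gam V τ (x + x')).lTensor (Pol V) w =
      (gam V τ x).lTensor (Pol V) w + (gam V τ x').lTensor (Pol V) w := by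
  rw [map_add, LinearMap.lTensor_add, LinearMap.add_apply]

theorem lTensor_gam_smul (r : ℂ) (x : Module.Dual ℂ V)
    (w : Pol V ⊗[ℂ] (Sy V ⊗[ℂ] (τ ⊗[ℂ] Spin V))) :
    (gam V τ (r • x)).lTensor (Pol V) w = r • (gam V τ x).lTensor (Pol V) w := by
  rw [map_smul, LinearMap.lTensor_smul, LinearMap.smul_apply]

theorem diracLin_Qg (g : G) (w : Pol V ⊗[ℂ] (Sy V ⊗[ℂ] (τ ⊗[ℂ] Spin V))) :
    diracLin D ρ (Qg (uRep (tauS ρ)) g w) = Qg (uRep (tauS ρ)) g (diracLin D ρ w) := by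
  rw [diracLin_apply, diracLin_apply, map_neg, map_add, map_sum,
    Qg_lTensor _ g _ _ (uRep_diracU D ρ g)]
  congr 2
  have h : ∀ j, Qg (uRep (tauS ρ)) g
      ((gam V τ ((yb V).coord j)).lTensor (Pol V) (Qy _ (yb V j) w)) =
      (gam V τ (costd G g ((yb V).coord j))).lTensor (Pol V)
        (Qy _ (std G g (yb V j)) (Qg (uRep (tauS ρ)) g w)) := by
    intro j
    rw [Qg_lTensor _ g _ _ (uRep_gam ρ g _), ← Module.End.mul_apply (Qg (uRep (tauS ρ)) g),
      Qg_Qy, Module.End.mul_apply]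
  rw [Finset.sum_congr rfl fun j _ => h j]
  exact (sum_invariant (LinearMap.mk₂ ℂ (fun x y => (gam V τ x).lTensor (Pol V)
        (Qy _ y (Qg (uRep (tauS ρ)) g w)))
    (fun x x' y => lTensor_gam_add _ _ _)
    (fun r x y => lTensor_gam_smul _ _ _)
    (fun x y y' => by rw [Qy_add, map_add])
    (fun r x y => by rw [Qy_smul, map_smul])) g).symm

theorem ev_diracLin (w : Pol V ⊗[ℂ] (Sy V ⊗[ℂ] (τ ⊗[ℂ] Spin V))) :
    ev V _ (diracLin D ρ w) =
    -(∑ j, gam V τ ((yb V).coord j) (ev V _ (Qy _ (yb V j) w)) + diracU D ρ (ev V _ w)) := by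
  simp only [diracLin_apply, map_neg, map_add, map_sum, ev_lTensor]

theorem Qy_Qx_apply (ρU : Representation ℂ G U) (E : Module.Dual ℂ V →ₗ[ℂ] Module.End ℂ U) (y : V)
    (x : Module.Dual ℂ V) (w : Pol V ⊗[ℂ] U) :
    Qy U y (Qx D ρU E x w) = Qx D ρU E x (Qy U y w) + ((D.t * x y) • w -
      ∑ s : Refl G, (D.c s * D.root s y * x (D.coroot s)) • Qg ρU s.1 w) := by
  have h := LinearMap.congr_fun (Qy_Qx D ρU E y x) w
  simp only [LinearMap.sub_apply, Module.End.mul_apply, LinearMap.smul_apply, LinearMap.sum_apply,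
    Module.End.one_apply] at h
  rw [← h]
  abel

theorem diracLin_Qx (x : Module.Dual ℂ V) (w : Pol V ⊗[ℂ] (Sy V ⊗[ℂ] (τ ⊗[ℂ] Spin V))) :
    diracLin D ρ (Qx D (uRep (tauS ρ)) (uD V _) x w) =
      Qx D (uRep (tauS ρ)) (uD V _) x (diracLin D ρ w) := by
  rw [← sub_eq_zero]
  refine LinearMap.congr_fun (eq_zero_of_ev (diracLin D ρ ∘ₗ Qx D (uRep (tauS ρ)) (uD V _) x -
    Qx D (uRep (tauS ρ)) (uD V _) x ∘ₗ diracLin D ρ) ?_ ?_) w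
  · intro y
    refine LinearMap.ext fun w => ?_
    simp only [Module.End.mul_apply, LinearMap.sub_apply, LinearMap.comp_apply, map_sub,
      ← diracLin_Qy, Qy_Qx_apply, map_add, map_sum, map_smul, diracLin_Qg]
    abel
  · intro w
    have e1 : ∑ j, x (yb V j) • gam V τ ((yb V).coord j) (ev V _ w) = gam V τ x (ev V _ w) :=
      sum_gam _ _
    have e2 : ∑ j, ∑ s : Refl G, (D.c s * D.root s (yb V j) * x (D.coroot s)) •
        gam V τ ((yb V).coord j) (uRep (tauS ρ) s.1 (ev V _ w)) =
        ∑ s : Refl G, (D.c s * x (D.coroot s)) •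
          gam V τ (D.root s) (uRep (tauS ρ) s.1 (ev V _ w)) := by
      rw [Finset.sum_comm]
      refine Finset.sum_congr rfl fun s _ => ?_
      rw [← sum_gam (D.root s), Finset.smul_sum]
      refine Finset.sum_congr rfl fun j _ => ?_
      rw [smul_smul]
      congr 1
      ring
    simp only [LinearMap.sub_apply, LinearMap.comp_apply, map_sub, ev_Qx, ev_diracLin, Qy_Qx_apply,
      map_add, map_sum, map_smul, ev_Qg, map_neg, uD_diracU, uD_gam, Finset.sum_add_distrib,
      Finset.sum_sub_distrib, mul_smul, ← Finset.smul_sum, e1]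
    simp only [smul_smul, ← mul_assoc, e2]
    abel

end GlobalDirac

section Index

/-! #### Operators on the module `𝔛_{t,c}(τ ⊗ S)` -/

variable {V : Type u} [AddCommGroup V] [Module ℂ V] [FiniteDimensional ℂ V]
  {G : Subgroup (V ≃ₗ[ℂ] V)} [Finite G] (D : Datum G)
  {τ : Type u} [AddCommGroup τ] [Module ℂ τ] (ρ : Representation ℂ G τ)

/-- The global Dirac operator `D_τ`, an `H_{t,c}`-linear endomorphism of `𝔛_{t,c}(τ ⊗ S)`. -/
def dirac : XMod D (tauS ρ) →ₗ[H D] XMod D (tauS ρ) :=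
  mkHLinear D (M := XMod D (tauS ρ)) (N := XMod D (tauS ρ)) (diracLin D ρ) fun a m => by
    rw [XMod.of_smul, XMod.of_smul]
    cases a with
    | y v => exact diracLin_Qy D ρ v m
    | x f => exact diracLin_Qx D ρ f m
    | g g => exact diracLin_Qg D ρ g m

/-- `1 ⊗ 1 ⊗ parity` on `ℂ[𝔥*] ⊗ τ ⊗ S`. -/
def parU (V τ : Type u) [AddCommGroup V] [Module ℂ V] [AddCommGroup τ] [Module ℂ τ] :
    Module.End ℂ (Sy V ⊗[ℂ] (τ ⊗[ℂ] Spin V)) :=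
  ((parity V).lTensor τ).lTensor (Sy V)

theorem parU_tmul (q : Sy V) (z : τ) (ω : Spin V) :
    parU V τ (q ⊗ₜ (z ⊗ₜ ω)) = q ⊗ₜ (z ⊗ₜ parity V ω) := rfl

theorem uRep_parU (g : G) (u : Sy V ⊗[ℂ] (τ ⊗[ℂ] Spin V)) :
    uRep (tauS ρ) g (parU V τ u) = parU V τ (uRep (tauS ρ) g u) := by
  have : uRep (tauS ρ) g ∘ₗ parU V τ = parU V τ ∘ₗ uRep (tauS ρ) g := ext3 fun q z ω => by
    simp only [LinearMap.comp_apply, parU_tmul, uRep_tauS, spin_parity]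
  exact LinearMap.congr_fun this u

theorem gam_parU (x : Module.Dual ℂ V) (u : Sy V ⊗[ℂ] (τ ⊗[ℂ] Spin V)) :
    gam V τ x (parU V τ u) = -parU V τ (gam V τ x u) := by
  have : gam V τ x ∘ₗ parU V τ = -(parU V τ ∘ₗ gam V τ x) := ext3 fun q z ω => by
    simp only [LinearMap.comp_apply, LinearMap.neg_apply, parU_tmul, gam_tmul, parity_cx,
      TensorProduct.tmul_neg, neg_neg]
  exact LinearMap.congr_fun this u

theorem diracU_parU (u : Sy V ⊗[ℂ] (τ ⊗[ℂ] Spin V)) :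
    diracU D ρ (parU V τ u) = -parU V τ (diracU D ρ u) := by
  have : diracU D ρ ∘ₗ parU V τ = -(parU V τ ∘ₗ diracU D ρ) := ext3 fun q z ω => by
    simp only [LinearMap.comp_apply, LinearMap.neg_apply, parU_tmul, diracU_tmul, map_sum, map_add,
      map_smul, parity_cx, parity_cy, TensorProduct.tmul_neg, ← Finset.sum_neg_distrib, neg_add,
      smul_neg, neg_neg]
  exact LinearMap.congr_fun this u

/-- `1 ⊗ 1 ⊗ 1 ⊗ parity` on `𝔛_{t,c}(τ ⊗ S)`. -/
def par : XMod D (tauS ρ) →ₗ[H D] XMod D (tauS ρ) :=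
  mkHLinear D (M := XMod D (tauS ρ)) (N := XMod D (tauS ρ)) ((parU V τ).lTensor (Pol V))
    fun a m => by
    rw [XMod.of_smul, XMod.of_smul]
    symm
    cases a with
    | y v => exact Qy_lTensor v (parU V τ) m
    | x f =>
      have : Qx D (uRep (tauS ρ)) (uD V (τ ⊗[ℂ] Spin V)) f ∘ₗ (parU V τ).lTensor (Pol V) =
          (parU V τ).lTensor (Pol V) ∘ₗ Qx D (uRep (tauS ρ)) (uD V (τ ⊗[ℂ] Spin V)) f := by
        apply TensorProduct.ext'
        intro p u
        have e : uD V (τ ⊗[ℂ] Spin V) f (parU V τ u) = parU V τ (uD V (τ ⊗[ℂ] Spin V) f u) := by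
          have : uD V (τ ⊗[ℂ] Spin V) f ∘ₗ parU V τ = parU V τ ∘ₗ uD V (τ ⊗[ℂ] Spin V) f :=
            ext3 fun q z ω => rfl
          exact LinearMap.congr_fun this u
        simp only [LinearMap.comp_apply, LinearMap.lTensor_tmul, Qx_tmul, map_sub, map_add,
          map_smul, map_sum, uRep_parU, e]
      exact LinearMap.congr_fun this m
    | g g => exact Qg_lTensor _ g _ _ (uRep_parU ρ g) m

theorem diracLin_par (w : Pol V ⊗[ℂ] (Sy V ⊗[ℂ] (τ ⊗[ℂ] Spin V))) :
    diracLin D ρ ((parU V τ).lTensor (Pol V) w) =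
      -(parU V τ).lTensor (Pol V) (diracLin D ρ w) := by
  have h1 : ∀ (x : Module.Dual ℂ V) (w : Pol V ⊗[ℂ] (Sy V ⊗[ℂ] (τ ⊗[ℂ] Spin V))),
      (gam V τ x).lTensor (Pol V) ((parU V τ).lTensor (Pol V) w) =
      -(parU V τ).lTensor (Pol V) ((gam V τ x).lTensor (Pol V) w) := by
    intro x w
    have : (gam V τ x).lTensor (Pol V) ∘ₗ (parU V τ).lTensor (Pol V) =
      -((parU V τ).lTensor (Pol V) ∘ₗ (gam V τ x).lTensor (Pol V)) :=
      TensorProduct.ext' fun p u => by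
        simp only [LinearMap.comp_apply, LinearMap.neg_apply, LinearMap.lTensor_tmul, gam_parU,
          TensorProduct.tmul_neg]
    exact LinearMap.congr_fun this w
  have h2 : (diracU D ρ).lTensor (Pol V) ((parU V τ).lTensor (Pol V) w) =
      -(parU V τ).lTensor (Pol V) ((diracU D ρ).lTensor (Pol V) w) := by
    have : (diracU D ρ).lTensor (Pol V) ∘ₗ (parU V τ).lTensor (Pol V) =
      -((parU V τ).lTensor (Pol V) ∘ₗ (diracU D ρ).lTensor (Pol V)) :=
      TensorProduct.ext' fun p u => by
        simp only [LinearMap.comp_apply, LinearMap.neg_apply, LinearMap.lTensor_tmul, diracU_parU,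
          TensorProduct.tmul_neg]
    exact LinearMap.congr_fun this w
  have h3 : ∀ j, Qy _ (yb V j) ((parU V τ).lTensor (Pol V) w) =
      (parU V τ).lTensor (Pol V) (Qy _ (yb V j) w) := fun j => Qy_lTensor _ _ _
  rw [diracLin_apply, diracLin_apply, h2, map_neg, map_add, map_sum, neg_neg, neg_add, neg_neg]
  congr 1
  rw [← Finset.sum_neg_distrib]
  exact Finset.sum_congr rfl fun j _ => by rw [h3, h1, neg_neg]

theorem dirac_par (w : XMod D (tauS ρ)) : dirac D ρ (par D ρ w) = -par D ρ (dirac D ρ w) :=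
  diracLin_par D ρ w

/-- `𝔛_{t,c}(τ ⊗ S)⁺ = 𝔛_{t,c}(τ ⊗ S⁺)`, where `S⁺ = ⋀^even 𝔥`. -/
def XEven : Submodule (H D) (XMod D (tauS ρ)) := LinearMap.ker (par D ρ - LinearMap.id)

/-- `𝔛_{t,c}(τ ⊗ S)⁻ = 𝔛_{t,c}(τ ⊗ S⁻)`, where `S⁻ = ⋀^odd 𝔥`. -/
def XOdd : Submodule (H D) (XMod D (tauS ρ)) := LinearMap.ker (par D ρ + LinearMap.id)

/-- `D_τ⁺ : 𝔛_{t,c}(τ ⊗ S)⁺ → 𝔛_{t,c}(τ ⊗ S)⁻`, the restriction of `D_τ`. -/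
def diracPlus : XEven D ρ →ₗ[H D] XOdd D ρ :=
  (dirac D ρ).restrict fun w hw => by
    have h1 : par D ρ w = w := sub_eq_zero.mp hw
    have h2 : par D ρ (dirac D ρ w) + dirac D ρ w = 0 := by
      have h := dirac_par D ρ w
      rw [h1] at h
      nth_rewrite 2 [h]
      exact add_neg_cancel _
    exact h2

end Index

section Pairing

/-! #### The Dirac operator is dual to multiplication by the Dirac element

For a representation `U` of `G`, the pairing of `𝔛_{t,c}(U)` with the induced module of the dual
of `U` sends `(h, z*)` and `ξ` to `z*(e(h ξ))`, where `e : 𝔛_{t,c}(U) → U` is the evaluation at `0`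
in both variables (up to an anti-isomorphism of algebras acting on `h`). -/

variable {V : Type u} [AddCommGroup V] [Module ℂ V]

/-- Evaluation at `0` on `ℂ[𝔥*] ⊗ τ`. -/
def evU (V τ : Type u) [AddCommGroup V] [Module ℂ V] [AddCommGroup τ] [Module ℂ τ] :
    Sy V ⊗[ℂ] τ →ₗ[ℂ] τ :=
  (TensorProduct.lid ℂ τ).toLinearMap ∘ₗ
    (SymmetricAlgebra.algebraMapInv (R := ℂ) (M := V)).toLinearMap.rTensor τ

theorem eq_zero_of_derivatives [FiniteDimensional ℂ V] (n : ℕ) (p : Sy V) (hp : killed n p)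
    (h : ∀ l : List (Module.Dual ℂ V), SymmetricAlgebra.algebraMapInv ((l.map dx).prod p) = 0) :
    p = 0 := by
  induction n generalizing p with
  | zero => exact hp
  | succ n ih =>
    rw [eq_const p fun f => ih _ (hp f) fun l => by
      have := h (l ++ [f])
      simpa using this]
    have := h []
    simp only [List.map_nil, List.prod_nil, Module.End.one_apply] at this
    rw [this, map_zero]

variable {τ : Type u} [AddCommGroup τ] [Module ℂ τ]

theorem evU_tmul (q : Sy V) (z : τ) :
    evU V τ (q ⊗ₜ z) = SymmetricAlgebra.algebraMapInv q • z := by simp [evU]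

theorem evU_eq_zero [FiniteDimensional ℂ V] (u : Sy V ⊗[ℂ] τ)
    (h : ∀ l : List (Module.Dual ℂ V), evU V τ ((l.map (uD V τ)).prod u) = 0) : u = 0 := by
  classical
  let b := Module.Basis.ofVectorSpace ℂ τ
  let e := TensorProduct.equivFinsuppOfBasisRight (M := Sy V) b
  have he : ∀ x u i, e (uD V τ x u) i = dx x (e u i) := by
    intro x u i
    induction u using TensorProduct.induction_on with
    | zero => simp
    | add a c ha hc => simp only [map_add, Finsupp.add_apply, ha, hc]
    | tmul p u => rw [uD_tmul]; simp [e]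
  have hl : ∀ (l : List (Module.Dual ℂ V)) u i, e ((l.map (uD V τ)).prod u) i =
      (l.map dx).prod (e u i) := by
    intro l
    induction l with
    | nil => intro u i; simp
    | cons x l ih =>
      intro u i
      simp only [List.map_cons, List.prod_cons, Module.End.mul_apply, he, ih]
  have hc : ∀ u i, b.repr (evU V τ u) i = SymmetricAlgebra.algebraMapInv (e u i) := by
    intro u i
    induction u using TensorProduct.induction_on with
    | zero => simp
    | add a c ha hc => simp only [map_add, Finsupp.add_apply, ha, hc]
    | tmul p u => rw [evU_tmul]; simp [e, mul_comm]
  apply e.injective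
  rw [map_zero]
  ext1 i
  obtain ⟨n, hn⟩ := exists_killed (e u i)
  refine eq_zero_of_derivatives n _ hn fun l => ?_
  rw [← hl, ← hc, h, map_zero, Finsupp.zero_apply]

variable {G : Subgroup (V ≃ₗ[ℂ] V)} [Finite G] (D : Datum G)

/-- Evaluation at `0` in both variables, `𝔛_{t,c}(τ) → τ`. -/
def XMod.ev0 (ρ : Representation ℂ G τ) : XMod D ρ →ₗ[ℂ] τ := evU V τ ∘ₗ ev V (Sy V ⊗[ℂ] τ)

variable [FiniteDimensional ℂ V]

/-- The pairing `(h, z*), ξ ↦ z*(e(h ξ))` has no kernel in `𝔛_{t,c}(τ)`. -/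
theorem XMod.eq_zero_of_ev0 (ρ : Representation ℂ G τ) (ξ : XMod D ρ)
    (h : ∀ a : H D, XMod.ev0 D ρ (a • ξ) = 0) : ξ = 0 := by
  suffices hs : ∀ (n : ℕ) (ξ : XMod D ρ), (∀ a : H D, XMod.ev0 D ρ (a • ξ) = 0) →
      (∀ l : List V, l.length = n → (l.map (Qy (Sy V ⊗[ℂ] τ))).prod ξ = 0) → ξ = 0 by
    obtain ⟨n, hn⟩ := exists_Qy_nilpotent (V := V) (U := Sy V ⊗[ℂ] τ) ξ
    exact hs n ξ h hn
  intro n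
  induction n with
  | zero => intro ξ _ hn; exact hn [] rfl
  | succ n ih =>
    intro ξ h hn
    have h0 : ∀ y, H.of D (.y y) • ξ = Qy (Sy V ⊗[ℂ] τ) y ξ := fun y => XMod.of_smul D ρ (.y y) ξ
    have h1 : ∀ y, Qy (Sy V ⊗[ℂ] τ) y ξ = 0 := fun y => by
      have h2 : H.of D (.y y) • ξ = 0 := ih _ (fun a => by rw [← mul_smul]; exact h _)
        fun l hl => by
          have := hn (l ++ [y]) (by simp [hl])
          rw [h0]
          simp only [List.map_append, List.map_cons, List.map_nil, List.prod_append, List.prod_cons,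
            List.prod_nil, mul_one] at this
          exact this
      exact (h0 y).symm.trans h2
    have h2 : ∀ (l : List (Module.Dual ℂ V)), ev V _ ((l.map fun x => H.of D (.x x)).prod • ξ) =
        (l.map (uD V τ)).prod (ev V (Sy V ⊗[ℂ] τ) ξ) := by
      intro l
      induction l with
      | nil => simp
      | cons x l ihl =>
        rw [List.map_cons, List.prod_cons, mul_smul, XMod.of_smul, List.map_cons, List.prod_cons,
          Module.End.mul_apply, ← ihl]
        exact ev_Qx D (uRep ρ) (uD V τ) x _
    have h3 : ev V (Sy V ⊗[ℂ] τ) ξ = 0 := evU_eq_zero _ fun l => by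
      rw [← h2]
      exact h _
    have h4 := eq_one_tmul (U := Sy V ⊗[ℂ] τ) ξ h1
    rw [h3, TensorProduct.tmul_zero] at h4
    exact h4

/-- `D_τ` is dual to right multiplication by the Dirac element `∑_j (x_j ⊗ y_j + y_j ⊗ x_j)`:
`e(h D_τ ξ) = - ∑_j (𝔰(y_j) e(x_j h ξ) + 𝔰(x_j) e(y_j h ξ))`. -/
theorem ev0_dirac (ρ : Representation ℂ G τ) (a : H D) (ξ : XMod D (tauS ρ)) :
    XMod.ev0 D (tauS ρ) (a • dirac D ρ ξ) =
      -∑ j, ((cy (yb V j)).lTensor τ (XMod.ev0 D (tauS ρ) (H.of D (.x ((yb V).coord j)) • a • ξ)) +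
        (cx ((yb V).coord j)).lTensor τ (XMod.ev0 D (tauS ρ) (H.of D (.y (yb V j)) • a • ξ))) := by
  rw [← map_smul]
  generalize a • ξ = ξ
  have e1 : ∀ x, ev V _ (H.of D (.x x) • ξ) = uD V (τ ⊗[ℂ] Spin V) x (ev V _ ξ) := fun x => by
    rw [XMod.of_smul]; exact ev_Qx D (uRep (tauS ρ)) _ x _
  have e2 : ∀ x (u : Sy V ⊗[ℂ] (τ ⊗[ℂ] Spin V)),
      evU V _ (gam V τ x u) = (cx x).lTensor τ (evU V _ u) := fun x u => by
    have : evU V (τ ⊗[ℂ] Spin V) ∘ₗ gam V τ x = (cx x).lTensor τ ∘ₗ evU V (τ ⊗[ℂ] Spin V) :=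
      ext3 fun q z ω => by
        simp only [LinearMap.comp_apply, gam_tmul, evU_tmul, map_smul, LinearMap.lTensor_tmul]
    exact LinearMap.congr_fun this u
  have e3 : ∀ (u : Sy V ⊗[ℂ] (τ ⊗[ℂ] Spin V)), evU V _ (diracU D ρ u) =
      ∑ j, (cy (yb V j)).lTensor τ (evU V _ (uD V _ ((yb V).coord j) u)) := fun u => by
    have : evU V (τ ⊗[ℂ] Spin V) ∘ₗ diracU D ρ = ∑ j, (cy (yb V j)).lTensor τ ∘ₗ
        evU V (τ ⊗[ℂ] Spin V) ∘ₗ uD V _ ((yb V).coord j) :=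
      ext3 fun q z ω => by
        simp only [LinearMap.comp_apply, LinearMap.sum_apply, diracU_tmul, evU_tmul, uD_tmul,
          map_smul, map_add, map_sum, map_mul, LinearMap.lTensor_tmul,
          SymmetricAlgebra.algebraMapInv_ι, zero_mul, zero_smul, smul_zero, add_zero,
          Datum.intv, lineInt_eval_zero, Finset.sum_const_zero]
    have h := LinearMap.congr_fun this u
    simpa only [LinearMap.comp_apply, LinearMap.sum_apply] using h
  have e4 := congrArg (evU V _) (ev_diracLin D ρ ξ)
  simp only [map_neg, map_add, map_sum, e2, e3, ← Finset.sum_add_distrib] at e4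
  refine e4.trans (congrArg Neg.neg (Finset.sum_congr rfl fun j _ => ?_))
  have h0 : H.of D (.y (yb V j)) • ξ = Qy _ (yb V j) ξ := XMod.of_smul D (tauS ρ) (.y (yb V j)) ξ
  rw [← e1, add_comm, h0]
  rfl

end Pairing

section Category

open CategoryTheory

variable {V : Type u} [AddCommGroup V] [Module ℂ V] [FiniteDimensional ℂ V]
  {G : Subgroup (V ≃ₗ[ℂ] V)} [Finite G] (D : Datum G)
  {τ : Type u} [AddCommGroup τ] [Module ℂ τ] (ρ : Representation ℂ G τ)

/-! ### Categories of `H_{t,c}`-modules -/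

/-- Locally `𝔥`-nilpotent modules (the category `𝒪^ln`): every vector is killed by all
products of sufficiently many elements of `𝔥`. -/
def locNilp : ObjectProperty (ModuleCat.{u} (H D)) := fun M =>
  ∀ m : M, ∃ n : ℕ, ∀ l : List V, l.length = n → (l.map fun y => H.of D (.y y)).prod • m = 0

/-- Category `𝒪`: the locally `𝔥`-nilpotent modules that are finitely generated over the
subalgebra generated by `𝔥*`. -/
def catO : ObjectProperty (ModuleCat.{u} (H D)) := fun M =>
  locNilp D M ∧ Module.Finite (Algebra.adjoin ℂ (Set.range fun x => H.of D (.x x))) M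

theorem catO_le : catO D ≤ locNilp D := fun _ h => h.1

/-- `𝔛_{t,c}(τ ⊗ S)⁺`. -/
abbrev XEvenObj : ModuleCat.{u} (H D) := ModuleCat.of (H D) (XEven D ρ)

/-- `𝔛_{t,c}(τ ⊗ S)⁻`. -/
abbrev XOddObj : ModuleCat.{u} (H D) := ModuleCat.of (H D) (XOdd D ρ)

/-- `𝔐_{t,c}(τ)`. -/
abbrev MObj : ModuleCat.{u} (H D) := ModuleCat.of (H D) (MMod D ρ)

/-- `ker D_τ⁺`. -/
abbrev kerObj : ModuleCat.{u} (H D) := ModuleCat.of (H D) (LinearMap.ker (diracPlus D ρ))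

/-- `coker D_τ⁺`. -/
abbrev cokerObj : ModuleCat.{u} (H D) :=
  ModuleCat.of (H D) (XOdd D ρ ⧸ LinearMap.range (diracPlus D ρ))

theorem act_prod {U : Type u} [AddCommGroup U] [Module ℂ U] (σ : Representation ℂ G U)
    (E : Module.Dual ℂ V →ₗ[ℂ] Module.End ℂ U) (hE : ∀ x x', E x * E x' = E x' * E x)
    (hEg : ∀ g x, σ g * E x = E (costd G g x) * σ g) (l : List V) :
    act D σ E hE hEg (l.map fun y => H.of D (.y y)).prod = (l.map (Qy U)).prod := by
  rw [map_list_prod, List.map_map]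
  congr 2
  funext y
  exact act_of D σ E hE hEg (.y y)

theorem locNilp_M : locNilp D (MObj D ρ) := fun m => by
  obtain ⟨n, hn⟩ := exists_Qy_nilpotent (V := V) (U := τ) m
  refine ⟨n, fun l hl => ?_⟩
  exact (congrArg (fun f : Module.End ℂ (Pol V ⊗[ℂ] τ) => f m)
    (act_prod D ρ 0 (fun _ _ => rfl) (fun _ _ => by simp) l)).trans (hn l hl)

theorem XMod_nilp (m : XMod D ρ) : ∃ n : ℕ, ∀ l : List V, l.length = n →
    (l.map fun y => H.of D (.y y)).prod • m = 0 := by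
  obtain ⟨n, hn⟩ := exists_Qy_nilpotent (V := V) (U := Sy V ⊗[ℂ] τ) m
  refine ⟨n, fun l hl => ?_⟩
  exact (congrArg (fun f : Module.End ℂ (Pol V ⊗[ℂ] (Sy V ⊗[ℂ] τ)) => f m)
    (act_prod D (uRep ρ) (uD V τ) uD_comm (uRep_uD ρ) l)).trans (hn l hl)

theorem locNilp_ker : locNilp D (kerObj D ρ) := fun m => by
  obtain ⟨n, hn⟩ := XMod_nilp D (tauS ρ) m.1.1
  exact ⟨n, fun l hl => Subtype.ext (Subtype.ext (hn l hl))⟩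

theorem locNilp_coker : locNilp D (cokerObj D ρ) := fun m => by
  obtain ⟨m, rfl⟩ := Submodule.mkQ_surjective (LinearMap.range (diracPlus D ρ)) m
  obtain ⟨n, hn⟩ := XMod_nilp D (tauS ρ) m.1
  refine ⟨n, fun l hl => ?_⟩
  have h : (l.map fun y => H.of D (.y y)).prod • m = 0 := Subtype.ext (hn l hl)
  exact ((Submodule.mkQ _).map_smul _ m).symm.trans (by rw [h, map_zero])

end Category

/-! ### Grothendieck groups -/

section K0

open CategoryTheory

variable {A : Type u} [Ring A]

/-- The relations `[X₂] = [X₁] + [X₃]` for the short exact sequences `0 → X₁ → X₂ → X₃ → 0` of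
modules satisfying `P`. -/
def K0.rel (P : ObjectProperty (ModuleCat.{u} A)) : AddSubgroup (FreeAbelianGroup P.FullSubcategory) :=
  AddSubgroup.closure {r | ∃ S : ShortComplex (ModuleCat.{u} A), S.ShortExact ∧
    ∃ (h₁ : P S.X₁) (h₂ : P S.X₂) (h₃ : P S.X₃), r = FreeAbelianGroup.of ⟨S.X₂, h₂⟩ -
      FreeAbelianGroup.of ⟨S.X₁, h₁⟩ - FreeAbelianGroup.of ⟨S.X₃, h₃⟩}

/-- The Grothendieck group of the full subcategory of modules satisfying `P`. -/
abbrev K0 (P : ObjectProperty (ModuleCat.{u} A)) : Type (u + 1) :=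
  FreeAbelianGroup P.FullSubcategory ⧸ K0.rel P

/-- The class of a module. -/
def K0.cls {P : ObjectProperty (ModuleCat.{u} A)} (M : ModuleCat.{u} A) (h : P M) : K0 P :=
  QuotientAddGroup.mk (FreeAbelianGroup.of ⟨M, h⟩)

/-- The map on Grothendieck groups induced by an inclusion of subcategories. -/
def K0.incl {P Q : ObjectProperty (ModuleCat.{u} A)} (h : P ≤ Q) : K0 P →+ K0 Q :=
  QuotientAddGroup.map _ _ (FreeAbelianGroup.map fun M => ⟨M.obj, h _ M.property⟩) <| by
    unfold K0.rel
    rw [AddSubgroup.closure_le]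
    rintro _ ⟨S, hS, h₁, h₂, h₃, rfl⟩
    refine AddSubgroup.subset_closure ⟨S, hS, h _ h₁, h _ h₂, h _ h₃, ?_⟩
    simp only [map_sub, FreeAbelianGroup.map_of_apply]

theorem K0.incl_cls {P Q : ObjectProperty (ModuleCat.{u} A)} (h : P ≤ Q) (M : ModuleCat.{u} A)
    (hM : P M) : K0.incl h (K0.cls M hM) = K0.cls M (h _ hM) := by
  unfold K0.incl K0.cls
  rw [QuotientAddGroup.map_mk, FreeAbelianGroup.map_of_apply]

end K0

section GlobalIndex

variable {V : Type u} [AddCommGroup V] [Module ℂ V] [FiniteDimensional ℂ V]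
  {G : Subgroup (V ≃ₗ[ℂ] V)} [Finite G] (D : Datum G)
  {τ : Type u} [AddCommGroup τ] [Module ℂ τ] (ρ : Representation ℂ G τ)

/-- The global Dirac index `I(τ) = ker D_τ⁺ - coker D_τ⁺`, in the Grothendieck group of the
locally `𝔥`-nilpotent modules. -/
def globalIndex : K0 (locNilp D) :=
  K0.cls (kerObj D ρ) (locNilp_ker D ρ) - K0.cls (cokerObj D ρ) (locNilp_coker D ρ)

end GlobalIndex

end RCA

end

/-! Write `-D_τ = A + B` with `A = ∑ ∂_{y_j} ⊗ 𝔰(x_j)` and `B = 1 ⊗ diracU`, and grade `𝔛(τ ⊗ S)` by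
the total degree in `ℂ[𝔥*]` and `S` (`degX`). Then `A` lowers the degree by one and `B` preserves
it. The algebra `H_{t,c}` respects the associated filtration `filX`, though not the grading: `y` and
`g` preserve the degree, and `x` does so up to `∂_x`, which lowers it.

Besides `D_τ` there is a second `H_{t,c}`-linear odd operator, the de Rham differential `d = ∑
∂_{x_j} ⊗ 𝔰(y_j)`, which is `B` for `t = 0`, `c = 0`. The Koszul differential is a homotopy between
the degree and zero, so the only cohomology of `d` is the part of degree zero, a copy of `𝔐(τ)`
inside the even forms (`deRham_exact`, `eq_zero_of_inclM_eq_deRham`). This holds on every step of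
the filtration. Hence `[F⁺] - [F⁻] = [𝔐(τ)]` (`K0.sub_eq_of_exact`) for `F` a step `filX K` or all
of `𝔛(τ ⊗ S)`.

On the other hand, if `D_τ` preserves `F` and is bijective modulo `F`, then `D_τ⁺` has the same
kernel and cokernel as its restriction to `F⁺ → F⁻`, so that its index is `[F⁺] - [F⁻]`
(`K0.index_eq_sub`). The two computations meet in `index_eq_cls_MObj`. The choice `F = ⊤` settles
Serre subcategories and locally nilpotent modules.

For `t ≠ 0` and category `𝒪` the choice is `F = filX K` with `K` large, and two facts make it work.
By `diracU_sq`, `B²` is `-2(t · degree - z)`, where `z` comes from the finite-dimensional algebra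
`ℂ[G × G]` and so has finite spectrum. Therefore `B` is bijective in large degrees, and `D_τ` is
bijective modulo `filX K` because `A` only lowers the degree. Secondly, the Euler element `∑ x_j
y_j` acts on the part of degree `m` in `ℂ[𝔥]` by `t m + z'`, up to a term lowering the degree in
`ℂ[𝔥*]`, with `z'` again from `ℂ[G × G]`. Inverting this for large `m` shows that `filX K` lies in a
finitely generated `ℂ[𝔥]`-module (`exists_fg_biHom_le`).

For `t = 0` the class of `𝔐(τ)` in `K_0(𝒪^ln)` vanishes by an Eilenberg swindle, so it is trivially
in the image of `K_0(𝒪)`. The operators of `y` and `g` on `𝔐(τ)` do not involve the parameters,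
which gives the last assertion. -/

noncomputable section

namespace RCA

/-! ### Line integrals, the Euler operator and the grading of a symmetric algebra -/

section Calculus

variable {W : Type u} [AddCommGroup W] [Module ℂ W]

/-- Integration by parts: under the integral sign `∂_f` is `d/dT`. The boundary term at `T = 0`
vanishes because of the factor `T^(n+1)`, and the one at `T = a` is substitution by `e`, which is
the map `v ↦ v + a(v) f` on points. All `n` are treated together since multiplication by a linear
form shifts `n`. -/
theorem mom_succ_dd (a : Sy W) (f : W →ₗ[ℂ] ℂ) (e : W →ₗ[ℂ] W)
    (he : ∀ w, sι (e w) = sι w + f w • a) (p : Sy W) : ∀ n,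
    mom a f (n + 1) (dd f p) = -(a ^ (n + 1) * symMap e p) - ((n : ℂ) + 1) • mom a f n p := by
  induction p using sy_induction with
  | one =>
    intro n
    have h : ((n : ℂ) + 1) ≠ 0 := by exact_mod_cast Nat.succ_ne_zero n
    rw [mom_one, smul_smul, show ((n : ℂ) + 1) * -(1 / ((n : ℂ) + 1)) = -1 by field_simp]
    simp
  | add p q hp hq => intro n; simp only [map_add, hp, hq, mul_add, smul_add]; abel
  | smul r p hp =>
    intro n
    simp only [map_smul, hp, smul_sub, smul_neg, mul_smul_comm, smul_comm ((n : ℂ) + 1) r]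
  | mul w p hp =>
    intro n
    rw [dd_ι_mul, map_add, map_smul, mom_ι_mul, mom_ι_mul, hp, hp, map_mul, symMap_ι, he]
    simp only [Algebra.smul_def, Nat.cast_add, Nat.cast_one, map_add, map_one, map_natCast]
    ring

/-- The remaining case of integration by parts, where `T^0 = 1` leaves the boundary term `p` at `T =
0`. -/
theorem mom_zero_dd (a : Sy W) (f : W →ₗ[ℂ] ℂ) (e : W →ₗ[ℂ] W)
    (he : ∀ w, sι (e w) = sι w + f w • a) (p : Sy W) :
    mom a f 0 (dd f p) = p - symMap e p := by
  induction p using sy_induction with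
  | one => simp
  | add p q hp hq => simp only [map_add, hp, hq]; abel
  | smul r p hp => simp only [map_smul, hp, smul_sub]
  | mul w p hp =>
    rw [dd_ι_mul, map_add, map_smul, mom_ι_mul, hp, mom_succ_dd a f e he, map_mul, symMap_ι, he]
    simp only [Algebra.smul_def, Nat.cast_zero, zero_add, map_one, pow_one]
    ring

/-- The fundamental theorem of calculus for `lineInt`. -/
theorem lineInt_dd_self (d : ℂ) (a : W) (f : W →ₗ[ℂ] ℂ) (e : W →ₗ[ℂ] W)
    (he : ∀ w, e w = w - (d * f w) • a) (p : Sy W) :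
    lineInt d a f (dd f p) = p - symMap e p := by
  rw [lineInt_eq, mom_zero_dd _ f e]
  intro w
  rw [he]
  simp [sub_eq_add_neg, mul_comm d, mul_smul]

/-- The Euler operator `∑_j w_j ∂_{f_j}`. -/
def eulerOp {ι : Type*} [Fintype ι] (w : ι → W) (f : ι → W →ₗ[ℂ] ℂ) : Module.End ℂ (Sy W) :=
  ∑ j, LinearMap.mulLeft ℂ (sι (w j)) ∘ₗ dd (f j)

theorem eulerOp_apply {ι : Type*} [Fintype ι] (w : ι → W) (f : ι → W →ₗ[ℂ] ℂ) (p : Sy W) :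
    eulerOp w f p = ∑ j, sι (w j) * dd (f j) p := by
  simp [eulerOp]

theorem eulerOp_one {ι : Type*} [Fintype ι] (w : ι → W) (f : ι → W →ₗ[ℂ] ℂ) :
    eulerOp w f 1 = 0 := by
  simp [eulerOp_apply]

/-- Leibniz rule; the hypothesis that the `w j` and `f j` are dual says exactly that the operator
fixes linear forms. -/
theorem eulerOp_ι_mul {ι : Type*} [Fintype ι] (w : ι → W) (f : ι → W →ₗ[ℂ] ℂ)
    (h : ∀ v, ∑ j, f j v • w j = v) (v : W) (p : Sy W) :
    eulerOp w f (sι v * p) = sι v * eulerOp w f p + sι v * p := by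
  have hv : sι v = ∑ j, f j v • sι (w j) := by
    conv_lhs => rw [← h v]
    simp only [map_sum, map_smul]
  simp only [eulerOp_apply, dd_ι_mul, mul_add, Finset.sum_add_distrib, Finset.mul_sum]
  refine congrArg₂ (· + ·) (Finset.sum_congr rfl fun j _ => mul_left_comm _ _ _) ?_
  rw [hv, Finset.sum_mul]
  exact Finset.sum_congr rfl fun j _ => by rw [mul_smul_comm, smul_mul_assoc]

theorem dd_eulerOp {ι : Type*} [Fintype ι] (w : ι → W) (f : ι → W →ₗ[ℂ] ℂ)
    (h : ∀ v, ∑ j, f j v • w j = v) (g : W →ₗ[ℂ] ℂ) (p : Sy W) :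
    dd g (eulerOp w f p) = eulerOp w f (dd g p) + dd g p := by
  induction p using sy_induction with
  | one => simp [eulerOp_one]
  | add p q hp hq => simp only [map_add, hp, hq]; abel
  | smul r p hp => simp only [map_smul, hp, smul_add]
  | mul v p hp =>
    rw [eulerOp_ι_mul w f h, map_add, dd_ι_mul, dd_ι_mul, hp, map_add, eulerOp_ι_mul w f h, map_smul,
      mul_add]

/-- Homogeneous elements of degree `n` of the symmetric algebra. -/
abbrev syPow (W : Type u) [AddCommGroup W] [Module ℂ W] (n : ℕ) : Submodule ℂ (Sy W) :=
  LinearMap.range (sι (W := W)) ^ n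

theorem syPow_zero : syPow W 0 = 1 := pow_zero _

theorem syPow_succ (n : ℕ) : syPow W (n + 1) = LinearMap.range (sι (W := W)) * syPow W n :=
  pow_succ' _ _

theorem syPow_induction {motive : ℕ → Sy W → Prop} (one : motive 0 1)
    (add : ∀ n p q, motive n p → motive n q → motive n (p + q))
    (smul : ∀ n (r : ℂ) p, motive n p → motive n (r • p))
    (mul : ∀ n (w : W) p, p ∈ syPow W n → motive n p → motive (n + 1) (sι w * p)) (n : ℕ) :
    ∀ p ∈ syPow W n, motive n p := by
  induction n with
  | zero =>
    intro p hp
    rw [syPow_zero] at hp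
    obtain ⟨r, rfl⟩ := Submodule.mem_one.mp hp
    rw [Algebra.algebraMap_eq_smul_one]
    exact smul 0 r 1 one
  | succ n ih =>
    intro p hp
    rw [syPow_succ] at hp
    induction hp using Submodule.mul_induction_on' with
    | mem_mul_mem a ha b hb =>
      obtain ⟨w, rfl⟩ := ha
      exact mul n w b hb (ih b hb)
    | add a _ b _ ha hb => exact add _ _ _ ha hb

theorem ι_mul_mem_syPow (w : W) {n : ℕ} {p : Sy W} (hp : p ∈ syPow W n) :
    sι w * p ∈ syPow W (n + 1) := by
  rw [syPow_succ]
  exact Submodule.mul_mem_mul ⟨w, rfl⟩ hp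

theorem one_mem_syPow : (1 : Sy W) ∈ syPow W 0 := by
  rw [syPow_zero]; exact Submodule.one_le.mp le_rfl

theorem iSup_syPow : ⨆ n, syPow W n = ⊤ := by
  refine Submodule.eq_top_iff'.mpr fun p => ?_
  induction p using sy_induction with
  | one => exact Submodule.mem_iSup_of_mem 0 one_mem_syPow
  | add p q hp hq => exact add_mem hp hq
  | smul r p hp => exact Submodule.smul_mem _ _ hp
  | mul w p hp =>
    induction hp using Submodule.iSup_induction' with
    | mem n p hp => exact Submodule.mem_iSup_of_mem (n + 1) (ι_mul_mem_syPow w hp)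
    | zero => simp
    | add p q _ _ hp hq => rw [mul_add]; exact add_mem hp hq

theorem eulerOp_of_mem_syPow {ι : Type*} [Fintype ι] (w : ι → W) (f : ι → W →ₗ[ℂ] ℂ)
    (h : ∀ v, ∑ j, f j v • w j = v) (n : ℕ) : ∀ p ∈ syPow W n, eulerOp w f p = (n : ℂ) • p := by
  refine syPow_induction (motive := fun n p => eulerOp w f p = (n : ℂ) • p) ?_ ?_ ?_ ?_ n
  · simp [eulerOp_one]
  · intro n p q hp hq; rw [map_add, hp, hq, smul_add]
  · intro n r p hp; rw [map_smul, hp, smul_comm]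
  · intro n v p _ hp
    rw [eulerOp_ι_mul w f h, hp, mul_smul_comm, Nat.cast_succ, add_smul, one_smul]

theorem symMap_mem_syPow {W' : Type u} [AddCommGroup W'] [Module ℂ W'] (e : W →ₗ[ℂ] W') (n : ℕ) :
    ∀ p ∈ syPow W n, symMap e p ∈ syPow W' n := by
  refine syPow_induction (motive := fun n p => symMap e p ∈ syPow W' n) ?_ ?_ ?_ ?_ n
  · rw [map_one]; exact one_mem_syPow
  · intro n p q hp hq; rw [map_add]; exact add_mem hp hq
  · intro n r p hp; rw [map_smul]; exact Submodule.smul_mem _ _ hp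
  · intro n v p _ hp
    rw [map_mul, symMap_ι]; exact ι_mul_mem_syPow _ hp

theorem dd_of_mem_syPow_zero (f : W →ₗ[ℂ] ℂ) {p : Sy W} (hp : p ∈ syPow W 0) : dd f p = 0 := by
  rw [syPow_zero] at hp
  obtain ⟨r, rfl⟩ := Submodule.mem_one.mp hp
  rw [Algebra.algebraMap_eq_smul_one, map_smul, dd_one, smul_zero]

theorem dd_mem_syPow (f : W →ₗ[ℂ] ℂ) (n : ℕ) :
    ∀ p ∈ syPow W (n + 1), dd f p ∈ syPow W n := by
  induction n with
  | zero =>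
    intro p hp
    rw [show syPow W (0 + 1) = LinearMap.range (sι (W := W)) from pow_one _] at hp
    obtain ⟨w, rfl⟩ := hp
    rw [dd_ι, Algebra.algebraMap_eq_smul_one]
    exact Submodule.smul_mem _ _ one_mem_syPow
  | succ n ih =>
    intro p hp
    rw [syPow_succ] at hp
    induction hp using Submodule.mul_induction_on' with
    | mem_mul_mem a ha b hb =>
      obtain ⟨w, rfl⟩ := ha
      rw [dd_ι_mul]
      exact add_mem (ι_mul_mem_syPow w (ih b hb)) (Submodule.smul_mem _ _ hb)
    | add a _ b _ ha hb => rw [map_add]; exact add_mem ha hb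

theorem syPow_fg [FiniteDimensional ℂ W] (n : ℕ) : (syPow W n).FG :=
  Submodule.FG.pow (Submodule.fg_range _) n

end Calculus

/-! ### The grading of the spin module -/

section SpinDegree

variable {V : Type u} [AddCommGroup V] [Module ℂ V]

/-- Homogeneous elements of degree `n` of the spin module. -/
abbrev spinPow (V : Type u) [AddCommGroup V] [Module ℂ V] (n : ℕ) : Submodule ℂ (Spin V) :=
  LinearMap.range (ExteriorAlgebra.ι ℂ (M := V)) ^ n

theorem spinPow_zero : spinPow V 0 = 1 := pow_zero _

theorem spinPow_succ (n : ℕ) :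
    spinPow V (n + 1) = LinearMap.range (ExteriorAlgebra.ι ℂ (M := V)) * spinPow V n :=
  pow_succ' _ _

theorem iSup_spinPow : ⨆ n, spinPow V n = ⊤ := by
  refine Submodule.eq_top_iff'.mpr fun p => ?_
  induction p using spin_induction with
  | one =>
    refine Submodule.mem_iSup_of_mem 0 ?_
    rw [spinPow_zero]; exact Submodule.one_le.mp le_rfl
  | add p q hp hq => exact add_mem hp hq
  | smul r p hp => exact Submodule.smul_mem _ _ hp
  | mul w p hp =>
    induction hp using Submodule.iSup_induction' with
    | mem n p hp =>
      refine Submodule.mem_iSup_of_mem (n + 1) ?_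
      rw [spinPow_succ]
      exact Submodule.mul_mem_mul ⟨w, rfl⟩ hp
    | zero => simp
    | add p q _ _ hp hq => rw [mul_add]; exact add_mem hp hq

variable [FiniteDimensional ℂ V]

/-- The degree operator `-½ ∑_j 𝔰(y_j) 𝔰(x_j)` of the spin module. -/
def spinDeg (V : Type u) [AddCommGroup V] [Module ℂ V] [FiniteDimensional ℂ V] :
    Module.End ℂ (Spin V) :=
  (-(1 / 2) : ℂ) • ∑ j, cy (yb V j) ∘ₗ cx ((yb V).coord j)

theorem spinDeg_apply (ω : Spin V) :
    spinDeg V ω = (-(1 / 2) : ℂ) • ∑ j, cy (yb V j) (cx ((yb V).coord j) ω) := by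
  simp [spinDeg]

theorem sum_coord_smul (v : V) : ∑ j, (yb V).coord j v • yb V j = v := (yb V).sum_repr v

theorem spinDeg_one : spinDeg V 1 = 0 := by
  simp [spinDeg_apply, cx_one]

/-- The Clifford relation `𝔰(x)𝔰(y) + 𝔰(y)𝔰(x) = -2 x(y)` produces the extra term, and the factor
`-½` in `spinDeg` normalises it to one copy of `w ∧ ω`. -/
theorem spinDeg_ι_mul (w : V) (ω : Spin V) : spinDeg V (ExteriorAlgebra.ι ℂ w * ω) =
    ExteriorAlgebra.ι ℂ w * spinDeg V ω + ExteriorAlgebra.ι ℂ w * ω := by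
  have h2 : ∀ y (η : Spin V), ExteriorAlgebra.ι ℂ y * (ExteriorAlgebra.ι ℂ w * η) =
      -(ExteriorAlgebra.ι ℂ w * (ExteriorAlgebra.ι ℂ y * η)) := fun y η => by
    rw [← mul_assoc, eq_neg_of_add_eq_zero_left (ExteriorAlgebra.ι_add_mul_swap y w), neg_mul,
      mul_assoc]
  have hw : ExteriorAlgebra.ι ℂ w = ∑ j, (yb V).coord j w • ExteriorAlgebra.ι ℂ (yb V j) := by
    conv_lhs => rw [← sum_coord_smul w]
    simp only [map_sum, map_smul]
  simp only [spinDeg_apply, cx_mul, cy_apply, mul_sub, mul_smul_comm, h2, sub_neg_eq_add,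
    Finset.sum_add_distrib, smul_add, Finset.mul_sum]
  rw [add_comm]
  congr 1
  conv_rhs => rw [hw, Finset.sum_mul]
  rw [Finset.smul_sum]
  refine Finset.sum_congr rfl fun j _ => ?_
  rw [smul_smul, smul_mul_assoc]
  congr 1
  ring

theorem spinDeg_of_mem_spinPow (n : ℕ) : ∀ ω ∈ spinPow V n, spinDeg V ω = (n : ℂ) • ω := by
  induction n with
  | zero =>
    intro p hp
    rw [spinPow_zero] at hp
    obtain ⟨r, rfl⟩ := Submodule.mem_one.mp hp
    rw [Algebra.algebraMap_eq_smul_one, map_smul, spinDeg_one, smul_zero, Nat.cast_zero, zero_smul]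
  | succ n ih =>
    intro p hp
    rw [spinPow_succ] at hp
    induction hp using Submodule.mul_induction_on' with
    | mem_mul_mem a ha b hb =>
      obtain ⟨w, rfl⟩ := ha
      rw [spinDeg_ι_mul, ih b hb, mul_smul_comm, Nat.cast_succ, add_smul, one_smul]
    | add a _ b _ ha hb => rw [map_add, ha, hb, smul_add]

theorem spinDeg_cy (y : V) (ω : Spin V) : spinDeg V (cy y ω) = cy y (spinDeg V ω) + cy y ω :=
  spinDeg_ι_mul y ω

theorem spinDeg_cx (x : Module.Dual ℂ V) (ω : Spin V) :
    spinDeg V (cx x ω) = cx x (spinDeg V ω) - cx x ω := by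
  induction ω using spin_induction with
  | one => rw [cx_one, map_zero, spinDeg_one, map_zero, sub_zero]
  | add p q hp hq => simp only [map_add, hp, hq]; abel
  | smul r p hp => simp only [map_smul, hp, smul_sub]
  | mul w p hp =>
    rw [cx_mul, map_sub, map_smul, spinDeg_ι_mul, hp, spinDeg_ι_mul, map_add, cx_mul, cx_mul,
      mul_sub]
    abel

theorem spinDeg_spin {G : Subgroup (V ≃ₗ[ℂ] V)} (g : G) (ω : Spin V) :
    spinDeg V (spin G g ω) = spin G g (spinDeg V ω) := by
  induction ω using spin_induction with
  | one => rw [spin_one, spinDeg_one, map_zero]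
  | add p q hp hq => simp only [map_add, hp, hq]
  | smul r p hp => simp only [map_smul, hp]
  | mul w p hp => rw [spin_mul, spinDeg_ι_mul, hp, spinDeg_ι_mul, map_add, spin_mul, spin_mul]

theorem spinDeg_parity (ω : Spin V) : spinDeg V (parity V ω) = parity V (spinDeg V ω) := by
  rw [spinDeg_apply, spinDeg_apply, map_smul, map_sum]
  simp only [parity_cx, parity_cy, map_neg, neg_neg]

end SpinDegree

/-! ### The operator `diracU` on `ℂ[𝔥*] ⊗ τ ⊗ S`, its degree and its square -/

section DegreeU

variable {V : Type u} [AddCommGroup V] [Module ℂ V] [FiniteDimensional ℂ V]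
  {G : Subgroup (V ≃ₗ[ℂ] V)} {τ : Type u} [AddCommGroup τ] [Module ℂ τ]
  (ρ : Representation ℂ G τ)

theorem eulerOp_symRep (g : G) (q : Sy V) :
    eulerOp (yb V) (fun j => (yb V).coord j) (symRep (std G) g q) =
      symRep (std G) g (eulerOp (yb V) (fun j => (yb V).coord j) q) := by
  rw [symRep_apply, symRep_apply]
  induction q using sy_induction with
  | one => simp [eulerOp_one]
  | add p q hp hq => simp only [map_add, hp, hq]
  | smul r p hp => simp only [map_smul, hp]
  | mul w p hp =>
    rw [map_mul, symMap_ι, eulerOp_ι_mul _ _ sum_coord_smul, hp, eulerOp_ι_mul _ _ sum_coord_smul,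
      map_add, map_mul, map_mul, symMap_ι]

variable (V τ) in
/-- The total degree operator on `ℂ[𝔥*] ⊗ τ ⊗ S`. -/
def degU : Module.End ℂ (Sy V ⊗[ℂ] (τ ⊗[ℂ] Spin V)) :=
  op3 (eulerOp (yb V) fun j => (yb V).coord j) LinearMap.id LinearMap.id +
    op3 LinearMap.id LinearMap.id (spinDeg V)

theorem degU_tmul (q : Sy V) (z : τ) (ω : Spin V) : degU V τ (q ⊗ₜ (z ⊗ₜ ω)) =
    eulerOp (yb V) (fun j => (yb V).coord j) q ⊗ₜ (z ⊗ₜ ω) + q ⊗ₜ (z ⊗ₜ spinDeg V ω) := rfl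

theorem uD_degU (x : Module.Dual ℂ V) (u : Sy V ⊗[ℂ] (τ ⊗[ℂ] Spin V)) :
    uD V (τ ⊗[ℂ] Spin V) x (degU V τ u) =
      degU V τ (uD V (τ ⊗[ℂ] Spin V) x u) + uD V (τ ⊗[ℂ] Spin V) x u := by
  have : uD V (τ ⊗[ℂ] Spin V) x ∘ₗ degU V τ =
      degU V τ ∘ₗ uD V (τ ⊗[ℂ] Spin V) x + uD V (τ ⊗[ℂ] Spin V) x := ext3 fun q z ω => by
    simp only [LinearMap.comp_apply, LinearMap.add_apply, degU_tmul, map_add, uD_tmul]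
    rw [dx, dd_eulerOp _ _ sum_coord_smul, TensorProduct.add_tmul]
    abel
  exact LinearMap.congr_fun this u

theorem degU_gam (x : Module.Dual ℂ V) (u : Sy V ⊗[ℂ] (τ ⊗[ℂ] Spin V)) :
    degU V τ (gam V τ x u) = gam V τ x (degU V τ u) - gam V τ x u := by
  have : degU V τ ∘ₗ gam V τ x = gam V τ x ∘ₗ degU V τ - gam V τ x := ext3 fun q z ω => by
    simp only [LinearMap.comp_apply, LinearMap.sub_apply, degU_tmul, map_add, gam_tmul, spinDeg_cx,
      TensorProduct.tmul_sub]
    abel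
  exact LinearMap.congr_fun this u

theorem degU_uRep [Finite G] (g : G) (u : Sy V ⊗[ℂ] (τ ⊗[ℂ] Spin V)) :
    degU V τ (uRep (tauS ρ) g u) = uRep (tauS ρ) g (degU V τ u) := by
  have : degU V τ ∘ₗ uRep (tauS ρ) g = uRep (tauS ρ) g ∘ₗ degU V τ := ext3 fun q z ω => by
    simp only [LinearMap.comp_apply, degU_tmul, map_add, uRep_tauS, spinDeg_spin, eulerOp_symRep]
  exact LinearMap.congr_fun this u

theorem degU_parU (u : Sy V ⊗[ℂ] (τ ⊗[ℂ] Spin V)) :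
    degU V τ (parU V τ u) = parU V τ (degU V τ u) := by
  have : degU V τ ∘ₗ parU V τ = parU V τ ∘ₗ degU V τ := ext3 fun q z ω => by
    simp only [LinearMap.comp_apply, degU_tmul, map_add, parU_tmul, spinDeg_parity]
  exact LinearMap.congr_fun this u

/-- The Euler operator vanishes at `0` because each of its terms carries a linear factor. The
formulas for `evU` here verify the second hypothesis of `eq_zero_of_evU`, and those for `uD` the
first. -/
theorem evU_degU (u : Sy V ⊗[ℂ] (τ ⊗[ℂ] Spin V)) :
    evU V _ (degU V τ u) = (spinDeg V).lTensor τ (evU V _ u) := by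
  have : evU V (τ ⊗[ℂ] Spin V) ∘ₗ degU V τ = (spinDeg V).lTensor τ ∘ₗ evU V (τ ⊗[ℂ] Spin V) :=
    ext3 fun q z ω => by
      simp only [LinearMap.comp_apply, degU_tmul, map_add, evU_tmul, map_smul,
        LinearMap.lTensor_tmul, eulerOp_apply, map_sum, map_mul, SymmetricAlgebra.algebraMapInv_ι,
        zero_mul, Finset.sum_const_zero, zero_smul, zero_add]
  exact LinearMap.congr_fun this u

theorem evU_gam (x : Module.Dual ℂ V) (u : Sy V ⊗[ℂ] (τ ⊗[ℂ] Spin V)) :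
    evU V _ (gam V τ x u) = (cx x).lTensor τ (evU V _ u) := by
  have : evU V (τ ⊗[ℂ] Spin V) ∘ₗ gam V τ x = (cx x).lTensor τ ∘ₗ evU V (τ ⊗[ℂ] Spin V) :=
    ext3 fun q z ω => by
      simp only [LinearMap.comp_apply, gam_tmul, evU_tmul, map_smul, LinearMap.lTensor_tmul]
  exact LinearMap.congr_fun this u

omit [FiniteDimensional ℂ V] in
theorem algebraMapInv_symMap {W W' : Type u} [AddCommGroup W] [Module ℂ W] [AddCommGroup W']
    [Module ℂ W'] (e : W →ₗ[ℂ] W') (q : Sy W) :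
    SymmetricAlgebra.algebraMapInv (symMap e q) = SymmetricAlgebra.algebraMapInv q := by
  induction q using sy_induction with
  | one => simp
  | add p q hp hq => simp only [map_add, hp, hq]
  | smul r p hp => simp only [map_smul, hp]
  | mul w p hp => simp only [map_mul, symMap_ι, SymmetricAlgebra.algebraMapInv_ι, zero_mul]

theorem evU_uRep [Finite G] (g : G) (u : Sy V ⊗[ℂ] (τ ⊗[ℂ] Spin V)) :
    evU V _ (uRep (tauS ρ) g u) = TensorProduct.map (ρ g) (spin G g) (evU V _ u) := by
  have : evU V (τ ⊗[ℂ] Spin V) ∘ₗ uRep (tauS ρ) g =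
      TensorProduct.map (ρ g) (spin G g) ∘ₗ evU V (τ ⊗[ℂ] Spin V) :=
    ext3 fun q z ω => by
      simp only [LinearMap.comp_apply, uRep_tauS, evU_tmul, map_smul, TensorProduct.map_tmul,
        symRep_apply, algebraMapInv_symMap]
  exact LinearMap.congr_fun this u

/-- The action `1 ⊗ g ⊗ 1` on `ℂ[𝔥*] ⊗ τ ⊗ S`. -/
def rhoU (g : G) : Module.End ℂ (Sy V ⊗[ℂ] (τ ⊗[ℂ] Spin V)) := op3 LinearMap.id (ρ g) LinearMap.id

theorem rhoU_tmul (g : G) (q : Sy V) (z : τ) (ω : Spin V) :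
    rhoU ρ g (q ⊗ₜ (z ⊗ₜ ω)) = q ⊗ₜ (ρ g z ⊗ₜ ω) := rfl

theorem uD_rhoU (x : Module.Dual ℂ V) (g : G) (u : Sy V ⊗[ℂ] (τ ⊗[ℂ] Spin V)) :
    uD V _ x (rhoU ρ g u) = rhoU ρ g (uD V _ x u) := by
  have : uD V _ x ∘ₗ rhoU ρ g = rhoU ρ g ∘ₗ uD V _ x := ext3 fun q z ω => rfl
  exact LinearMap.congr_fun this u

theorem evU_rhoU (g : G) (u : Sy V ⊗[ℂ] (τ ⊗[ℂ] Spin V)) :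
    evU V _ (rhoU ρ g u) = (ρ g).rTensor (Spin V) (evU V _ u) := by
  have : evU V (τ ⊗[ℂ] Spin V) ∘ₗ rhoU ρ g = (ρ g).rTensor (Spin V) ∘ₗ evU V _ :=
    ext3 fun q z ω => by
      simp only [LinearMap.comp_apply, rhoU_tmul, evU_tmul, map_smul, LinearMap.rTensor_tmul]
  exact LinearMap.congr_fun this u

theorem lTensor_spinDeg_cy (y : V) (w : τ ⊗[ℂ] Spin V) :
    (spinDeg V).lTensor τ ((cy y).lTensor τ w) =
      (cy y).lTensor τ ((spinDeg V).lTensor τ w) + (cy y).lTensor τ w := by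
  have : (spinDeg V).lTensor τ ∘ₗ (cy y).lTensor τ =
      (cy y).lTensor τ ∘ₗ (spinDeg V).lTensor τ + (cy y).lTensor τ :=
    TensorProduct.ext' fun z ω => by
      simp only [LinearMap.comp_apply, LinearMap.add_apply, LinearMap.lTensor_tmul, spinDeg_cy,
        TensorProduct.tmul_add]
  exact LinearMap.congr_fun this w

theorem cy_swap (y y' : V) (ω : Spin V) : cy y (cy y' ω) = -cy y' (cy y ω) := by
  rw [cy_apply, cy_apply, cy_apply, cy_apply, ← mul_assoc,
    eq_neg_of_add_eq_zero_left (ExteriorAlgebra.ι_add_mul_swap y y'), neg_mul, mul_assoc]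

theorem cx_swap (x x' : Module.Dual ℂ V) (ω : Spin V) : cx x (cx x' ω) = -cx x' (cx x ω) := by
  unfold cx
  simp only [LinearMap.smul_apply, map_smul]
  rw [CliffordAlgebra.contractLeft_comm, smul_neg, smul_neg]

theorem cx_cy (x : Module.Dual ℂ V) (y : V) (ω : Spin V) :
    cx x (cy y ω) = (-2 * x y) • ω - cy y (cx x ω) := cx_mul x y ω

variable [Finite G] (D : Datum G)

/-- At the origin both parts of the dual Dunkl operator vanish: `μ_y` is multiplication by a linear
form, and `I_s^∨` integrates over an interval that shrinks to a point. Only the de Rham part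
survives. -/
theorem evU_diracU (u : Sy V ⊗[ℂ] (τ ⊗[ℂ] Spin V)) : evU V _ (diracU D ρ u) =
    ∑ j, (cy (yb V j)).lTensor τ (evU V _ (uD V _ ((yb V).coord j) u)) := by
  have : evU V (τ ⊗[ℂ] Spin V) ∘ₗ diracU D ρ = ∑ j, (cy (yb V j)).lTensor τ ∘ₗ
      evU V (τ ⊗[ℂ] Spin V) ∘ₗ uD V _ ((yb V).coord j) :=
    ext3 fun q z ω => by
      simp only [LinearMap.comp_apply, LinearMap.sum_apply, diracU_tmul, evU_tmul, uD_tmul,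
        map_smul, map_add, map_sum, map_mul, LinearMap.lTensor_tmul,
        SymmetricAlgebra.algebraMapInv_ι, zero_mul, zero_smul, smul_zero, add_zero,
        Datum.intv, lineInt_eval_zero, Finset.sum_const_zero]
  have h := LinearMap.congr_fun this u
  simpa only [LinearMap.comp_apply, LinearMap.sum_apply] using h

/-- An operator on `ℂ[𝔥*] ⊗ τ` commuting with all `∂_x` is determined by its composition with
evaluation at `0`. -/
theorem eq_zero_of_evU {σ : Type u} [AddCommGroup σ] [Module ℂ σ] (C : Module.End ℂ (Sy V ⊗[ℂ] σ))
    (hC : ∀ x u, uD V σ x (C u) = C (uD V σ x u)) (h0 : ∀ u, evU V σ (C u) = 0) (u : Sy V ⊗[ℂ] σ) :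
    C u = 0 := by
  refine evU_eq_zero _ fun l => ?_
  suffices h : ∀ (l : List (Module.Dual ℂ V)) u,
      (l.map (uD V σ)).prod (C u) = C ((l.map (uD V σ)).prod u) by rw [h, h0]
  intro l
  induction l with
  | nil => intro u; rfl
  | cons x l ih =>
    intro u
    simp only [List.map_cons, List.prod_cons, Module.End.mul_apply, ih, hC]

/-- Each summand pairs a change of polynomial degree with the opposite change of exterior degree.
Instead of computing the degree of `I_s^∨`, the proof tests the commutator against `∂_x`: the terms
of `uD_diracU` contain `𝔰(x)`, which lowers the degree by one just as `∂_x` does. -/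
theorem diracU_degU (u : Sy V ⊗[ℂ] (τ ⊗[ℂ] Spin V)) :
    diracU D ρ (degU V τ u) = degU V τ (diracU D ρ u) := by
  rw [← sub_eq_zero]
  refine eq_zero_of_evU (diracU D ρ ∘ₗ degU V τ - degU V τ ∘ₗ diracU D ρ) ?_ ?_ u
  · intro x u
    simp only [LinearMap.sub_apply, LinearMap.comp_apply, map_sub, map_add, map_smul, map_sum,
      uD_degU, uD_diracU, degU_gam, degU_uRep, smul_sub, Finset.sum_sub_distrib]
    abel
  · intro u
    simp only [LinearMap.sub_apply, LinearMap.comp_apply, map_sub, map_add, map_sum,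
      evU_diracU, uD_degU, evU_degU, lTensor_spinDeg_cy, sub_self]

/-- The Dunkl part contains only `𝔰(x_j)`, which anticommutes with `𝔰(x)`. So the anticommutator
sees only the de Rham part, through the Clifford relation with `𝔰(y_j)`. -/
theorem gam_diracU (x : Module.Dual ℂ V) (u : Sy V ⊗[ℂ] (τ ⊗[ℂ] Spin V)) :
    gam V τ x (diracU D ρ u) = -diracU D ρ (gam V τ x u) - (2 : ℂ) • uD V _ x u := by
  have : gam V τ x ∘ₗ diracU D ρ = -(diracU D ρ ∘ₗ gam V τ x) - (2 : ℂ) • uD V _ x := by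
    refine ext3 fun q z ω => ?_
    have h : dx x q = ∑ j, x (yb V j) • dx ((yb V).coord j) q := by
      let B : Module.Dual ℂ V →ₗ[ℂ] Sy V :=
        { toFun := fun x => dx x q
          map_add' := fun x x' => dd_add _ _ _
          map_smul' := fun r x => dd_smul _ _ _ }
      have h1 : B x = ∑ j, x (yb V j) • B ((yb V).coord j) := by
        conv_lhs => rw [← sum_coord x]
        simp only [map_sum, map_smul]
      exact h1
    simp only [LinearMap.comp_apply, LinearMap.sub_apply, LinearMap.neg_apply,
      LinearMap.smul_apply, diracU_tmul, map_sum, map_add, map_smul, gam_tmul, uD_tmul, cx_cy,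
      cx_swap x, TensorProduct.tmul_sub, TensorProduct.tmul_neg, smul_neg, Finset.sum_add_distrib,
      Finset.sum_sub_distrib, Finset.sum_neg_distrib]
    rw [h, TensorProduct.sum_tmul, Finset.smul_sum]
    have h2 : ∀ j, dx ((yb V).coord j) q ⊗ₜ[ℂ] (z ⊗ₜ[ℂ] ((-2 * x (yb V j)) • ω)) =
        -((2 : ℂ) • ((x (yb V j) • dx ((yb V).coord j) q) ⊗ₜ[ℂ] (z ⊗ₜ[ℂ] ω))) := fun j => by
      rw [TensorProduct.tmul_smul, TensorProduct.tmul_smul, ← TensorProduct.smul_tmul', smul_smul,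
        ← neg_smul, neg_mul]
    simp only [h2, Finset.sum_neg_distrib]
    abel
  exact LinearMap.congr_fun this u

theorem uD_uRep_refl {σ : Type u} [AddCommGroup σ] [Module ℂ σ] (ρ : Representation ℂ G σ)
    (x : Module.Dual ℂ V) (s : Refl G) (u : Sy V ⊗[ℂ] σ) :
    uD V σ x (uRep ρ s.1 u) = uRep ρ s.1 (uD V σ x u) +
      (D.d s * x (D.coroot s)) • uD V σ (D.root s) (uRep ρ s.1 u) := by
  have h := LinearMap.congr_fun (uRep_uD ρ s.1 x) u
  simp only [Module.End.mul_apply] at h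
  rw [h, D.refl_apply_dual, map_sub, map_smul, LinearMap.sub_apply, LinearMap.smul_apply]
  abel

/-- Both sides are multiples of `𝔰(α_s^∨) 𝔰(α_s) ω`: on the left `s` is absorbed into a scalar by
`Datum.cx_root`, on the right `s - 1` is such a multiple by `Datum.spin_refl`. -/
theorem spin_refl_comm (s : Refl G) (ω : Spin V) :
    D.c s • cy (D.coroot s) (cx (D.root s) (spin G s.1 ω)) =
      -((2 * (D.c s / D.d s)) • (spin G s.1 ω - ω)) := by
  have hd := D.d_ne_zero s
  rw [D.cx_root, map_neg, map_smul, D.spin_refl, add_sub_cancel_left, smul_smul, smul_neg, smul_smul]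
  congr 2
  field_simp

/-- `D_τ` on `ℂ[𝔥*] ⊗ τ ⊗ S` squares to a degree operator up to elements of the group algebra. -/
theorem diracU_sq (u : Sy V ⊗[ℂ] (τ ⊗[ℂ] Spin V)) : diracU D ρ (diracU D ρ u) =
    -((2 : ℂ) • (D.t • degU V τ u + ∑ s : Refl G, (D.c s / D.d s) •
      (rhoU ρ s.1 u - uRep (tauS ρ) s.1 u))) := by
  rw [← sub_eq_zero, sub_neg_eq_add]
  have h := eq_zero_of_evU (diracU D ρ ∘ₗ diracU D ρ + (2 : ℂ) • (D.t • degU V τ +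
    ∑ s : Refl G, (D.c s / D.d s) • (rhoU ρ s.1 - uRep (tauS ρ) s.1))) ?_ ?_ u
  · simpa only [LinearMap.add_apply, LinearMap.comp_apply, LinearMap.smul_apply,
      LinearMap.sum_apply, LinearMap.sub_apply] using h
  · intro x u
    -- The commutator of `∂_x` with `diracU²` is the anticommutator of `diracU` with the error term
    -- of `uD_diracU`. By `gam_diracU` this leaves only derivatives `∂_x` and `∂_{α_s}`.
    have e1 : ∑ s : Refl G, (D.c s * x (D.coroot s)) •
        gam V τ (D.root s) (diracU D ρ (uRep (tauS ρ) s.1 u)) =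
        -(∑ s : Refl G, (D.c s * x (D.coroot s)) •
          diracU D ρ (gam V τ (D.root s) (uRep (tauS ρ) s.1 u))) -
        (2 : ℂ) • ∑ s : Refl G, (D.c s * x (D.coroot s)) •
          uD V _ (D.root s) (uRep (tauS ρ) s.1 u) := by
      rw [Finset.smul_sum, ← Finset.sum_neg_distrib, ← Finset.sum_sub_distrib]
      refine Finset.sum_congr rfl fun s _ => ?_
      rw [gam_diracU, smul_sub, smul_neg, smul_comm]
    -- The derivatives `∂_{α_s}` cancel against those arising from moving `∂_x` past the diagonal
    -- action of `s`; the factor `d_s` of `uD_uRep_refl` clears the denominator.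
    have e2 : ∑ s : Refl G, (D.c s / D.d s) • uD V _ x (uRep (tauS ρ) s.1 u) =
        ∑ s : Refl G, (D.c s / D.d s) • uRep (tauS ρ) s.1 (uD V _ x u) +
        ∑ s : Refl G, (D.c s * x (D.coroot s)) •
          uD V _ (D.root s) (uRep (tauS ρ) s.1 u) := by
      rw [← Finset.sum_add_distrib]
      refine Finset.sum_congr rfl fun s _ => ?_
      have hd := D.d_ne_zero s
      rw [uD_uRep_refl D, smul_add, smul_smul]
      congr 2
      field_simp
    simp only [LinearMap.add_apply, LinearMap.comp_apply, LinearMap.smul_apply,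
      LinearMap.sum_apply, LinearMap.sub_apply, map_add, map_sub, map_smul, map_sum, uD_diracU,
      uD_degU, uD_rhoU, uRep_diracU, smul_add, smul_sub, Finset.sum_sub_distrib, e1, e2]
    rw [gam_diracU, smul_sub, smul_neg, smul_comm D.t (2 : ℂ)]
    abel
  · intro u
    -- The derivatives commute while the `𝔰(y_j)` anticommute, so the double sum is its own
    -- negative.
    have e0 : ∑ j, (cy (yb V j)).lTensor τ (∑ i, (cy (yb V i)).lTensor τ
        (evU V _ (uD V _ ((yb V).coord i) (uD V _ ((yb V).coord j) u)))) = 0 := by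
      have h1 : ∀ i j, (cy (yb V j)).lTensor τ ((cy (yb V i)).lTensor τ
          (evU V _ (uD V _ ((yb V).coord i) (uD V _ ((yb V).coord j) u)))) =
          -((cy (yb V i)).lTensor τ ((cy (yb V j)).lTensor τ
          (evU V _ (uD V _ ((yb V).coord j) (uD V _ ((yb V).coord i) u))))) := fun i j => by
        have h2 := LinearMap.congr_fun
          (uD_comm (τ := τ ⊗[ℂ] Spin V) ((yb V).coord i) ((yb V).coord j)) u
        simp only [Module.End.mul_apply] at h2
        rw [h2]
        generalize evU V (τ ⊗[ℂ] Spin V) (uD V (τ ⊗[ℂ] Spin V) ((yb V).coord j)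
          (uD V (τ ⊗[ℂ] Spin V) ((yb V).coord i) u)) = w
        have : (cy (yb V j)).lTensor τ ∘ₗ (cy (yb V i)).lTensor τ =
            -((cy (yb V i)).lTensor τ ∘ₗ (cy (yb V j)).lTensor τ) :=
          TensorProduct.ext' fun z ω => by
            simp only [LinearMap.comp_apply, LinearMap.neg_apply, LinearMap.lTensor_tmul]
            rw [cy_swap, TensorProduct.tmul_neg]
        exact LinearMap.congr_fun this w
      simp only [map_sum]
      have h3 := Finset.sum_comm (s := Finset.univ) (t := Finset.univ) (f := fun j i =>
        (cy (yb V j)).lTensor τ ((cy (yb V i)).lTensor τ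
          (evU V _ (uD V _ ((yb V).coord i) (uD V _ ((yb V).coord j) u)))))
      have h4 := h3
      conv_rhs at h4 => rw [Finset.sum_congr rfl fun i _ => Finset.sum_congr rfl fun j _ => h1 i j]
      simp only [Finset.sum_neg_distrib] at h4
      have h5 := add_eq_zero_iff_eq_neg.mpr h4
      rw [← two_smul ℂ] at h5
      exact (smul_eq_zero.mp h5).resolve_left two_ne_zero
    -- What remains at the origin is an identity on `τ ⊗ S`. Its `t`-part is the definition of
    -- `spinDeg`, its `s`-part is `spin_refl_comm`.
    have key : ∀ w : τ ⊗[ℂ] Spin V,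
        ∑ j, (cy (yb V j)).lTensor τ (D.t • (cx ((yb V).coord j)).lTensor τ w -
          ∑ s : Refl G, (D.c s * (yb V).coord j (D.coroot s)) •
            (cx (D.root s)).lTensor τ (TensorProduct.map (ρ s.1) (spin G s.1) w)) +
        (2 : ℂ) • (D.t • (spinDeg V).lTensor τ w + ∑ s : Refl G, (D.c s / D.d s) •
          ((ρ s.1).rTensor (Spin V) w - TensorProduct.map (ρ s.1) (spin G s.1) w)) = 0 := by
      intro w
      induction w using TensorProduct.induction_on with
      | zero => simp
      | add a b ha hb =>
        rw [← add_zero (0 : τ ⊗[ℂ] Spin V)]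
        nth_rewrite 1 [← ha]
        rw [← hb]
        simp only [map_add, map_sub, map_sum, map_smul, smul_add, smul_sub, Finset.sum_add_distrib,
          Finset.sum_sub_distrib]
        abel
      | tmul z ω =>
        have k1 : ∀ s : Refl G, ∑ j, (D.c s * (yb V).coord j (D.coroot s)) •
            (ρ s.1 z ⊗ₜ[ℂ] cy (yb V j) (cx (D.root s) (spin G s.1 ω))) =
            (D.c s / D.d s) • -((2 : ℂ) •
              (ρ s.1 z ⊗ₜ[ℂ] spin G s.1 ω - ρ s.1 z ⊗ₜ[ℂ] ω)) := fun s => by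
          have k2 : ∑ j, (yb V).coord j (D.coroot s) •
              cy (yb V j) (cx (D.root s) (spin G s.1 ω)) =
              cy (D.coroot s) (cx (D.root s) (spin G s.1 ω)) := by
            conv_rhs => rw [← sum_coord_smul (D.coroot s)]
            simp only [cy_apply, map_sum, map_smul, Finset.sum_mul, smul_mul_assoc]
          have k3 := spin_refl_comm D s ω
          rw [← k2, mul_smul] at k3
          rw [← TensorProduct.tmul_sub, ← TensorProduct.tmul_smul, ← TensorProduct.tmul_neg,
            ← TensorProduct.tmul_smul, smul_neg, smul_comm _ (2 : ℂ), ← k3,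
            Finset.smul_sum, TensorProduct.tmul_sum]
          simp only [TensorProduct.tmul_smul, smul_smul]
        have k4 : ∑ j, (z ⊗ₜ[ℂ] cy (yb V j) (cx ((yb V).coord j) ω)) =
            -((2 : ℂ) • (z ⊗ₜ[ℂ] spinDeg V ω)) := by
          rw [spinDeg_apply, ← TensorProduct.tmul_sum, ← TensorProduct.tmul_smul,
            ← TensorProduct.tmul_neg, smul_smul, ← neg_smul]
          norm_num
        simp only [map_sub, map_sum, map_smul, LinearMap.lTensor_tmul, TensorProduct.map_tmul,
          LinearMap.rTensor_tmul, Finset.sum_sub_distrib]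
        rw [Finset.sum_comm (s := Finset.univ) (t := (Finset.univ : Finset (Refl G))),
          Finset.sum_congr rfl fun s _ => k1 s, ← Finset.smul_sum, k4]
        simp only [smul_add, smul_sub, smul_neg, Finset.smul_sum, Finset.sum_sub_distrib,
          Finset.sum_neg_distrib, smul_comm _ (2 : ℂ)]
        abel
    rw [← key (evU V _ u)]
    simp only [LinearMap.add_apply, LinearMap.comp_apply, LinearMap.smul_apply,
      LinearMap.sum_apply, LinearMap.sub_apply, map_add, map_smul, map_sum, map_sub, evU_diracU,
      uD_diracU, evU_gam, evU_uRep, evU_degU, evU_rhoU]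
    simp only [map_sum] at e0 ⊢
    simp only [Finset.sum_add_distrib, e0, zero_add]

end DegreeU

/-! ### Linear algebra of operators that preserve or lower a degree -/

section Filtration

variable {X : Type*} [AddCommGroup X] [Module ℂ X] (N : Module.End ℂ X)

/-- The `k`-eigenspace of a degree operator. -/
abbrev gr (k : ℕ) : Submodule ℂ X := Module.End.eigenspace N (k : ℂ)

/-- The filtration by degree given by a degree operator. -/
def fil : ℕ → Submodule ℂ X
  | 0 => gr N 0
  | n + 1 => fil n ⊔ gr N (n + 1)

variable {N}

theorem mem_gr {k : ℕ} {x : X} : x ∈ gr N k ↔ N x = (k : ℂ) • x := Module.End.mem_eigenspace_iff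

theorem fil_mono : Monotone (fil N) := monotone_nat_of_le_succ fun _ => le_sup_left

theorem gr_le_fil (k : ℕ) : gr N k ≤ fil N k := by
  cases k with
  | zero => exact le_rfl
  | succ k => exact le_sup_right

theorem eq_zero_of_mem_fil_of_mem_gr {n m : ℕ} (h : n < m) {x : X} (h1 : x ∈ fil N n)
    (h2 : x ∈ gr N m) : x = 0 := by
  have hle : ∀ n < m, fil N n ≤ ⨆ (j : ℂ) (_ : j ≠ (m : ℂ)), Module.End.eigenspace N j := by
    intro n
    have hgr : ∀ k < m, gr N k ≤ ⨆ (j : ℂ) (_ : j ≠ (m : ℂ)), Module.End.eigenspace N j :=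
      fun k hk => le_iSup₂_of_le (k : ℂ) (by exact_mod_cast hk.ne) le_rfl
    induction n with
    | zero => exact hgr 0
    | succ n ih => exact fun hn => sup_le (ih (by omega)) (hgr _ hn)
  exact Submodule.disjoint_def.mp (Module.End.eigenspaces_iSupIndep N (m : ℂ)) x h2 (hle n h h1)

/-- Eigenspaces are independent, so subspaces of them that already span everything leave no room for
larger eigenspaces. This identifies eigenspaces with explicit spans. -/
theorem le_of_iSup_eq_top (Y : ℕ → Submodule ℂ X) (h1 : ∀ k, Y k ≤ gr N k) (h2 : ⨆ k, Y k = ⊤)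
    (k : ℕ) : gr N k ≤ Y k := by
  intro x hx
  have h3 : x ∈ Y k ⊔ ⨆ (j : ℕ) (_ : j ≠ k), Y j := by
    have : (⊤ : Submodule ℂ X) ≤ Y k ⊔ ⨆ (j : ℕ) (_ : j ≠ k), Y j := by
      rw [← h2]
      refine iSup_le fun j => ?_
      by_cases hj : j = k
      · exact hj ▸ le_sup_left
      · exact le_sup_of_le_right (le_iSup₂_of_le (f := fun j (_ : j ≠ k) => Y j) j hj le_rfl)
    exact this trivial
  obtain ⟨a, ha, b, hb, rfl⟩ := Submodule.mem_sup.mp h3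
  have hle : ⨆ (j : ℕ) (_ : j ≠ k), Y j ≤
      ⨆ (j : ℂ) (_ : j ≠ (k : ℂ)), Module.End.eigenspace N j :=
    iSup₂_le fun j hj => (h1 j).trans (le_iSup₂_of_le (j : ℂ) (by exact_mod_cast hj) le_rfl)
  have hb' : b ∈ gr N k := by
    have := sub_mem hx (h1 k ha)
    rwa [add_sub_cancel_left] at this
  have : b = 0 := Submodule.disjoint_def.mp (Module.End.eigenspaces_iSupIndep N (k : ℂ)) b hb'
    (hle hb)
  rw [this, add_zero]
  exact ha

theorem exists_mem_fil (h : ⨆ k, gr N k = ⊤) (x : X) : ∃ n, x ∈ fil N n := by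
  have h1 : x ∈ ⨆ n, fil N n := by
    have : (⊤ : Submodule ℂ X) ≤ ⨆ n, fil N n := h ▸ iSup_mono gr_le_fil
    exact this trivial
  exact (Submodule.mem_iSup_of_directed _ (fil_mono.directed_le)).mp h1

/-- The eigenvalue `-1` is not a natural number. This is why a lowering operator annihilates degree
zero. -/
theorem eq_zero_of_eigen_neg_one (h : ⨆ k, gr N k = ⊤) {x : X} (hx : N x = -x) : x = 0 := by
  have h1 : x ∈ Module.End.eigenspace N (-1 : ℂ) := by
    rw [Module.End.mem_eigenspace_iff, hx, neg_one_smul]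
  have h2 : (⊤ : Submodule ℂ X) ≤ ⨆ (j : ℂ) (_ : j ≠ (-1 : ℂ)), Module.End.eigenspace N j := by
    rw [← h]
    refine iSup_le fun k => le_iSup₂_of_le (k : ℂ) (fun hk => ?_) le_rfl
    have h0 : ((k : ℂ) + 1) = 0 := by rw [hk]; ring
    exact Nat.cast_add_one_ne_zero k h0
  exact Submodule.disjoint_def.mp (Module.End.eigenspaces_iSupIndep N (-1 : ℂ)) x h1 (h2 trivial)

theorem map_mem_gr {A : Module.End ℂ X} (hA : ∀ x, N (A x) = A (N x)) {k : ℕ} {x : X}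
    (hx : x ∈ gr N k) : A x ∈ gr N k := by
  rw [mem_gr] at hx ⊢
  rw [hA, hx, map_smul]

theorem map_mem_fil {A : Module.End ℂ X} (hA : ∀ x, N (A x) = A (N x)) {n : ℕ} {x : X}
    (hx : x ∈ fil N n) : A x ∈ fil N n := by
  induction n generalizing x with
  | zero => exact map_mem_gr hA hx
  | succ n ih =>
    obtain ⟨a, ha, b, hb, rfl⟩ := Submodule.mem_sup.mp hx
    rw [map_add]
    exact Submodule.add_mem_sup (ih ha) (map_mem_gr hA hb)

theorem lower_gr_zero (h : ⨆ k, gr N k = ⊤) {A : Module.End ℂ X}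
    (hA : ∀ x, N (A x) = A (N x) - A x) {x : X} (hx : x ∈ gr N 0) : A x = 0 := by
  refine eq_zero_of_eigen_neg_one h ?_
  rw [mem_gr] at hx
  rw [hA, hx, Nat.cast_zero, zero_smul, map_zero, zero_sub]

theorem lower_mem_fil_of_mem_succ (h : ⨆ k, gr N k = ⊤) {A : Module.End ℂ X}
    (hA : ∀ x, N (A x) = A (N x) - A x) {n : ℕ} {x : X} (hx : x ∈ fil N (n + 1)) :
    A x ∈ fil N n := by
  have h1 : ∀ n x, x ∈ gr N (n + 1) → A x ∈ fil N n := fun n x hx => by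
    refine gr_le_fil n ?_
    rw [mem_gr] at hx ⊢
    rw [hA, hx, map_smul, Nat.cast_succ, add_smul, one_smul, add_sub_cancel_right]
  induction n generalizing x with
  | zero =>
    obtain ⟨a, ha, b, hb, rfl⟩ := Submodule.mem_sup.mp hx
    rw [map_add, lower_gr_zero h hA ha, zero_add]
    exact h1 0 b hb
  | succ n ih =>
    obtain ⟨a, ha, b, hb, rfl⟩ := Submodule.mem_sup.mp hx
    rw [map_add]
    exact add_mem (fil_mono n.le_succ (ih ha)) (h1 _ b hb)

theorem lower_mem_fil (h : ⨆ k, gr N k = ⊤) {A : Module.End ℂ X}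
    (hA : ∀ x, N (A x) = A (N x) - A x) {n : ℕ} {x : X} (hx : x ∈ fil N n) :
    A x ∈ fil N n := by
  cases n with
  | zero => rw [lower_gr_zero h hA hx]; exact zero_mem _
  | succ n => exact fil_mono n.le_succ (lower_mem_fil_of_mem_succ h hA hx)

/-- An operator `A + B` with `A` lowering the degree by one and `B` of degree zero has no kernel
modulo `fil N K`, if `B` is injective in degrees above `K`. -/
theorem mem_fil_of_map_mem_fil (h : ⨆ k, gr N k = ⊤) {A B : Module.End ℂ X}
    (hA : ∀ x, N (A x) = A (N x) - A x) (hB : ∀ x, N (B x) = B (N x)) {K : ℕ}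
    (hinj : ∀ k > K, ∀ x ∈ gr N k, B x = 0 → x = 0) {x : X} (hx : A x + B x ∈ fil N K) :
    x ∈ fil N K := by
  obtain ⟨n, hn⟩ := exists_mem_fil h x
  induction n with
  | zero => exact fil_mono K.zero_le hn
  | succ n ih =>
    by_cases hK : n + 1 ≤ K
    · exact fil_mono hK hn
    refine ih ?_
    have h1 := lower_mem_fil_of_mem_succ h hA hn
    obtain ⟨a, ha, b, hb, rfl⟩ := Submodule.mem_sup.mp hn
    -- Modulo `fil N n` only `B b` is left of `A x + B x`, so this homogeneous element of degree `n
    -- + 1` must vanish.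
    have h2 : B b ∈ fil N n := by
      have h3 := sub_mem (sub_mem (fil_mono (by omega : K ≤ n) hx) h1) (map_mem_fil hB ha)
      rwa [add_sub_cancel_left, map_add, add_sub_cancel_left] at h3
    have h3 := hinj _ (by omega) b hb
      (eq_zero_of_mem_fil_of_mem_gr n.lt_succ_self h2 (map_mem_gr hB hb))
    rw [h3, add_zero]
    exact ha

/-- An operator `A + B` with `A` lowering the degree by one and `B` of degree zero is surjective
modulo `fil N K`, if `B` is surjective in degrees above `K`. -/
theorem exists_sub_map_mem_fil (h : ⨆ k, gr N k = ⊤) {A B : Module.End ℂ X}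
    (hA : ∀ x, N (A x) = A (N x) - A x) {K : ℕ}
    (hsurj : ∀ k > K, ∀ x ∈ gr N k, ∃ y ∈ gr N k, B y = x) (x : X) :
    ∃ y, x - (A y + B y) ∈ fil N K := by
  obtain ⟨n, hn⟩ := exists_mem_fil h x
  induction n generalizing x with
  | zero => exact ⟨0, by simpa using fil_mono K.zero_le hn⟩
  | succ n ih =>
    by_cases hK : n + 1 ≤ K
    · exact ⟨0, by simpa using fil_mono hK hn⟩
    obtain ⟨a, ha, b, hb, rfl⟩ := Submodule.mem_sup.mp hn
    obtain ⟨y, hy, rfl⟩ := hsurj _ (by omega) b hb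
    -- Removing the leading term by `y` creates the error `A y`, which has dropped into `fil N n`.
    obtain ⟨y', hy'⟩ := ih (a - A y)
      (sub_mem ha (lower_mem_fil_of_mem_succ h hA (gr_le_fil _ hy)))
    refine ⟨y + y', ?_⟩
    convert hy' using 1
    rw [map_add, map_add]
    abel

/-- A complex with a homotopy between the degree operator and zero is exact in positive degrees. -/
theorem exists_of_homotopy {d h : Module.End ℂ X} (hd : ∀ x, N (d x) = d (N x))
    (hh : ∀ x, N (h x) = h (N x)) (hom : ∀ x, d (h x) + h (d x) = -((2 : ℂ) • N x)) {n : ℕ} {x : X}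
    (hx : x ∈ fil N n) (hdx : d x = 0) : ∃ y ∈ fil N n, ∃ z ∈ gr N 0, x = z + d y := by
  induction n generalizing x with
  | zero => exact ⟨0, zero_mem _, x, hx, by simp⟩
  | succ n ih =>
    obtain ⟨a, ha, b, hb, rfl⟩ := Submodule.mem_sup.mp hx
    -- Since `d` preserves the degree, the leading term of a cocycle is itself a cocycle.
    have h1 : d b = 0 := by
      refine eq_zero_of_mem_fil_of_mem_gr n.lt_succ_self ?_ (map_mem_gr hd hb)
      rw [map_add] at hdx
      rw [eq_neg_of_add_eq_zero_right hdx]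
      exact neg_mem (map_mem_fil hd ha)
    rw [map_add, h1, add_zero] at hdx
    obtain ⟨y, hy, z, hz, e⟩ := ih ha hdx
    have hn : (((n + 1 : ℕ) : ℂ)) ≠ 0 := Nat.cast_ne_zero.mpr n.succ_ne_zero
    have h2 := hom b
    rw [h1, map_zero, add_zero, mem_gr.mp hb] at h2
    -- On the cocycle `b` the homotopy formula reads `d (h b) = -2 (n + 1) b`, which dictates the
    -- coefficient.
    refine ⟨y + (-(1 / (2 * ((n + 1 : ℕ) : ℂ)))) • h b, ?_, z, hz, ?_⟩
    · exact Submodule.add_mem_sup hy (Submodule.smul_mem _ _ (map_mem_gr hh hb))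
    · have h3 : d ((-(1 / (2 * ((n + 1 : ℕ) : ℂ)))) • h b) = b := by
        rw [map_smul, h2, ← neg_smul, smul_smul, smul_smul]
        convert one_smul ℂ b using 2
        field_simp
      rw [map_add, h3, ← add_assoc, ← e]

/-- Components of positive degree keep their degree under `d`, so they cannot contribute to a value
of degree zero and may be dropped. -/
theorem exists_gr_zero_of_map_mem_gr_zero {d : Module.End ℂ X} (hd : ∀ x, N (d x) = d (N x)) {n : ℕ}
    {x : X} (hx : x ∈ fil N n) (hdx : d x ∈ gr N 0) : ∃ y ∈ gr N 0, d y = d x := by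
  induction n generalizing x with
  | zero => exact ⟨x, hx, rfl⟩
  | succ n ih =>
    obtain ⟨a, ha, b, hb, rfl⟩ := Submodule.mem_sup.mp hx
    have h1 : d b = 0 := by
      refine eq_zero_of_mem_fil_of_mem_gr n.lt_succ_self ?_ (map_mem_gr hd hb)
      have := sub_mem (fil_mono n.zero_le hdx) (map_mem_fil hd ha)
      rwa [map_add, add_sub_cancel_left] at this
    rw [map_add, h1, add_zero] at hdx ⊢
    exact ih ha hdx

end Filtration

/-! ### Invertibility outside a finite spectrum -/

section Invertible

/-- In a finite-dimensional algebra, `m t + z` is invertible for almost all natural numbers `m`. -/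
theorem exists_isUnit_add {B : Type*} [Ring B] [Algebra ℂ B] [FiniteDimensional ℂ B] (z : B)
    {t : ℂ} (ht : t ≠ 0) : ∃ K : ℕ, ∀ m > K, IsUnit ((t * (m : ℂ)) • (1 : B) + z) := by
  have h1 : (spectrum ℂ z).Finite := by
    -- The spectrum of an algebraic element consists of roots of any monic polynomial annihilating
    -- it.
    obtain ⟨p, hp, h0⟩ := (Algebra.IsIntegral.isIntegral (R := ℂ) z)
    refine (Polynomial.rootSet_finite p ℂ).subset fun μ hμ => ?_
    rw [Polynomial.mem_rootSet]
    refine ⟨hp.ne_zero, ?_⟩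
    have h2 := spectrum.subset_polynomial_aeval z p ⟨μ, hμ, rfl⟩
    rw [Polynomial.aeval_def, h0] at h2
    have : Nontrivial B := by
      by_contra hB
      rw [not_nontrivial_iff_subsingleton] at hB
      simp [spectrum.of_subsingleton] at hμ
    rw [spectrum.zero_eq] at h2
    simpa using h2
  -- As `t ≠ 0`, the map `m ↦ -t m` is injective and meets the spectrum only finitely often; `K`
  -- bounds these exceptional `m`.
  have h2 : ((fun m : ℕ => -(t * (m : ℂ))) ⁻¹' spectrum ℂ z).Finite := by
    refine h1.preimage fun a _ b _ hab => ?_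
    have := mul_left_cancel₀ ht (neg_injective hab)
    exact_mod_cast this
  obtain ⟨K, hK⟩ := h2.bddAbove
  refine ⟨K, fun m hm => ?_⟩
  have h3 : -(t * (m : ℂ)) ∉ spectrum ℂ z := fun h => not_le.mpr hm (hK h)
  rw [spectrum.mem_iff, not_not] at h3
  have h4 := h3.neg
  rwa [neg_sub, map_neg, sub_neg_eq_add, Algebra.algebraMap_eq_smul_one, add_comm] at h4

end Invertible

/-! ### The degree filtration of `𝔛(τ ⊗ S)` -/

section DegreeX

variable {V : Type u} [AddCommGroup V] [Module ℂ V] [FiniteDimensional ℂ V]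
  {τ : Type u} [AddCommGroup τ] [Module ℂ τ]

variable (V τ) in
/-- The total degree operator in `ℂ[𝔥*]` and `S` on `𝔛_{t,c}(τ ⊗ S)`. -/
def degX : Module.End ℂ (Pol V ⊗[ℂ] (Sy V ⊗[ℂ] (τ ⊗[ℂ] Spin V))) := (degU V τ).lTensor (Pol V)

variable (V τ) in
/-- The span of the tensors of total degree `k` in `ℂ[𝔥*]` and `S`. -/
def homX (k : ℕ) : Submodule ℂ (Pol V ⊗[ℂ] (Sy V ⊗[ℂ] (τ ⊗[ℂ] Spin V))) :=
  Submodule.span ℂ {w | ∃ (p : Pol V) (a b : ℕ) (q : Sy V) (z : τ) (ω : Spin V), a + b = k ∧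
    q ∈ syPow V a ∧ ω ∈ spinPow V b ∧ w = p ⊗ₜ (q ⊗ₜ (z ⊗ₜ ω))}

theorem homX_le (k : ℕ) : homX V τ k ≤ gr (degX V τ) k := by
  refine Submodule.span_le.mpr ?_
  rintro _ ⟨p, a, b, q, z, ω, rfl, hq, hω, rfl⟩
  rw [SetLike.mem_coe, mem_gr, degX, LinearMap.lTensor_tmul, degU_tmul,
    eulerOp_of_mem_syPow _ _ sum_coord_smul a q hq, spinDeg_of_mem_spinPow b ω hω,
    TensorProduct.tmul_smul, TensorProduct.tmul_smul, ← TensorProduct.smul_tmul', ← add_smul,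
    TensorProduct.tmul_smul, Nat.cast_add]

theorem iSup_homX : ⨆ k, homX V τ k = ⊤ := by
  refine Submodule.eq_top_iff'.mpr fun w => ?_
  induction w using TensorProduct.induction_on with
  | zero => exact zero_mem _
  | add a b ha hb => exact add_mem ha hb
  | tmul p u =>
    induction u using TensorProduct.induction_on with
    | zero => rw [TensorProduct.tmul_zero]; exact zero_mem _
    | add a b ha hb => rw [TensorProduct.tmul_add]; exact add_mem ha hb
    | tmul q v =>
      induction v using TensorProduct.induction_on with
      | zero => rw [TensorProduct.tmul_zero, TensorProduct.tmul_zero]; exact zero_mem _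
      | add a b ha hb =>
        rw [TensorProduct.tmul_add, TensorProduct.tmul_add]; exact add_mem ha hb
      | tmul z ω =>
        have hq : q ∈ ⨆ a, syPow V a := by rw [iSup_syPow]; trivial
        have hω : ω ∈ ⨆ a, spinPow V a := by rw [iSup_spinPow]; trivial
        induction hq using Submodule.iSup_induction' with
        | zero => rw [TensorProduct.zero_tmul, TensorProduct.tmul_zero]; exact zero_mem _
        | add a b _ _ ha hb =>
          rw [TensorProduct.add_tmul, TensorProduct.tmul_add]; exact add_mem ha hb
        | mem a q hq =>
          induction hω using Submodule.iSup_induction' with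
          | zero => simp only [TensorProduct.tmul_zero]; exact zero_mem _
          | add a b _ _ ha hb => simp only [TensorProduct.tmul_add]; exact add_mem ha hb
          | mem b ω hω =>
            exact Submodule.mem_iSup_of_mem (a + b)
              (Submodule.subset_span ⟨p, a, b, q, z, ω, rfl, hq, hω, rfl⟩)

/-- The explicit form of the eigenspaces is what recognises degree zero as `𝔐(τ)` and bounds the
filtration by the finitely generated modules of the last parts. -/
theorem gr_degX_le (k : ℕ) : gr (degX V τ) k ≤ homX V τ k :=
  le_of_iSup_eq_top _ homX_le iSup_homX k

theorem iSup_gr_degX : ⨆ k, gr (degX V τ) k = ⊤ :=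
  top_le_iff.mp (iSup_homX (V := V) (τ := τ) ▸ iSup_mono homX_le)

omit [FiniteDimensional ℂ V] in
theorem lTensor_comm_of {U : Type u} [AddCommGroup U] [Module ℂ U] {A B : Module.End ℂ U}
    (h : ∀ u, A (B u) = B (A u)) (w : Pol V ⊗[ℂ] U) :
    A.lTensor (Pol V) (B.lTensor (Pol V) w) = B.lTensor (Pol V) (A.lTensor (Pol V) w) := by
  have : A.lTensor (Pol V) ∘ₗ B.lTensor (Pol V) = B.lTensor (Pol V) ∘ₗ A.lTensor (Pol V) :=
    TensorProduct.ext' fun p u => by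
      simp only [LinearMap.comp_apply, LinearMap.lTensor_tmul, h]
  exact LinearMap.congr_fun this w

omit [FiniteDimensional ℂ V] in
theorem lTensor_lower_of {U : Type u} [AddCommGroup U] [Module ℂ U] {A B : Module.End ℂ U}
    (h : ∀ u, A (B u) = B (A u) - B u) (w : Pol V ⊗[ℂ] U) :
    A.lTensor (Pol V) (B.lTensor (Pol V) w) =
      B.lTensor (Pol V) (A.lTensor (Pol V) w) - B.lTensor (Pol V) w := by
  have : A.lTensor (Pol V) ∘ₗ B.lTensor (Pol V) =
      B.lTensor (Pol V) ∘ₗ A.lTensor (Pol V) - B.lTensor (Pol V) :=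
    TensorProduct.ext' fun p u => by
      simp only [LinearMap.comp_apply, LinearMap.sub_apply, LinearMap.lTensor_tmul, h,
        TensorProduct.tmul_sub]
  exact LinearMap.congr_fun this w

variable {G : Subgroup (V ≃ₗ[ℂ] V)} [Finite G] (D : Datum G) (ρ : Representation ℂ G τ)

omit [FiniteDimensional ℂ V] in
theorem Qx_lTensor {U : Type u} [AddCommGroup U] [Module ℂ U] (σ : Representation ℂ G U)
    (E : Module.Dual ℂ V →ₗ[ℂ] Module.End ℂ U) (x : Module.Dual ℂ V) (A : Module.End ℂ U)
    (hE : ∀ u, E x (A u) = A (E x u)) (hA : ∀ g u, σ g (A u) = A (σ g u)) (w : Pol V ⊗[ℂ] U) :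
    Qx D σ E x (A.lTensor (Pol V) w) = A.lTensor (Pol V) (Qx D σ E x w) := by
  have : Qx D σ E x ∘ₗ A.lTensor (Pol V) = A.lTensor (Pol V) ∘ₗ Qx D σ E x :=
    TensorProduct.ext' fun p u => by
      simp only [LinearMap.comp_apply, LinearMap.lTensor_tmul, Qx_tmul, map_sub, map_add,
        map_smul, map_sum, hE, hA]
  exact LinearMap.congr_fun this w

omit [FiniteDimensional ℂ V] in
-- Separates the summand `E_x`, which is `∂_x` on `𝔛(τ ⊗ S)` and lowers the degree, from a summand
-- that preserves it.
theorem Qx_eq_add {U : Type u} [AddCommGroup U] [Module ℂ U] (σ : Representation ℂ G U)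
    (E : Module.Dual ℂ V →ₗ[ℂ] Module.End ℂ U) (x : Module.Dual ℂ V) (w : Pol V ⊗[ℂ] U) :
    Qx D σ E x w = (E x).lTensor (Pol V) w + Qx D σ 0 x w := by
  have : Qx D σ E x = (E x).lTensor (Pol V) + Qx D σ 0 x :=
    TensorProduct.ext' fun p u => by
      simp only [LinearMap.add_apply, LinearMap.lTensor_tmul, Qx_tmul, LinearMap.zero_apply,
        TensorProduct.tmul_zero, zero_add]
      abel
  rw [this, LinearMap.add_apply]

/-- A subspace stable under the generators is an `H_{t,c}`-submodule. -/
def mkHSubmodule {M : Type u} [AddCommGroup M] [Module ℂ M] [Module (H D) M]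
    [IsScalarTower ℂ (H D) M] (F : Submodule ℂ M) (hF : ∀ a, ∀ m ∈ F, H.of D a • m ∈ F) :
    Submodule (H D) M where
  carrier := F
  add_mem' := F.add_mem
  zero_mem' := F.zero_mem
  smul_mem' h := by
    induction h using H.induction with
    | algebraMap r => intro m hm; rw [algebraMap_smul]; exact F.smul_mem r hm
    | of a => intro m hm; exact hF a m hm
    | mul a b ha hb => intro m hm; rw [mul_smul]; exact ha (hb hm)
    | add a b ha hb => intro m hm; rw [add_smul]; exact F.add_mem (ha hm) (hb hm)

/-- The part of `𝔛_{t,c}(τ ⊗ S)` of degree at most `n` in `ℂ[𝔥*]` and `S`. -/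
def filX (n : ℕ) : Submodule (H D) (XMod D (tauS ρ)) :=
  mkHSubmodule D (M := XMod D (tauS ρ)) (fil (degX V τ) n) fun a m hm => by
    rw [XMod.of_smul]
    cases a with
    | y v => exact map_mem_fil (fun w => (Qy_lTensor v (degU V τ) w).symm) hm
    | g g => exact map_mem_fil (fun w => (Qg_lTensor (uRep (tauS ρ)) g (degU V τ) (degU V τ)
        (fun u => (degU_uRep ρ g u).symm) w).symm) hm
    | x f =>
      have h1 := Qx_eq_add D (uRep (tauS ρ)) (uD V _) f m
      -- The first summand `∂_x` lowers the degree, so only the filtration, not the grading, is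
      -- stable.
      refine (congrArg (· ∈ fil (degX V τ) n) h1).mpr (add_mem ?_ ?_)
      · refine lower_mem_fil iSup_gr_degX (lTensor_lower_of fun u => ?_) hm
        rw [uD_degU]; abel
      · exact map_mem_fil (fun w => (Qx_lTensor D (uRep (tauS ρ)) 0 f (degU V τ) (by simp)
          (fun g u => (degU_uRep ρ g u).symm) w).symm) hm

theorem par_mem_filX {n : ℕ} {w : XMod D (tauS ρ)} (hw : w ∈ filX D ρ n) :
    par D ρ w ∈ filX D ρ n :=
  map_mem_fil (A := (parU V τ).lTensor (Pol V)) (lTensor_comm_of degU_parU) hw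

theorem degX_gam_Qy (w : Pol V ⊗[ℂ] (Sy V ⊗[ℂ] (τ ⊗[ℂ] Spin V))) :
    degX V τ ((∑ j, (gam V τ ((yb V).coord j)).lTensor (Pol V) ∘ₗ Qy _ (yb V j)) w) =
    (∑ j, (gam V τ ((yb V).coord j)).lTensor (Pol V) ∘ₗ Qy _ (yb V j)) (degX V τ w) -
    (∑ j, (gam V τ ((yb V).coord j)).lTensor (Pol V) ∘ₗ Qy _ (yb V j)) w := by
  simp only [LinearMap.sum_apply, LinearMap.comp_apply, map_sum, degX, Qy_lTensor]
  rw [← Finset.sum_sub_distrib]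
  exact Finset.sum_congr rfl fun j _ => lTensor_lower_of (degU_gam _) _

theorem degX_diracU (w : Pol V ⊗[ℂ] (Sy V ⊗[ℂ] (τ ⊗[ℂ] Spin V))) :
    degX V τ ((diracU D ρ).lTensor (Pol V) w) = (diracU D ρ).lTensor (Pol V) (degX V τ w) :=
  lTensor_comm_of (fun u => (diracU_degU ρ D u).symm) w

/-- The form `-(A + B)` required by `mem_fil_of_map_mem_fil` and `exists_sub_map_mem_fil`: the first
summand lowers the degree by one (`degX_gam_Qy`), the second preserves it (`degX_diracU`). -/
theorem diracLin_eq (w : Pol V ⊗[ℂ] (Sy V ⊗[ℂ] (τ ⊗[ℂ] Spin V))) : diracLin D ρ w =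
    -((∑ j, (gam V τ ((yb V).coord j)).lTensor (Pol V) ∘ₗ Qy _ (yb V j)) w +
      (diracU D ρ).lTensor (Pol V) w) := by
  rw [diracLin_apply, LinearMap.sum_apply]; rfl

theorem dirac_mem_filX {n : ℕ} {w : XMod D (tauS ρ)} (hw : w ∈ filX D ρ n) :
    dirac D ρ w ∈ filX D ρ n := by
  have h := add_mem (lower_mem_fil iSup_gr_degX degX_gam_Qy hw)
    (map_mem_fil (degX_diracU D ρ) hw)
  exact (congrArg (· ∈ fil (degX V τ) n) (diracLin_eq D ρ w)).mpr (neg_mem h)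

/-! ### The de Rham complex -/

/-- The parameters `t = r`, `c = 0`. -/
def Datum.withoutRefl {G : Subgroup (V ≃ₗ[ℂ] V)} (D : Datum G) (r : ℂ) : Datum G :=
  { D with t := r, c := 0, c_conj := fun _ _ _ _ => rfl }

/-- The differential `∑_j ∂_{x_j} ⊗ 1 ⊗ 𝔰(y_j)`. -/
def deRhamU : Module.End ℂ (Sy V ⊗[ℂ] (τ ⊗[ℂ] Spin V)) := diracU (D.withoutRefl 0) ρ

/-- The Koszul differential `∑_j y_j ⊗ 1 ⊗ 𝔰(x_j)`. -/
def koszulU : Module.End ℂ (Sy V ⊗[ℂ] (τ ⊗[ℂ] Spin V)) :=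
  diracU (D.withoutRefl 1) ρ - deRhamU D ρ

/-- For `c = 0` the operator is affine in `t`. Comparing powers of `t` in `diracU_sq` then yields
the relations between the de Rham and Koszul differentials without further computation. -/
theorem diracU_withoutRefl (r : ℂ) (u : Sy V ⊗[ℂ] (τ ⊗[ℂ] Spin V)) :
    diracU (D.withoutRefl r) ρ u = deRhamU D ρ u + r • koszulU D ρ u := by
  have : diracU (D.withoutRefl r) ρ = deRhamU D ρ + r • koszulU D ρ := ext3 fun q z ω => by
    simp only [LinearMap.add_apply, LinearMap.smul_apply, LinearMap.sub_apply, koszulU, deRhamU,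
      diracU_tmul]
    simp only [Datum.withoutRefl, Pi.zero_apply, zero_div, zero_mul, zero_smul,
      Finset.sum_const_zero, add_zero, one_smul, Finset.sum_add_distrib, add_sub_cancel_left,
      Finset.smul_sum]
  rw [this, LinearMap.add_apply, LinearMap.smul_apply]

theorem diracU_withoutRefl_sq (r : ℂ) (u : Sy V ⊗[ℂ] (τ ⊗[ℂ] Spin V)) :
    diracU (D.withoutRefl r) ρ (diracU (D.withoutRefl r) ρ u) =
      -((2 : ℂ) • (r • degU V τ u)) := by
  rw [diracU_sq]
  simp [Datum.withoutRefl]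

theorem deRhamU_sq (u : Sy V ⊗[ℂ] (τ ⊗[ℂ] Spin V)) : deRhamU D ρ (deRhamU D ρ u) = 0 := by
  refine (diracU_withoutRefl_sq D ρ 0 u).trans ?_
  rw [zero_smul, smul_zero, neg_zero]

theorem deRhamU_koszulU (u : Sy V ⊗[ℂ] (τ ⊗[ℂ] Spin V)) :
    deRhamU D ρ (koszulU D ρ u) + koszulU D ρ (deRhamU D ρ u) = -((2 : ℂ) • degU V τ u) := by
  have key : ∀ r : ℂ, r • deRhamU D ρ (koszulU D ρ u) + r • koszulU D ρ (deRhamU D ρ u) +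
      (r * r) • koszulU D ρ (koszulU D ρ u) = -((2 : ℂ) • (r • degU V τ u)) := fun r => by
    rw [← diracU_withoutRefl_sq D ρ r u, diracU_withoutRefl D ρ r u, diracU_withoutRefl,
      map_add, map_add, map_smul, map_smul, deRhamU_sq, zero_add, smul_add, smul_smul, add_assoc]
  -- The odd part in `r` isolates the linear coefficient; the quadratic term cancels.
  linear_combination (norm := module) (1 / 2 : ℂ) • key 1 - (1 / 2 : ℂ) • key (-1)

theorem deRhamU_degU (u : Sy V ⊗[ℂ] (τ ⊗[ℂ] Spin V)) :
    degU V τ (deRhamU D ρ u) = deRhamU D ρ (degU V τ u) :=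
  (diracU_degU ρ (D.withoutRefl 0) u).symm

theorem koszulU_degU (u : Sy V ⊗[ℂ] (τ ⊗[ℂ] Spin V)) :
    degU V τ (koszulU D ρ u) = koszulU D ρ (degU V τ u) := by
  simp only [koszulU, LinearMap.sub_apply, map_sub, deRhamU_degU, diracU_degU]

/-- The differential of the de Rham complex of `𝔥*` with values in `𝔐_{t,c}(τ)`, as an
`H_{t,c}`-linear endomorphism of `𝔛_{t,c}(τ ⊗ S)`. -/
def deRham : XMod D (tauS ρ) →ₗ[H D] XMod D (tauS ρ) :=
  mkHLinear D (M := XMod D (tauS ρ)) (N := XMod D (tauS ρ)) ((deRhamU D ρ).lTensor (Pol V))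
    fun a m => by
    rw [XMod.of_smul, XMod.of_smul]
    symm
    cases a with
    | y v => exact Qy_lTensor v (deRhamU D ρ) m
    | x f =>
      refine Qx_lTensor D (uRep (tauS ρ)) _ f (deRhamU D ρ) (fun u => ?_)
        (fun g u => uRep_diracU (D.withoutRefl 0) ρ g u) m
      -- The commutator of `∂_x` with `diracU` is made of terms with a factor `t` or `c(s)`, all
      -- zero here.
      refine (uD_diracU (D.withoutRefl 0) ρ f u).trans ?_
      simp [Datum.withoutRefl, deRhamU]
    | g g =>
      exact Qg_lTensor _ g _ _ (fun u => uRep_diracU (D.withoutRefl 0) ρ g u) m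

theorem deRham_mem_filX {n : ℕ} {w : XMod D (tauS ρ)} (hw : w ∈ filX D ρ n) :
    deRham D ρ w ∈ filX D ρ n :=
  map_mem_fil (A := (deRhamU D ρ).lTensor (Pol V)) (lTensor_comm_of (deRhamU_degU D ρ)) hw

theorem deRham_deRham (w : XMod D (tauS ρ)) : deRham D ρ (deRham D ρ w) = 0 := by
  have : (deRhamU D ρ).lTensor (Pol V) ∘ₗ (deRhamU D ρ).lTensor (Pol V) = 0 :=
    TensorProduct.ext' fun p u => by
      simp only [LinearMap.comp_apply, LinearMap.lTensor_tmul, deRhamU_sq, TensorProduct.tmul_zero,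
        LinearMap.zero_apply]
  exact LinearMap.congr_fun this w

theorem deRham_par (w : XMod D (tauS ρ)) : deRham D ρ (par D ρ w) = -par D ρ (deRham D ρ w) := by
  have : (deRhamU D ρ).lTensor (Pol V) ∘ₗ (parU V τ).lTensor (Pol V) =
      -((parU V τ).lTensor (Pol V) ∘ₗ (deRhamU D ρ).lTensor (Pol V)) :=
    TensorProduct.ext' fun p u => by
      simp only [LinearMap.comp_apply, LinearMap.neg_apply, LinearMap.lTensor_tmul, deRhamU,
        diracU_parU, TensorProduct.tmul_neg]
  exact LinearMap.congr_fun this w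

variable (V τ) in
/-- The inclusion `τ → ℂ[𝔥*] ⊗ τ ⊗ S`, `z ↦ 1 ⊗ z ⊗ 1`. -/
def inclU : τ →ₗ[ℂ] Sy V ⊗[ℂ] (τ ⊗[ℂ] Spin V) :=
  TensorProduct.mk ℂ (Sy V) (τ ⊗[ℂ] Spin V) 1 ∘ₗ (TensorProduct.mk ℂ τ (Spin V)).flip 1

omit [FiniteDimensional ℂ V] in
theorem inclU_apply (z : τ) : inclU V τ z = 1 ⊗ₜ (z ⊗ₜ 1) := rfl

omit [FiniteDimensional ℂ V] in
theorem inclU_injective : Function.Injective (inclU V τ) := by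
  refine Function.LeftInverse.injective (g := (TensorProduct.rid ℂ τ).toLinearMap ∘ₗ
    (ExteriorAlgebra.algebraMapInv (R := ℂ) (M := V)).toLinearMap.lTensor τ ∘ₗ
      evU V (τ ⊗[ℂ] Spin V)) fun z => ?_
  simp only [LinearMap.comp_apply, inclU_apply, evU_tmul, map_one, one_smul,
    LinearMap.lTensor_tmul, AlgHom.toLinearMap_apply, LinearEquiv.coe_coe, TensorProduct.rid_tmul]

theorem MMod.of_smul (a : Gen G) (m : MMod D ρ) : H.of D a • m = Qgen D ρ 0 a m :=
  congrArg (fun f : Module.End ℂ (Pol V ⊗[ℂ] τ) => f m)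
    (act_of D ρ 0 (fun _ _ => rfl) (fun _ _ => by simp) a)

/-- The embedding of `𝔐_{t,c}(τ)` into `𝔛_{t,c}(τ ⊗ S)`. -/
def inclM : MMod D ρ →ₗ[H D] XMod D (tauS ρ) :=
  mkHLinear D (M := MMod D ρ) (N := XMod D (tauS ρ)) ((inclU V τ).lTensor (Pol V))
    fun a m => by
    rw [XMod.of_smul, MMod.of_smul]
    have hg : ∀ g z, uRep (tauS ρ) g (inclU V τ z) = inclU V τ (ρ g z) := fun g z => by
      rw [inclU_apply, inclU_apply, uRep_tauS, spin_one, symRep_apply, map_one]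
    suffices h : (inclU V τ).lTensor (Pol V) ∘ₗ Qgen D ρ 0 a =
        Qgen D (uRep (tauS ρ)) (uD V _) a ∘ₗ (inclU V τ).lTensor (Pol V) from
      LinearMap.congr_fun h m
    refine TensorProduct.ext' fun p z => ?_
    cases a with
    | y v => rfl
    | x f =>
      have h0 : uD V (τ ⊗[ℂ] Spin V) f (inclU V τ z) = 0 := by
        rw [inclU_apply, uD_tmul, dx, dd_one, TensorProduct.zero_tmul]
      simp only [LinearMap.comp_apply, LinearMap.lTensor_tmul, Qgen, Qx_tmul, map_sub, map_add,
        map_smul, map_sum, hg, h0, LinearMap.zero_apply, TensorProduct.tmul_zero, map_zero]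
    | g g => simp only [LinearMap.comp_apply, LinearMap.lTensor_tmul, Qgen, Qg_tmul, hg]

theorem inclM_injective : Function.Injective (inclM D ρ) :=
  Module.Flat.lTensor_preserves_injective_linearMap (M := Pol V) (inclU V τ) inclU_injective

theorem lTensor_inclU_mem_gr (m : Pol V ⊗[ℂ] τ) :
    (inclU V τ).lTensor (Pol V) m ∈ gr (degX V τ) 0 := by
  rw [mem_gr, Nat.cast_zero, zero_smul]
  have : degX V τ ∘ₗ (inclU V τ).lTensor (Pol V) = 0 := TensorProduct.ext' fun p z => by
    simp only [LinearMap.comp_apply, LinearMap.lTensor_tmul, degX, inclU_apply, degU_tmul,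
      eulerOp_one, spinDeg_one, TensorProduct.zero_tmul, TensorProduct.tmul_zero, add_zero,
      LinearMap.zero_apply]
  exact LinearMap.congr_fun this m

theorem inclM_mem_filX (n : ℕ) (m : MMod D ρ) : inclM D ρ m ∈ filX D ρ n :=
  fil_mono n.zero_le (lTensor_inclU_mem_gr m)

theorem par_inclM (m : MMod D ρ) : par D ρ (inclM D ρ m) = inclM D ρ m := by
  have : (parU V τ).lTensor (Pol V) ∘ₗ (inclU V τ).lTensor (Pol V) =
      (inclU V τ).lTensor (Pol V) := TensorProduct.ext' fun p z => by
    simp only [LinearMap.comp_apply, LinearMap.lTensor_tmul, inclU_apply, parU_tmul, parity_one]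
  exact LinearMap.congr_fun this m

theorem deRham_inclM (m : MMod D ρ) : deRham D ρ (inclM D ρ m) = 0 := by
  have : (deRhamU D ρ).lTensor (Pol V) ∘ₗ (inclU V τ).lTensor (Pol V) = 0 :=
    TensorProduct.ext' fun p z => by
      simp only [LinearMap.comp_apply, LinearMap.lTensor_tmul, inclU_apply, deRhamU, diracU_tmul,
        dx, dd_one, TensorProduct.zero_tmul]
      simp [Datum.withoutRefl]
  exact LinearMap.congr_fun this m

/-- Total degree zero forces degree zero in both `ℂ[𝔥*]` and `S`, leaving scalars in these factors.
-/
theorem exists_inclM_of_mem_gr {w : XMod D (tauS ρ)} (hw : w ∈ gr (degX V τ) 0) :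
    ∃ m, inclM D ρ m = w := by
  suffices h : homX V τ 0 ≤ LinearMap.range ((inclU V τ).lTensor (Pol V)) from
    h (gr_degX_le 0 hw)
  refine Submodule.span_le.mpr ?_
  rintro _ ⟨p, a, b, q, z, ω, hab, hq, hω, rfl⟩
  obtain ⟨rfl, rfl⟩ : a = 0 ∧ b = 0 := by omega
  rw [syPow_zero] at hq
  rw [spinPow_zero] at hω
  obtain ⟨r, rfl⟩ := Submodule.mem_one.mp hq
  obtain ⟨r', rfl⟩ := Submodule.mem_one.mp hω
  refine ⟨p ⊗ₜ ((r * r') • z), ?_⟩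
  rw [LinearMap.lTensor_tmul, inclU_apply, Algebra.algebraMap_eq_smul_one,
    Algebra.algebraMap_eq_smul_one]
  simp only [← TensorProduct.smul_tmul', TensorProduct.tmul_smul, smul_smul, mul_comm r]

/-- The Poincaré lemma. -/
theorem deRham_exact {n : ℕ} {w : XMod D (tauS ρ)} (hw : w ∈ filX D ρ n)
    (h : deRham D ρ w = 0) : ∃ v ∈ filX D ρ n, ∃ m, w = inclM D ρ m + deRham D ρ v := by
  have hom : ∀ x, (deRhamU D ρ).lTensor (Pol V) ((koszulU D ρ).lTensor (Pol V) x) +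
      (koszulU D ρ).lTensor (Pol V) ((deRhamU D ρ).lTensor (Pol V) x) =
      -((2 : ℂ) • degX V τ x) := fun x => by
    have : (deRhamU D ρ).lTensor (Pol V) ∘ₗ (koszulU D ρ).lTensor (Pol V) +
      (koszulU D ρ).lTensor (Pol V) ∘ₗ (deRhamU D ρ).lTensor (Pol V) =
      -((2 : ℂ) • degX V τ) := TensorProduct.ext' fun p u => by
        simp only [LinearMap.comp_apply, LinearMap.add_apply, LinearMap.neg_apply,
          LinearMap.smul_apply, LinearMap.lTensor_tmul, degX, ← TensorProduct.tmul_add,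
          deRhamU_koszulU, TensorProduct.tmul_neg, TensorProduct.tmul_smul]
    exact LinearMap.congr_fun this x
  obtain ⟨v, hv, z, hz, e⟩ := exists_of_homotopy (lTensor_comm_of (deRhamU_degU D ρ))
    (lTensor_comm_of (koszulU_degU D ρ)) hom hw h
  obtain ⟨m, rfl⟩ := exists_inclM_of_mem_gr D ρ hz
  exact ⟨v, hv, m, e⟩

/-- A primitive of an element of degree zero can be taken in degree zero, and there `d` vanishes.
Hence no nonzero element of `𝔐(τ)` is exact. -/
theorem eq_zero_of_inclM_eq_deRham {m : MMod D ρ} {v : XMod D (tauS ρ)}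
    (h : inclM D ρ m = deRham D ρ v) : m = 0 := by
  obtain ⟨n, hv⟩ : ∃ n, v ∈ filX D ρ n := exists_mem_fil iSup_gr_degX v
  obtain ⟨y, hy, e⟩ := exists_gr_zero_of_map_mem_gr_zero (lTensor_comm_of (deRhamU_degU D ρ)) hv
    ((congrArg (· ∈ gr (degX V τ) 0) h).mp (lTensor_inclU_mem_gr m))
  obtain ⟨m', rfl⟩ := exists_inclM_of_mem_gr D ρ hy
  have h2 : deRham D ρ (inclM D ρ m') = deRham D ρ v := e
  rw [deRham_inclM, ← h] at h2
  exact inclM_injective D ρ (h2.symm.trans (map_zero _).symm)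

theorem exists_mem_filX (w : XMod D (tauS ρ)) : ∃ n, w ∈ filX D ρ n :=
  exists_mem_fil iSup_gr_degX w

end DegreeX

/-! ### Indices and Euler characteristics in Grothendieck groups -/

section K0

open CategoryTheory

variable {A : Type u} [Ring A] {P : ObjectProperty (ModuleCat.{u} A)}
  {M N L : Type u} [AddCommGroup M] [Module A M] [AddCommGroup N] [Module A N]
  [AddCommGroup L] [Module A L]

theorem prop_of_injective [P.IsClosedUnderSubobjects] (f : M →ₗ[A] N)
    (hf : Function.Injective f) (h : P (ModuleCat.of A N)) : P (ModuleCat.of A M) :=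
  have : Mono (ModuleCat.ofHom f) := (ModuleCat.mono_iff_injective _).mpr hf
  P.prop_of_mono (ModuleCat.ofHom f) h

theorem prop_of_surjective [P.IsClosedUnderQuotients] (f : M →ₗ[A] N)
    (hf : Function.Surjective f) (h : P (ModuleCat.of A M)) : P (ModuleCat.of A N) :=
  have : Epi (ModuleCat.ofHom f) := (ModuleCat.epi_iff_surjective _).mpr hf
  P.prop_of_epi (ModuleCat.ofHom f) h

theorem K0.cls_eq_add (f : M →ₗ[A] N) (g : N →ₗ[A] L) (hf : Function.Injective f)
    (hfg : Function.Exact f g) (hg : Function.Surjective g) (hM : P (ModuleCat.of A M))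
    (hN : P (ModuleCat.of A N)) (hL : P (ModuleCat.of A L)) :
    K0.cls (ModuleCat.of A N) hN = K0.cls (ModuleCat.of A M) hM + K0.cls (ModuleCat.of A L) hL := by
  have h : FreeAbelianGroup.of (⟨ModuleCat.of A N, hN⟩ : P.FullSubcategory) -
      FreeAbelianGroup.of ⟨ModuleCat.of A M, hM⟩ - FreeAbelianGroup.of ⟨ModuleCat.of A L, hL⟩ ∈
      K0.rel P :=
    AddSubgroup.subset_closure ⟨ModuleCat.shortComplexOfCompEqZero f g hfg.linearMap_comp_eq_zero,
      ModuleCat.shortComplex_shortExact _ hfg hf hg, hM, hN, hL, rfl⟩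
  have h2 := (QuotientAddGroup.eq_zero_iff _).mpr h
  rw [QuotientAddGroup.mk_sub, QuotientAddGroup.mk_sub, sub_sub, sub_eq_zero] at h2
  exact h2

/-- The generators of `K0` are objects, not isomorphism classes. The sequences `M → N → 0` and `M →
M → 0` give `[N] = [M] + [0] = [M]`; the zero module satisfies `P` as a quotient of `M`. -/
theorem K0.cls_eq_of_equiv [P.IsClosedUnderQuotients] (e : M ≃ₗ[A] N) (hM : P (ModuleCat.of A M))
    (hN : P (ModuleCat.of A N)) : K0.cls (ModuleCat.of A M) hM = K0.cls (ModuleCat.of A N) hN := by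
  have h0 : P (ModuleCat.of A PUnit.{u + 1}) :=
    prop_of_surjective (0 : M →ₗ[A] PUnit.{u + 1}) (fun _ => ⟨0, rfl⟩) hM
  have h1 : ∀ f : M ≃ₗ[A] N, Function.Exact f.toLinearMap (0 : N →ₗ[A] PUnit.{u + 1}) := fun f y =>
    ⟨fun _ => f.surjective y, fun _ => rfl⟩
  have h2 : Function.Exact (LinearMap.id : M →ₗ[A] M) (0 : M →ₗ[A] PUnit.{u + 1}) := fun y =>
    ⟨fun _ => ⟨y, rfl⟩, fun _ => rfl⟩
  rw [K0.cls_eq_add e.toLinearMap (0 : N →ₗ[A] PUnit.{u + 1}) e.injective (h1 e)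
    (fun _ => ⟨0, rfl⟩) hM hN h0]
  exact K0.cls_eq_add LinearMap.id (0 : M →ₗ[A] PUnit.{u + 1}) Function.injective_id h2
    (fun _ => ⟨0, rfl⟩) hM hM h0

theorem K0.cls_eq_ker_add_range (f : M →ₗ[A] N) (hM : P (ModuleCat.of A M))
    (hk : P (ModuleCat.of A (LinearMap.ker f))) (hr : P (ModuleCat.of A (LinearMap.range f))) :
    K0.cls (ModuleCat.of A M) hM = K0.cls (ModuleCat.of A (LinearMap.ker f)) hk +
      K0.cls (ModuleCat.of A (LinearMap.range f)) hr := by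
  refine K0.cls_eq_add (LinearMap.ker f).subtype f.rangeRestrict (Submodule.injective_subtype _) ?_
    f.surjective_rangeRestrict hk hM hr
  rw [LinearMap.exact_iff, LinearMap.ker_rangeRestrict, Submodule.range_subtype]

theorem K0.cls_prod [P.IsClosedUnderSubobjects] (h : P (ModuleCat.of A (M × N)))
    (hM : P (ModuleCat.of A M)) (hN : P (ModuleCat.of A N)) :
    K0.cls (ModuleCat.of A (M × N)) h = K0.cls (ModuleCat.of A M) hM + K0.cls (ModuleCat.of A N) hN :=
  K0.cls_eq_add (LinearMap.inl A M N) (LinearMap.snd A M N) LinearMap.inl_injective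
    Function.Exact.inl_snd LinearMap.snd_surjective hM h hN

/-- A map `f : M → N` that is bijective modulo submodules `F` and `F'` has the index
`[F] - [F']`. -/
theorem K0.index_eq_sub [P.IsClosedUnderSubobjects] [P.IsClosedUnderQuotients] (f : M →ₗ[A] N)
    (F : Submodule A M) (F' : Submodule A N) (h : ∀ x ∈ F, f x ∈ F') (hinj : ∀ x, f x ∈ F' → x ∈ F)
    (hsurj : ∀ y, ∃ x, y - f x ∈ F') (hF : P (ModuleCat.of A F)) (hF' : P (ModuleCat.of A F')) :
    ∃ (hk : P (ModuleCat.of A (LinearMap.ker f)))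
      (hc : P (ModuleCat.of A (N ⧸ LinearMap.range f))),
      K0.cls (ModuleCat.of A (LinearMap.ker f)) hk -
        K0.cls (ModuleCat.of A (N ⧸ LinearMap.range f)) hc =
        K0.cls (ModuleCat.of A F) hF - K0.cls (ModuleCat.of A F') hF' := by
  have hle : LinearMap.ker f ≤ F := fun x hx => hinj x (by
    rw [LinearMap.mem_ker.mp hx]; exact zero_mem _)
  -- The plan is the exact sequence `0 → ker f → F → F' → coker f → 0`, with `i` and `q` at its ends
  -- and the restriction `g` of `f` in the middle. It is cut into two short exact sequences at the
  -- range of `g`.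
  let i := Submodule.inclusion hle
  have hi : Function.Injective i := Submodule.inclusion_injective hle
  let q := (LinearMap.range f).mkQ ∘ₗ F'.subtype
  have hq : Function.Surjective q := fun y => by
    obtain ⟨y, rfl⟩ := Submodule.mkQ_surjective _ y
    obtain ⟨x, hx⟩ := hsurj y
    refine ⟨⟨_, hx⟩, ?_⟩
    rw [LinearMap.comp_apply, Submodule.subtype_apply, map_sub, sub_eq_self, Submodule.mkQ_apply,
      Submodule.Quotient.mk_eq_zero]
    exact ⟨x, rfl⟩
  let g := f.restrict h
  have hk := prop_of_injective i hi hF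
  have hc := prop_of_surjective q hq hF'
  have hr := prop_of_injective (LinearMap.range g).subtype (Submodule.injective_subtype _) hF'
  have e1 := K0.cls_eq_add i g.rangeRestrict hi (fun x => by
    rw [← LinearMap.mem_ker, LinearMap.ker_rangeRestrict, LinearMap.mem_ker]
    constructor
    · intro hx
      exact ⟨⟨x.1, congrArg Subtype.val hx⟩, rfl⟩
    · rintro ⟨y, rfl⟩
      exact Subtype.ext y.2) g.surjective_rangeRestrict hk hF hr
  have e2 := K0.cls_eq_add (LinearMap.range g).subtype q (Submodule.injective_subtype _) (fun x => by
    rw [LinearMap.comp_apply, Submodule.mkQ_apply, Submodule.Quotient.mk_eq_zero]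
    constructor
    · rintro ⟨y, hy⟩
      -- Exactness at `F'`: an element of `F'` in the range of `f` has its preimages in `F`.
      have hy' : y ∈ F := hinj y (by rw [hy]; exact x.2)
      exact ⟨⟨x, ⟨y, hy'⟩, Subtype.ext hy⟩, rfl⟩
    · rintro ⟨⟨_, y, rfl⟩, rfl⟩
      exact ⟨y.1, rfl⟩) hq hr hF' hc
  refine ⟨hk, hc, ?_⟩
  rw [e1, e2]
  abel

/-- The Euler characteristic of a two-periodic complex with cohomology `L`, in even degree. -/
theorem K0.sub_eq_of_exact [P.IsClosedUnderSubobjects] [P.IsClosedUnderQuotients] (d : M →ₗ[A] N)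
    (d' : N →ₗ[A] M) (i : L →ₗ[A] M) (hi : Function.Injective i) (hdd' : ∀ y, d (d' y) = 0)
    (hd'd : ∀ x, d' (d x) = 0) (hdi : ∀ z, d (i z) = 0)
    (hd : ∀ x, d x = 0 → ∃ y z, x = i z + d' y) (hd' : ∀ y, d' y = 0 → ∃ x, y = d x)
    (hid : ∀ z y, i z = d' y → z = 0) (hM : P (ModuleCat.of A M)) (hN : P (ModuleCat.of A N)) :
    ∃ hL : P (ModuleCat.of A L),
      K0.cls (ModuleCat.of A M) hM - K0.cls (ModuleCat.of A N) hN = K0.cls (ModuleCat.of A L) hL := by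
  have hL := prop_of_injective i hi hM
  have hk := prop_of_injective (LinearMap.ker d).subtype (Submodule.injective_subtype _) hM
  have hr := prop_of_surjective d.rangeRestrict d.surjective_rangeRestrict hM
  have hr' := prop_of_surjective d'.rangeRestrict d'.surjective_rangeRestrict hN
  -- The hypotheses say `ker d = L ⊕ im d'` and `ker d' = im d`. So `[M] = [L] + [im d'] + [im d]`
  -- and `[N] = [im d] + [im d']`.
  let e : (L × LinearMap.range d') →ₗ[A] LinearMap.ker d :=
    (i.codRestrict (LinearMap.ker d) hdi).coprod
      (Submodule.inclusion (by rintro _ ⟨y, rfl⟩; exact hdd' y))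
  have he : Function.Bijective e := by
    constructor
    · rw [injective_iff_map_eq_zero]
      rintro ⟨z, ⟨_, y, rfl⟩⟩ h
      have h1 : i z + d' y = 0 := congrArg Subtype.val h
      have h2 : z = 0 := hid z (-y) (by rw [map_neg]; exact eq_neg_of_add_eq_zero_left h1)
      have h3 : d' y = 0 := by rw [h2, map_zero, zero_add] at h1; exact h1
      exact Prod.ext h2 (Subtype.ext h3)
    · rintro ⟨x, hx⟩
      obtain ⟨y, z, rfl⟩ := hd x hx
      exact ⟨(z, ⟨d' y, y, rfl⟩), rfl⟩
  have hprod := prop_of_injective e he.1 hk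
  have e1 := K0.cls_eq_ker_add_range d hM hk hr
  have e2 := K0.cls_eq_add (LinearMap.range d).subtype d'.rangeRestrict
    (Submodule.injective_subtype _) (fun y => by
      rw [← LinearMap.mem_ker, LinearMap.ker_rangeRestrict, LinearMap.mem_ker]
      constructor
      · intro hy
        obtain ⟨x, rfl⟩ := hd' y hy
        exact ⟨⟨_, x, rfl⟩, rfl⟩
      · rintro ⟨⟨_, x, rfl⟩, rfl⟩
        exact hd'd x) d'.surjective_rangeRestrict hr hN hr'
  have e3 := K0.cls_eq_of_equiv (LinearEquiv.ofBijective e he) hprod hk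
  rw [K0.cls_prod hprod hL hr'] at e3
  refine ⟨hL, ?_⟩
  rw [e1, e2, ← e3]
  abel

end K0

/-! ### The index as the Euler characteristic of the de Rham complex -/

section Index

open CategoryTheory

variable {V : Type u} [AddCommGroup V] [Module ℂ V] [FiniteDimensional ℂ V]
  {G : Subgroup (V ≃ₗ[ℂ] V)} [Finite G] (D : Datum G)
  {τ : Type u} [AddCommGroup τ] [Module ℂ τ] (ρ : Representation ℂ G τ)

theorem mem_XEven {w : XMod D (tauS ρ)} : w ∈ XEven D ρ ↔ par D ρ w = w := sub_eq_zero

theorem mem_XOdd {w : XMod D (tauS ρ)} : w ∈ XOdd D ρ ↔ par D ρ w = -w :=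
  add_eq_zero_iff_eq_neg

theorem par_par (w : XMod D (tauS ρ)) : par D ρ (par D ρ w) = w := by
  have : (parU V τ).lTensor (Pol V) ∘ₗ (parU V τ).lTensor (Pol V) = LinearMap.id := by
    refine TensorProduct.ext' fun p u => ?_
    have h : parU V τ ∘ₗ parU V τ = LinearMap.id := ext3 fun q z ω => by
      simp only [LinearMap.comp_apply, parU_tmul, parity_parity, LinearMap.id_apply]
    have h2 : parU V τ (parU V τ u) = u := LinearMap.congr_fun h u
    simp only [LinearMap.comp_apply, LinearMap.lTensor_tmul, h2, LinearMap.id_apply]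
  exact LinearMap.congr_fun this w

/-- The de Rham differential from even to odd forms. -/
def deRhamPlus : XEven D ρ →ₗ[H D] XOdd D ρ :=
  (deRham D ρ).restrict fun w hw => by
    have h := deRham_par D ρ w
    rw [(mem_XEven D ρ).mp hw] at h
    exact (mem_XOdd D ρ).mpr (neg_eq_iff_eq_neg.mp h.symm)

/-- The de Rham differential from odd to even forms. -/
def deRhamMinus : XOdd D ρ →ₗ[H D] XEven D ρ :=
  (deRham D ρ).restrict fun w hw => by
    have h := deRham_par D ρ w
    rw [(mem_XOdd D ρ).mp hw, map_neg] at h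
    exact (mem_XEven D ρ).mpr (neg_injective h.symm)

theorem half_add_half (w : XMod D (tauS ρ)) : (1 / 2 : ℂ) • (w + w) = w := by
  rw [← two_smul ℂ w, smul_smul]
  norm_num

/-- The index of `D_τ⁺`, computed in a submodule of `𝔛_{t,c}(τ ⊗ S)` outside of which `D_τ` is
bijective and on which the de Rham complex is a resolution of `𝔐_{t,c}(τ)`. -/
theorem index_eq_cls_MObj (P : ObjectProperty (ModuleCat.{u} (H D))) [P.IsClosedUnderSubobjects]
    [P.IsClosedUnderQuotients] (F : Submodule (H D) (XMod D (tauS ρ)))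
    (hpar : ∀ w ∈ F, par D ρ w ∈ F) (hdR : ∀ w ∈ F, deRham D ρ w ∈ F)
    (hincl : ∀ m, inclM D ρ m ∈ F)
    (hexact : ∀ w ∈ F, deRham D ρ w = 0 → ∃ v ∈ F, ∃ m, w = inclM D ρ m + deRham D ρ v)
    (hD : ∀ w ∈ F, dirac D ρ w ∈ F) (hinj : ∀ w, dirac D ρ w ∈ F → w ∈ F)
    (hsurj : ∀ w, ∃ v, w - dirac D ρ v ∈ F)
    (hE : P (ModuleCat.of (H D) (F.comap (XEven D ρ).subtype)))
    (hO : P (ModuleCat.of (H D) (F.comap (XOdd D ρ).subtype))) :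
    ∃ (hk : P (kerObj D ρ)) (hc : P (cokerObj D ρ)) (hM : P (MObj D ρ)),
      K0.cls (kerObj D ρ) hk - K0.cls (cokerObj D ρ) hc = K0.cls (MObj D ρ) hM := by
  obtain ⟨hk, hc, e1⟩ := K0.index_eq_sub (diracPlus D ρ) (F.comap (XEven D ρ).subtype)
    (F.comap (XOdd D ρ).subtype) (fun w hw => hD w.1 hw) (fun w hw => hinj w.1 hw) (fun w => by
      obtain ⟨v, hv⟩ := hsurj w.1
      have hw := (mem_XOdd D ρ).mp w.2
      have h1 := hpar _ hv
      have h2 := dirac_par D ρ v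
      -- The preimage `v` modulo `F` need not be even. As `w` is odd and `D_τ` anticommutes with the
      -- parity, the parity of `v` is another preimage modulo `F`, and the average of the two is
      -- even.
      rw [map_sub, hw, ← neg_eq_iff_eq_neg.mpr h2, sub_neg_eq_add, neg_add_eq_sub] at h1
      refine ⟨⟨(1 / 2 : ℂ) • (v + par D ρ v), (mem_XEven D ρ).mpr ?_⟩, ?_⟩
      · rw [LinearMap.map_smul_of_tower, map_add, par_par, add_comm]
      · have h3 : w.1 - dirac D ρ ((1 / 2 : ℂ) • (v + par D ρ v)) =
            (1 / 2 : ℂ) • ((w.1 - dirac D ρ v) - (dirac D ρ (par D ρ v) - w.1)) := by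
          rw [LinearMap.map_smul_of_tower, map_add]
          nth_rewrite 1 [← half_add_half D ρ w.1]
          rw [← smul_sub]
          congr 1
          abel
        have h4 := F.smul_of_tower_mem (1 / 2 : ℂ) (sub_mem hv h1)
        rw [← h3] at h4
        exact h4) hE hO
  obtain ⟨hM, e2⟩ := K0.sub_eq_of_exact
    ((deRhamPlus D ρ).restrict (p := F.comap (XEven D ρ).subtype) (q := F.comap (XOdd D ρ).subtype)
      fun w hw => hdR w.1 hw)
    ((deRhamMinus D ρ).restrict (p := F.comap (XOdd D ρ).subtype)
      (q := F.comap (XEven D ρ).subtype) fun w hw => hdR w.1 hw)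
    (((inclM D ρ).codRestrict (XEven D ρ) fun m => (mem_XEven D ρ).mpr
      (par_inclM D ρ m)).codRestrict (F.comap (XEven D ρ).subtype) hincl)
    (fun m m' h => inclM_injective D ρ (congrArg (fun w => w.1.1) h))
    (fun w => Subtype.ext (Subtype.ext (deRham_deRham D ρ w.1.1)))
    (fun w => Subtype.ext (Subtype.ext (deRham_deRham D ρ w.1.1)))
    (fun m => Subtype.ext (Subtype.ext (deRham_inclM D ρ m)))
    (fun w hw => by
      obtain ⟨v, hv, m, e⟩ := hexact w.1.1 w.2 (congrArg (fun w => w.1.1) hw)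
      have h0 := (mem_XEven D ρ).mp w.1.2
      -- Applying the parity to the even cocycle gives a second expression with the same `m`;
      -- averaging replaces `v` by its odd part.
      have h1 : w.1.1 = inclM D ρ m + deRham D ρ (-par D ρ v) := by
        rw [← h0]
        nth_rewrite 1 [e]
        rw [map_add, par_inclM, map_neg, deRham_par, neg_neg]
      refine ⟨⟨⟨(1 / 2 : ℂ) • (v - par D ρ v), (mem_XOdd D ρ).mpr ?_⟩, ?_⟩, m,
        Subtype.ext (Subtype.ext ?_)⟩
      · rw [LinearMap.map_smul_of_tower, map_sub, par_par, ← smul_neg, neg_sub]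
      · exact F.smul_of_tower_mem (1 / 2 : ℂ) (sub_mem hv (hpar v hv))
      · have h2 : w.1.1 = (1 / 2 : ℂ) • ((inclM D ρ m + deRham D ρ v) +
            (inclM D ρ m + deRham D ρ (-par D ρ v))) := by
          rw [← e, ← h1, half_add_half]
        refine h2.trans (Eq.trans ?_ (congrArg₂ (· + ·) (half_add_half D ρ (inclM D ρ m))
          (LinearMap.map_smul_of_tower (deRham D ρ) (1 / 2 : ℂ) (v - par D ρ v)).symm))
        rw [← smul_add, map_sub, map_neg]
        congr 1
        abel)
    (fun w hw => by
      obtain ⟨v, hv, m, e⟩ := hexact w.1.1 w.2 (congrArg (fun w => w.1.1) hw)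
      have h0 := (mem_XOdd D ρ).mp w.1.2
      -- For an odd cocycle the parity flips the sign of the term from `𝔐(τ)`, which is even. It
      -- cancels in the average, so there is no odd cohomology.
      have h1 : w.1.1 = -inclM D ρ m + deRham D ρ (par D ρ v) := by
        rw [← neg_neg w.1.1, ← h0]
        nth_rewrite 1 [e]
        rw [map_add, par_inclM, neg_add, deRham_par]
      refine ⟨⟨⟨(1 / 2 : ℂ) • (v + par D ρ v), (mem_XEven D ρ).mpr ?_⟩, ?_⟩,
        Subtype.ext (Subtype.ext ?_)⟩
      · rw [LinearMap.map_smul_of_tower, map_add, par_par, add_comm]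
      · exact F.smul_of_tower_mem (1 / 2 : ℂ) (add_mem hv (hpar v hv))
      · have h2 : w.1.1 = (1 / 2 : ℂ) • ((inclM D ρ m + deRham D ρ v) +
            (-inclM D ρ m + deRham D ρ (par D ρ v))) := by
          rw [← e, ← h1, half_add_half]
        refine h2.trans (Eq.trans ?_
          (LinearMap.map_smul_of_tower (deRham D ρ) (1 / 2 : ℂ) (v + par D ρ v)).symm)
        rw [map_add]
        congr 1
        abel)
    (fun m w h => eq_zero_of_inclM_eq_deRham D ρ (congrArg (fun w => w.1.1) h)) hE hO
  exact ⟨hk, hc, hM, e1.trans e2⟩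

/-- In a Serre subcategory, or any other subcategory closed under subobjects and quotients, that
contains `𝔛_{t,c}(τ ⊗ S)^±`, the index of `D_τ⁺` is the class of `𝔐_{t,c}(τ)`. -/
theorem index_eq_cls_MObj_of_XMod (P : ObjectProperty (ModuleCat.{u} (H D)))
    [P.IsClosedUnderSubobjects] [P.IsClosedUnderQuotients] (hE : P (XEvenObj D ρ))
    (hO : P (XOddObj D ρ)) :
    ∃ (hk : P (kerObj D ρ)) (hc : P (cokerObj D ρ)) (hM : P (MObj D ρ)),
      K0.cls (kerObj D ρ) hk - K0.cls (cokerObj D ρ) hc = K0.cls (MObj D ρ) hM :=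
  -- With `F = ⊤` the conditions on `D_τ` are void, and the index is just `[𝔛⁺] - [𝔛⁻]`.
  index_eq_cls_MObj D ρ P ⊤ (fun _ _ => trivial) (fun _ _ => trivial) (fun _ => trivial)
    (fun w _ h => by
      obtain ⟨n, hn⟩ := exists_mem_filX D ρ w
      obtain ⟨v, -, m, e⟩ := deRham_exact D ρ hn h
      exact ⟨v, trivial, m, e⟩)
    (fun _ _ => trivial) (fun _ _ => trivial) (fun _ => ⟨0, trivial⟩)
    (prop_of_injective (Submodule.subtype _) (Submodule.injective_subtype _) hE)
    (prop_of_injective (Submodule.subtype _) (Submodule.injective_subtype _) hO)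

instance : (locNilp D).IsClosedUnderSubobjects where
  prop_of_mono {X Y} f _ hY m := by
    obtain ⟨n, hn⟩ := hY (f m)
    refine ⟨n, fun l hl => (ModuleCat.mono_iff_injective f).mp inferInstance ?_⟩
    refine (f.hom.map_smul _ m).trans ((hn l hl).trans (map_zero f.hom).symm)

instance : (locNilp D).IsClosedUnderQuotients where
  prop_of_epi {X Y} f _ hX m := by
    obtain ⟨m, rfl⟩ := (ModuleCat.epi_iff_surjective f).mp inferInstance m
    obtain ⟨n, hn⟩ := hX m
    refine ⟨n, fun l hl => ?_⟩
    exact (f.hom.map_smul _ m).symm.trans ((congrArg f.hom (hn l hl)).trans (map_zero f.hom))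

theorem locNilp_XMod {τ : Type u} [AddCommGroup τ] [Module ℂ τ] (ρ : Representation ℂ G τ) :
    locNilp D (ModuleCat.of (H D) (XMod D ρ)) := XMod_nilp D ρ

theorem globalIndex_eq : globalIndex D ρ = K0.cls (MObj D ρ) (locNilp_M D ρ) := by
  obtain ⟨hk, hc, hM, e⟩ := index_eq_cls_MObj_of_XMod D ρ (locNilp D)
    (prop_of_injective (XEven D ρ).subtype (Submodule.injective_subtype _)
      (locNilp_XMod D (tauS ρ)))
    (prop_of_injective (XOdd D ρ).subtype (Submodule.injective_subtype _)
      (locNilp_XMod D (tauS ρ)))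
  exact e

end Index

/-! ### The Eilenberg swindle for locally nilpotent modules -/

section Swindle

open CategoryTheory

variable {V : Type u} [AddCommGroup V] [Module ℂ V]
  {G : Subgroup (V ≃ₗ[ℂ] V)} [Finite G] (D : Datum G)

theorem locNilp_finsupp {M : Type u} [AddCommGroup M] [Module (H D) M]
    (h : locNilp D (ModuleCat.of (H D) M)) : locNilp D (ModuleCat.of (H D) (ℕ →₀ M)) := by
  -- Vanishing for all longer products as well is what allows the bounds of two summands to be
  -- combined.
  suffices hs : ∀ m : ℕ →₀ M, ∃ n : ℕ, ∀ k ≥ n, ∀ l : List V, l.length = k →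
      (l.map fun y => H.of D (.y y)).prod • m = 0 from fun m => by
    obtain ⟨n, hn⟩ := hs m
    exact ⟨n, hn n le_rfl⟩
  intro m
  induction m using Finsupp.induction_linear with
  | zero => exact ⟨0, fun _ _ _ _ => smul_zero _⟩
  | add a b ha hb =>
    obtain ⟨n, hn⟩ := ha
    obtain ⟨n', hn'⟩ := hb
    refine ⟨max n n', fun k hk l hl => ?_⟩
    rw [smul_add, hn k (le_trans (le_max_left _ _) hk) l hl,
      hn' k (le_trans (le_max_right _ _) hk) l hl, add_zero]
  | single i m =>
    obtain ⟨n, hn⟩ := h m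
    refine ⟨n, fun k hk l hl => ?_⟩
    -- The last `n` factors of the product act first and already annihilate `m`.
    rw [Finsupp.smul_single, ← List.take_append_drop (k - n) l, List.map_append, List.prod_append,
      mul_smul]
    have h2 : ((l.drop (k - n)).map fun y => H.of D (.y y)).prod • m = 0 :=
      hn _ (by rw [List.length_drop]; omega)
    rw [h2, smul_zero, Finsupp.single_zero]

/-- Infinite direct sums make the Grothendieck group of the locally `𝔥`-nilpotent modules
vanish. -/
theorem K0.cls_locNilp_eq_zero {M : Type u} [AddCommGroup M] [Module (H D) M]
    (h : locNilp D (ModuleCat.of (H D) M)) : K0.cls (ModuleCat.of (H D) M) h = 0 := by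
  have h1 := locNilp_finsupp D h
  let f : M →ₗ[H D] (ℕ →₀ M) := Finsupp.lsingle 0
  -- The shift has the zeroth summand as kernel, so `[M^(ℕ)] = [M] + [M^(ℕ)]`.
  let g : (ℕ →₀ M) →ₗ[H D] (ℕ →₀ M) := Finsupp.lcomapDomain Nat.succ Nat.succ_injective
  have e := K0.cls_eq_add f g (Finsupp.single_injective 0) (fun m => by
    constructor
    · intro hm
      refine ⟨m 0, Finsupp.ext fun n => ?_⟩
      cases n with
      | zero => simp [f]
      | succ n =>
        have := DFunLike.congr_fun hm n
        simp only [g, Finsupp.lcomapDomain_apply, Finsupp.comapDomain_apply] at this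
        simp only [f, Finsupp.lsingle_apply, Finsupp.single_apply]
        rw [if_neg (by omega)]
        exact this.symm
    · rintro ⟨m, rfl⟩
      refine Finsupp.ext fun n => ?_
      simp [f, g, Finsupp.lcomapDomain]) (fun m =>
        ⟨m.mapDomain Nat.succ, Finsupp.comapDomain_mapDomain _ Nat.succ_injective m⟩) h h1 h1
  exact left_eq_add.mp (e.trans (add_comm _ _))

end Swindle

/-! ### Units of the group algebra acting on representations -/

section GroupAlgebra

variable {Γ : Type*} [Group Γ] {X : Type*} [AddCommGroup X] [Module ℂ X]

theorem asAlgebraHom_mem (Φ : Representation ℂ Γ X) (Y : Submodule ℂ X)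
    (hY : ∀ g, ∀ x ∈ Y, Φ g x ∈ Y) (b : MonoidAlgebra ℂ Γ) :
    ∀ x ∈ Y, Φ.asAlgebraHom b x ∈ Y := by
  induction b using MonoidAlgebra.induction_on with
  | of g => intro x hx; rw [Representation.asAlgebraHom_of]; exact hY g x hx
  | add a b ha hb => intro x hx; rw [map_add]; exact add_mem (ha x hx) (hb x hx)
  | smul r b hb => intro x hx; rw [map_smul]; exact Y.smul_mem r (hb x hx)

/-- The inverse is again an element of the group algebra and so preserves `Y`. No dimension
condition on `Y` is needed, and the bound for invertibility is uniform in the representation. -/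
theorem exists_asAlgebraHom_eq (Φ : Representation ℂ Γ X) (Y : Submodule ℂ X)
    (hY : ∀ g, ∀ x ∈ Y, Φ g x ∈ Y) {b : MonoidAlgebra ℂ Γ} (hb : IsUnit b) {x : X} (hx : x ∈ Y) :
    ∃ y ∈ Y, Φ.asAlgebraHom b y = x := by
  obtain ⟨b, rfl⟩ := hb
  refine ⟨Φ.asAlgebraHom (b⁻¹ : (MonoidAlgebra ℂ Γ)ˣ) x, asAlgebraHom_mem Φ Y hY _ x hx, ?_⟩
  rw [← Module.End.mul_apply, ← map_mul, Units.mul_inv, map_one, Module.End.one_apply]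

theorem eq_zero_of_asAlgebraHom (Φ : Representation ℂ Γ X) {b : MonoidAlgebra ℂ Γ} (hb : IsUnit b)
    {x : X} (hx : Φ.asAlgebraHom b x = 0) : x = 0 := by
  obtain ⟨b, rfl⟩ := hb
  rw [← Module.End.one_apply (R := ℂ) x, ← map_one Φ.asAlgebraHom, ← Units.inv_mul b, map_mul,
    Module.End.mul_apply, hx, map_zero]

/-- A simple module is cyclic, hence finitely generated over the finite-dimensional algebra `ℂ[Γ]`.
-/
theorem finiteDimensional_of_isIrreducible [Finite Γ] (ρ : Representation ℂ Γ X)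
    (hρ : ρ.IsIrreducible) : FiniteDimensional ℂ X := by
  have h1 : IsSimpleModule (MonoidAlgebra ℂ Γ) ρ.asModule :=
    (Representation.irreducible_iff_isSimpleModule_asModule ρ).mp hρ
  have h2 : Module.Finite (MonoidAlgebra ℂ Γ) ρ.asModule := inferInstance
  have h3 : Module.Finite ℂ ρ.asModule := Module.Finite.trans (MonoidAlgebra ℂ Γ) _
  exact Module.Finite.equiv ρ.asModuleEquiv

end GroupAlgebra

/-! ### The image of `ℂ[𝔥]` is Noetherian; closure properties of category `𝒪` -/

section Noetherian

open CategoryTheory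

variable {V : Type u} [AddCommGroup V] [Module ℂ V]
  {G : Subgroup (V ≃ₗ[ℂ] V)} [Finite G] (D : Datum G)

/-- The subalgebra of `H_{t,c}` generated by `𝔥*`. -/
abbrev polAlg : Subalgebra ℂ (H D) := Algebra.adjoin ℂ (Set.range fun x => H.of D (.x x))

theorem H.of_x_add (x x' : Module.Dual ℂ V) :
    H.of D (.x (x + x')) = H.of D (.x x) + H.of D (.x x') := by
  have h := RingQuot.mkAlgHom_rel ℂ (Rel.x_add (D := D) x x')
  rwa [map_add] at h

theorem H.of_x_smul (r : ℂ) (x : Module.Dual ℂ V) :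
    H.of D (.x (r • x)) = r • H.of D (.x x) := by
  have h := RingQuot.mkAlgHom_rel ℂ (Rel.x_smul (D := D) r x)
  rwa [map_smul] at h

theorem H.of_x_comm (x x' : Module.Dual ℂ V) :
    H.of D (.x x) * H.of D (.x x') = H.of D (.x x') * H.of D (.x x) := by
  have h := RingQuot.mkAlgHom_rel ℂ (Rel.xx (D := D) x x')
  rwa [map_mul, map_mul] at h

/-- The generators `x ∈ 𝔥*`, as a linear map. -/
def H.ofX : Module.Dual ℂ V →ₗ[ℂ] H D where
  toFun x := H.of D (.x x)
  map_add' := H.of_x_add D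
  map_smul' := H.of_x_smul D

variable [FiniteDimensional ℂ V]

theorem polAlg_fg : (polAlg D).FG := by
  classical
  refine ⟨Finset.univ.image fun j => H.of D (.x ((yb V).coord j)), le_antisymm ?_ ?_⟩
  · refine Algebra.adjoin_mono ?_
    intro a ha
    simp only [Finset.coe_image, Set.mem_image] at ha
    obtain ⟨j, -, rfl⟩ := ha
    exact ⟨_, rfl⟩
  · refine Algebra.adjoin_le ?_
    rintro _ ⟨x, rfl⟩
    have h : H.ofX D x = ∑ j, x (yb V j) • H.ofX D ((yb V).coord j) := by
      conv_lhs => rw [← sum_coord x]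
      simp only [map_sum, map_smul]
    refine (congrArg (· ∈ Algebra.adjoin ℂ _) h).mpr (sum_mem fun j _ => ?_)
    refine Subalgebra.smul_mem _ (Algebra.subset_adjoin ?_) _
    simp only [Finset.coe_image, Set.mem_image]
    exact ⟨j, Finset.mem_coe.mpr (Finset.mem_univ j), rfl⟩

open scoped IsMulCommutative in
-- The generators commute and a basis of `𝔥*` suffices, so Hilbert's basis theorem applies. Only a
-- quotient of `ℂ[𝔥]` is needed, hence no PBW theorem. Closure of `catO` under subobjects rests on
-- this.
theorem isNoetherianRing_polAlg : IsNoetherianRing (polAlg D) := by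
  have h : ∀ a ∈ Set.range fun x => H.of D (.x x), ∀ b ∈ Set.range fun x => H.of D (.x x),
      a * b = b * a := by
    rintro _ ⟨x, rfl⟩ _ ⟨x', rfl⟩
    exact H.of_x_comm D x x'
  have := Algebra.isMulCommutative_adjoin ℂ h
  have := (polAlg D).fg_iff_finiteType.mp (polAlg_fg D)
  exact Algebra.FiniteType.isNoetherianRing ℂ _

instance : (catO D).IsClosedUnderSubobjects where
  prop_of_mono {X Y} f _ hY := by
    refine ⟨(locNilp D).prop_of_mono f hY.1, ?_⟩
    have := isNoetherianRing_polAlg D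
    have := hY.2
    exact Module.Finite.of_injective (f.hom.restrictScalars (polAlg D))
      ((ModuleCat.mono_iff_injective f).mp inferInstance)

instance : (catO D).IsClosedUnderQuotients where
  prop_of_epi {X Y} f _ hX := by
    refine ⟨(locNilp D).prop_of_epi f hX.1, ?_⟩
    have := hX.2
    exact Module.Finite.of_surjective (f.hom.restrictScalars (polAlg D))
      ((ModuleCat.epi_iff_surjective f).mp inferInstance)

end Noetherian

/-! ### Finite dimensionality of the spin module -/

section SpinFinite

theorem spinPow_eq_bot (V : Type u) [AddCommGroup V] [Module ℂ V] [FiniteDimensional ℂ V] {n : ℕ}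
    (h : Module.finrank ℂ V < n) : spinPow V n = ⊥ := by
  have : Module.Finite ℂ ↥(spinPow V n) := exteriorPower.instFinite
  refine Submodule.finrank_eq_zero.mp ?_
  exact (exteriorPower.finrank_eq ℂ n).trans (Nat.choose_eq_zero_of_lt h)

instance (V : Type u) [AddCommGroup V] [Module ℂ V] [FiniteDimensional ℂ V] :
    FiniteDimensional ℂ (Spin V) := by
  refine Module.finite_def.mpr ?_
  have h : (⊤ : Submodule ℂ (Spin V)) = ⨆ n ∈ Finset.range (Module.finrank ℂ V + 1), spinPow V n := by
    refine le_antisymm ?_ le_top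
    rw [← iSup_spinPow]
    refine iSup_le fun n => ?_
    by_cases hn : n < Module.finrank ℂ V + 1
    · exact le_iSup₂_of_le n (Finset.mem_range.mpr hn) le_rfl
    · rw [spinPow_eq_bot V (by omega)]; exact bot_le
  rw [h]
  exact Submodule.fg_biSup _ _ fun n _ => Submodule.FG.pow (Submodule.fg_range _) n

end SpinFinite

/-! ### Finite generation of bounded parts over `ℂ[𝔥]` for nonzero `t` -/

section Finiteness

variable {V : Type u} [AddCommGroup V] [Module ℂ V]

/-- Elements of `ℂ[𝔥] ⊗ ℂ[𝔥*] ⊗ σ` of degree `m` in `ℂ[𝔥]` and degree `a` in `ℂ[𝔥*]`. -/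
def biHom (V σ : Type u) [AddCommGroup V] [Module ℂ V] [AddCommGroup σ] [Module ℂ σ] (m a : ℕ) :
    Submodule ℂ (Pol V ⊗[ℂ] (Sy V ⊗[ℂ] σ)) :=
  Submodule.map₂ (TensorProduct.mk ℂ _ _) (syPow (Module.Dual ℂ V) m)
    (Submodule.map₂ (TensorProduct.mk ℂ _ _) (syPow V a) ⊤)

variable {σ : Type u} [AddCommGroup σ] [Module ℂ σ]

theorem tmul_mem_biHom {m a : ℕ} {p : Pol V} (hp : p ∈ syPow (Module.Dual ℂ V) m) {q : Sy V}
    (hq : q ∈ syPow V a) (z : σ) : p ⊗ₜ (q ⊗ₜ z) ∈ biHom V σ m a :=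
  Submodule.apply_mem_map₂ _ hp (Submodule.apply_mem_map₂ _ hq trivial)

theorem biHom_le {m a : ℕ} {T : Submodule ℂ (Pol V ⊗[ℂ] (Sy V ⊗[ℂ] σ))}
    (h : ∀ p ∈ syPow (Module.Dual ℂ V) m, ∀ q ∈ syPow V a, ∀ z, p ⊗ₜ (q ⊗ₜ z) ∈ T) :
    biHom V σ m a ≤ T := by
  refine Submodule.map₂_le.mpr fun p hp u hu => ?_
  have h1 : Submodule.map₂ (TensorProduct.mk ℂ (Sy V) σ) (syPow V a) ⊤ ≤
      T.comap (TensorProduct.mk ℂ _ _ p) := Submodule.map₂_le.mpr fun q hq z _ => h p hp q hq z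
  exact h1 hu

theorem biHom_fg [FiniteDimensional ℂ V] [FiniteDimensional ℂ σ] (m a : ℕ) : (biHom V σ m a).FG :=
  (syPow_fg m).map₂ _ ((syPow_fg a).map₂ _ Module.Finite.fg_top)

theorem Qy_mem_biHom (y : V) {m a : ℕ} {w : Pol V ⊗[ℂ] (Sy V ⊗[ℂ] σ)}
    (hw : w ∈ biHom V σ (m + 1) a) : Qy _ y w ∈ biHom V σ m a := by
  refine (biHom_le (T := (biHom V σ m a).comap (Qy _ y)) fun p hp q hq z => ?_) hw
  rw [Submodule.mem_comap, Qy_tmul]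
  exact tmul_mem_biHom (dd_mem_syPow _ m p hp) hq z

theorem lTensor_uD_mem_biHom (x : Module.Dual ℂ V) {m a : ℕ} {w : Pol V ⊗[ℂ] (Sy V ⊗[ℂ] σ)}
    (hw : w ∈ biHom V σ m (a + 1)) : (uD V σ x).lTensor (Pol V) w ∈ biHom V σ m a := by
  refine (biHom_le (T := (biHom V σ m a).comap ((uD V σ x).lTensor (Pol V)))
    fun p hp q hq z => ?_) hw
  rw [Submodule.mem_comap, LinearMap.lTensor_tmul, uD_tmul]
  exact tmul_mem_biHom hp (dd_mem_syPow _ a q hq) z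

theorem lTensor_uD_of_mem_biHom_zero (x : Module.Dual ℂ V) {m : ℕ} {w : Pol V ⊗[ℂ] (Sy V ⊗[ℂ] σ)}
    (hw : w ∈ biHom V σ m 0) : (uD V σ x).lTensor (Pol V) w = 0 := by
  refine (biHom_le (T := LinearMap.ker ((uD V σ x).lTensor (Pol V))) fun p hp q hq z => ?_) hw
  rw [LinearMap.mem_ker, LinearMap.lTensor_tmul, uD_tmul, dx, dd_of_mem_syPow_zero _ hq,
    TensorProduct.zero_tmul, TensorProduct.tmul_zero]

variable [FiniteDimensional ℂ V] {G : Subgroup (V ≃ₗ[ℂ] V)} [Finite G] (D : Datum G)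
  (ρ : Representation ℂ G σ)

/-- The action of `G × G` on `ℂ[𝔥] ⊗ U`. -/
def prodRep {U : Type u} [AddCommGroup U] [Module ℂ U] (ρ : Representation ℂ G U) :
    Representation ℂ (G × G) (Pol V ⊗[ℂ] U) :=
  Representation.tprod ((symRep (costd G)).comp (MonoidHom.fst G G)) (ρ.comp (MonoidHom.snd G G))

theorem prodRep_tmul {U : Type u} [AddCommGroup U] [Module ℂ U] (ρ : Representation ℂ G U)
    (g : G × G) (p : Pol V) (u : U) :
    prodRep ρ g (p ⊗ₜ u) = symRep (costd G) g.1 p ⊗ₜ ρ g.2 u := rfl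

theorem prodRep_mem_biHom (m a : ℕ) (g : G × G) :
    ∀ w ∈ biHom V σ m a, prodRep (uRep ρ) g w ∈ biHom V σ m a := fun w hw => by
  refine (biHom_le (T := (biHom V σ m a).comap (prodRep (uRep ρ) g)) fun p hp q hq z => ?_) hw
  rw [Submodule.mem_comap, prodRep_tmul, uRep_tmul, symRep_apply, symRep_apply]
  exact tmul_mem_biHom (symMap_mem_syPow _ m p hp) (symMap_mem_syPow _ a q hq) _

/-- The element `∑_s (c(s) / d_s) ((s, s) - (1, s))` of the group algebra of `G × G`. -/
def Datum.cas : MonoidAlgebra ℂ (G × G) :=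
  ∑ s : Refl G, (D.c s / D.d s) •
    (MonoidAlgebra.of ℂ (G × G) (s.1, s.1) - MonoidAlgebra.of ℂ (G × G) (1, s.1))

theorem asAlgebraHom_cas {X : Type*} [AddCommGroup X] [Module ℂ X]
    (Φ : Representation ℂ (G × G) X) (x : X) : Φ.asAlgebraHom D.cas x =
      ∑ s : Refl G, (D.c s / D.d s) • (Φ (s.1, s.1) x - Φ (1, s.1) x) := by
  simp only [Datum.cas, map_sum, map_smul, map_sub, Representation.asAlgebraHom_of,
    LinearMap.sum_apply, LinearMap.smul_apply, LinearMap.sub_apply]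

/-- The Euler element `∑_j x_j y_j` acts by the degree up to elements of the group algebra. -/
theorem sum_Qx_Qy {U : Type u} [AddCommGroup U] [Module ℂ U] (ρ : Representation ℂ G U)
    (E : Module.Dual ℂ V →ₗ[ℂ] Module.End ℂ U) (p : Pol V) (u : U) :
    ∑ j, Qx D ρ E ((yb V).coord j) (Qy U (yb V j) (p ⊗ₜ u)) =
      ∑ j, (E ((yb V).coord j)).lTensor (Pol V) (Qy U (yb V j) (p ⊗ₜ u)) +
      D.t • (eulerOp (fun j => (yb V).coord j) (fun j => Module.Dual.eval ℂ V (yb V j)) p ⊗ₜ u) +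
      (prodRep ρ).asAlgebraHom D.cas (p ⊗ₜ u) := by
  -- The sum over `j` assembles the derivative along `α_s^∨`, and by the fundamental theorem of
  -- calculus `I_s ∂_{α_s^∨} = 1 - s`. On `ℂ[𝔥] ⊗ U` this is `(1, s) - (s, s)` in the action of `G ×
  -- G`.
  have h1 : ∀ s : Refl G, ∑ j, (D.c s / D.d s * (yb V).coord j (D.coroot s)) •
      (D.int s (dy (yb V j) p) ⊗ₜ[ℂ] ρ s.1 u) =
      (D.c s / D.d s) • (p ⊗ₜ[ℂ] ρ s.1 u - symRep (costd G) s.1 p ⊗ₜ[ℂ] ρ s.1 u) := fun s => by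
    have h2 : ∑ j, (yb V).coord j (D.coroot s) • dy (yb V j) p = dy (D.coroot s) p := by
      let B : V →ₗ[ℂ] Pol V :=
        { toFun := fun y => dy y p
          map_add' := fun y y' => by
            rw [dy, dy, dy, map_add, dd_add]
          map_smul' := fun r y => by
            rw [dy, dy, map_smul, dd_smul, RingHom.id_apply] }
      have h3 : B (D.coroot s) = ∑ j, (yb V).coord j (D.coroot s) • B (yb V j) := by
        conv_lhs => rw [← sum_coord_smul (D.coroot s)]
        simp only [map_sum, map_smul]
      exact h3.symm
    have h4 : D.int s (dy (D.coroot s) p) = p - symRep (costd G) s.1 p :=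
      lineInt_dd_self (D.d s) (D.root s) (Module.Dual.eval ℂ V (D.coroot s)) (costd G s.1)
        (fun w => by rw [D.refl_apply_dual, Module.Dual.eval_apply]) p
    rw [← TensorProduct.sub_tmul, ← h4, ← h2, map_sum, TensorProduct.sum_tmul, Finset.smul_sum]
    refine Finset.sum_congr rfl fun j _ => ?_
    rw [map_smul, ← TensorProduct.smul_tmul', mul_smul]
  simp only [Qy_tmul, Qx_tmul, LinearMap.lTensor_tmul, asAlgebraHom_cas, prodRep_tmul, map_one,
    Module.End.one_apply, Finset.sum_add_distrib, Finset.sum_sub_distrib, eulerOp_apply,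
    TensorProduct.sum_tmul, Finset.smul_sum]
  rw [Finset.sum_comm (s := Finset.univ) (t := (Finset.univ : Finset (Refl G))),
    Finset.sum_congr rfl fun s _ => h1 s, sub_eq_add_neg, ← Finset.sum_neg_distrib]
  congr 1
  exact Finset.sum_congr rfl fun s _ =>
    (smul_neg _ _).symm.trans (congrArg _ (neg_sub _ _))

/-- In degree `m` the Euler operator is the scalar `m`, so `sum_Qx_Qy` can be solved for an element
of the group algebra of `G × G` that is invertible for large `m`. The right side involves only
vectors of degree `m - 1` in `ℂ[𝔥]`, to which some `x_j` or `∂_{x_j}` is applied. -/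
theorem asAlgebraHom_biHom {m a : ℕ} {w : Pol V ⊗[ℂ] (Sy V ⊗[ℂ] σ)} (hw : w ∈ biHom V σ m a) :
    (prodRep (uRep ρ)).asAlgebraHom ((D.t * (m : ℂ)) • 1 + D.cas) w =
      ∑ j, Qx D (uRep ρ) (uD V σ) ((yb V).coord j) (Qy _ (yb V j) w) -
      ∑ j, (uD V σ ((yb V).coord j)).lTensor (Pol V) (Qy _ (yb V j) w) := by
  refine (biHom_le (T := LinearMap.eqLocus
    ((prodRep (uRep ρ)).asAlgebraHom ((D.t * (m : ℂ)) • 1 + D.cas))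
    (∑ j, Qx D (uRep ρ) (uD V σ) ((yb V).coord j) ∘ₗ (Qy _ (yb V j)) -
      ∑ j, (uD V σ ((yb V).coord j)).lTensor (Pol V) ∘ₗ (Qy _ (yb V j))))
      fun p hp q hq z => ?_) hw |>.trans ?_
  · rw [LinearMap.mem_eqLocus]
    simp only [LinearMap.sub_apply, LinearMap.sum_apply, LinearMap.comp_apply, sum_Qx_Qy]
    rw [eulerOp_of_mem_syPow _ _ (fun x => sum_coord x) m p hp, map_add, LinearMap.add_apply,
      map_smul, map_one, LinearMap.smul_apply, Module.End.one_apply, ← TensorProduct.smul_tmul',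
      smul_smul]
    abel
  · simp only [LinearMap.sub_apply, LinearMap.sum_apply, LinearMap.comp_apply]

/-- For `t ≠ 0`, the part of `𝔛_{t,c}(σ)` of bounded degree in `ℂ[𝔥*]` is contained in a finitely
generated `ℂ[𝔥]`-module. -/
theorem exists_fg_biHom_le [FiniteDimensional ℂ σ] (ht : D.t ≠ 0) (n : ℕ) :
    ∃ N : Submodule (polAlg D) (XMod D ρ), N.FG ∧
      ∀ m, ∀ a ≤ n, ∀ w : XMod D ρ, w ∈ biHom V σ m a → w ∈ N := by
  obtain ⟨K, hK⟩ := exists_isUnit_add D.cas ht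
  -- The finitely many bidegrees not reached by the invertibility argument; a finite spanning set of
  -- their sum generates everything.
  let Z : Submodule ℂ (Pol V ⊗[ℂ] (Sy V ⊗[ℂ] σ)) :=
    ⨆ m ∈ Finset.range (K + 1), ⨆ a ∈ Finset.range (n + 1), biHom V σ m a
  have hle : ∀ m ≤ K, ∀ a ≤ n, biHom V σ m a ≤ Z := fun m hm a ha =>
    le_iSup₂_of_le m (Finset.mem_range_succ_iff.mpr hm)
      (le_iSup₂_of_le (f := fun a _ => biHom V σ m a) a (Finset.mem_range_succ_iff.mpr ha) le_rfl)
  have hZ : Z.FG := Submodule.fg_biSup _ _ fun m _ => Submodule.fg_biSup _ _ fun a _ => biHom_fg m a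
  obtain ⟨S, hS⟩ := hZ
  let S' : Finset (XMod D ρ) := S
  refine ⟨Submodule.span (polAlg D) S', ⟨S', rfl⟩, fun m => ?_⟩
  have h0 : ∀ w ∈ Z, w ∈ Submodule.span (polAlg D) (S' : Set (XMod D ρ)) := fun w hw => by
    rw [← hS] at hw
    exact Submodule.span_le_restrictScalars ℂ (polAlg D) (S' : Set (XMod D ρ)) hw
  generalize Submodule.span (polAlg D) (S' : Set (XMod D ρ)) = N at h0
  induction m with
  | zero =>
    intro a ha w hw
    exact h0 w (hle 0 K.zero_le a ha hw)
  | succ m ih =>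
    intro a ha w hw
    by_cases hm : m + 1 ≤ K
    · exact h0 w (hle (m + 1) hm a ha hw)
    -- Above `K` the group algebra element is invertible, so `w` comes from some `v` of the same
    -- bidegree. This writes `w` as `∑ x_j (∂_{y_j} v) - ∑ ∂_{x_j} ∂_{y_j} v`, where the vectors
    -- `∂_{y_j} v` and `∂_{x_j} ∂_{y_j} v` are covered by the induction on `m`.
    obtain ⟨v, hv, e⟩ := exists_asAlgebraHom_eq (prodRep (uRep ρ)) _ (prodRep_mem_biHom ρ (m + 1) a)
      (hK (m + 1) (by omega)) hw
    rw [asAlgebraHom_biHom D ρ hv] at e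
    rw [← e]
    refine N.sub_mem (N.sum_mem fun j _ => ?_) (N.sum_mem fun j _ => ?_)
    · have h1 := N.smul_mem (⟨H.of D (.x ((yb V).coord j)), Algebra.subset_adjoin ⟨_, rfl⟩⟩ :
        polAlg D) (ih a ha (Qy (Sy V ⊗[ℂ] σ) (yb V j) v) (Qy_mem_biHom _ hv))
      exact (congrArg (· ∈ N) (XMod.of_smul D ρ (.x ((yb V).coord j)) _)).mp h1
    · cases a with
      | zero =>
        exact (congrArg (· ∈ N) (lTensor_uD_of_mem_biHom_zero ((yb V).coord j)
          (Qy_mem_biHom (yb V j) hv))).mpr N.zero_mem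
      | succ a => exact ih a (by omega) _ (lTensor_uD_mem_biHom _ (Qy_mem_biHom _ hv))

end Finiteness

/-! ### Bijectivity of `diracU` in large degrees for nonzero `t` -/

section Bijectivity

variable {V : Type u} [AddCommGroup V] [Module ℂ V] [FiniteDimensional ℂ V]
  {τ : Type u} [AddCommGroup τ] [Module ℂ τ]
  {G : Subgroup (V ≃ₗ[ℂ] V)} [Finite G] (D : Datum G) (ρ : Representation ℂ G τ)

/-- The action of `G × G` on `ℂ[𝔥*] ⊗ τ ⊗ S`, by the first factor on `ℂ[𝔥*] ⊗ S` and by the second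
factor on `τ`. -/
def splitRep : Representation ℂ (G × G) (Sy V ⊗[ℂ] (τ ⊗[ℂ] Spin V)) :=
  Representation.tprod ((symRep (std G)).comp (MonoidHom.fst G G))
    (Representation.tprod (ρ.comp (MonoidHom.snd G G)) ((spin G).comp (MonoidHom.fst G G)))

omit [FiniteDimensional ℂ V] [Finite G] in
theorem splitRep_tmul (g : G × G) (q : Sy V) (z : τ) (ω : Spin V) :
    splitRep ρ g (q ⊗ₜ (z ⊗ₜ ω)) = symRep (std G) g.1 q ⊗ₜ (ρ g.2 z ⊗ₜ spin G g.1 ω) := rfl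

omit [FiniteDimensional ℂ V] in
theorem splitRep_diag (g : G) (u : Sy V ⊗[ℂ] (τ ⊗[ℂ] Spin V)) :
    splitRep ρ (g, g) u = uRep (tauS ρ) g u := rfl

omit [Finite G] in
theorem splitRep_one (g : G) (u : Sy V ⊗[ℂ] (τ ⊗[ℂ] Spin V)) :
    splitRep ρ (1, g) u = rhoU ρ g u := by
  have : splitRep ρ (1, g) = rhoU ρ g := ext3 fun q z ω => by
    simp only [splitRep_tmul, rhoU_tmul, map_one, Module.End.one_apply]
  rw [this]

omit [Finite G] in
theorem degU_splitRep (g : G × G) (u : Sy V ⊗[ℂ] (τ ⊗[ℂ] Spin V)) :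
    degU V τ (splitRep ρ g u) = splitRep ρ g (degU V τ u) := by
  have : degU V τ ∘ₗ splitRep ρ g = splitRep ρ g ∘ₗ degU V τ := ext3 fun q z ω => by
    simp only [LinearMap.comp_apply, degU_tmul, map_add, splitRep_tmul, spinDeg_spin,
      eulerOp_symRep]
  exact LinearMap.congr_fun this u

/-- The action `1 ⊗ splitRep` of `G × G` on `𝔛_{t,c}(τ ⊗ S)`. -/
def splitRepX : Representation ℂ (G × G) (Pol V ⊗[ℂ] (Sy V ⊗[ℂ] (τ ⊗[ℂ] Spin V))) :=
  Representation.tprod 1 (splitRep ρ)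

omit [FiniteDimensional ℂ V] [Finite G] in
theorem splitRepX_tmul (g : G × G) (p : Pol V) (u : Sy V ⊗[ℂ] (τ ⊗[ℂ] Spin V)) :
    splitRepX ρ g (p ⊗ₜ u) = p ⊗ₜ splitRep ρ g u := rfl

omit [Finite G] in
theorem splitRepX_mem_gr (k : ℕ) (g : G × G) :
    ∀ w ∈ gr (degX V τ) k, splitRepX ρ g w ∈ gr (degX V τ) k := fun w hw => by
  refine map_mem_gr (fun w => ?_) hw
  have : degX V τ ∘ₗ splitRepX ρ g = splitRepX ρ g ∘ₗ degX V τ := TensorProduct.ext' fun p u => by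
    simp only [LinearMap.comp_apply, degX, LinearMap.lTensor_tmul, splitRepX_tmul, degU_splitRep]
  exact LinearMap.congr_fun this w

/-- Under `splitRepX` the pair `(s, s)` is the diagonal action and `(1, s)` acts on `τ` alone, so
the reflection term of `diracU_sq` is `-D.cas`, from the same element as in the Euler computation.
-/
theorem lTensor_diracU_sq (w : Pol V ⊗[ℂ] (Sy V ⊗[ℂ] (τ ⊗[ℂ] Spin V))) :
    (diracU D ρ).lTensor (Pol V) ((diracU D ρ).lTensor (Pol V) w) =
      -((2 : ℂ) • (D.t • degX V τ w - (splitRepX ρ).asAlgebraHom D.cas w)) := by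
  have : (diracU D ρ).lTensor (Pol V) ∘ₗ (diracU D ρ).lTensor (Pol V) =
      -((2 : ℂ) • (D.t • degX V τ - (splitRepX ρ).asAlgebraHom D.cas)) :=
    TensorProduct.ext' fun p u => by
      simp only [LinearMap.comp_apply, LinearMap.neg_apply, LinearMap.smul_apply,
        LinearMap.sub_apply, LinearMap.lTensor_tmul, degX, asAlgebraHom_cas, splitRepX_tmul,
        splitRep_diag, splitRep_one, diracU_sq]
      simp only [TensorProduct.tmul_neg, TensorProduct.tmul_smul, TensorProduct.tmul_add,
        TensorProduct.tmul_sum, TensorProduct.tmul_sub]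
      rw [sub_eq_add_neg, ← Finset.sum_neg_distrib]
      refine congrArg (fun v => -((2 : ℂ) • (D.t • p ⊗ₜ[ℂ] degU V τ u + v))) ?_
      refine Finset.sum_congr rfl fun s _ => ?_
      module
  exact LinearMap.congr_fun this w

theorem lTensor_diracU_sq_of_mem_gr {k : ℕ} {w : Pol V ⊗[ℂ] (Sy V ⊗[ℂ] (τ ⊗[ℂ] Spin V))}
    (hw : w ∈ gr (degX V τ) k) :
    (diracU D ρ).lTensor (Pol V) ((diracU D ρ).lTensor (Pol V) w) =
      (-2 : ℂ) • (splitRepX ρ).asAlgebraHom ((D.t * (k : ℂ)) • 1 + -D.cas) w := by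
  rw [lTensor_diracU_sq, mem_gr.mp hw, map_add, map_neg, map_smul, map_one, LinearMap.add_apply,
    LinearMap.neg_apply, LinearMap.smul_apply, Module.End.one_apply, smul_smul]
  module

/-- For `t ≠ 0`, `D_τ` is bijective on `ℂ[𝔥*] ⊗ τ ⊗ S` in large degrees. -/
theorem exists_bijective_diracU (ht : D.t ≠ 0) : ∃ K : ℕ, ∀ k > K,
    (∀ w ∈ gr (degX V τ) k, (diracU D ρ).lTensor (Pol V) w = 0 → w = 0) ∧
    ∀ w ∈ gr (degX V τ) k, ∃ v ∈ gr (degX V τ) k, (diracU D ρ).lTensor (Pol V) v = w := by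
  obtain ⟨K, hK⟩ := exists_isUnit_add (-D.cas) ht
  refine ⟨K, fun k hk => ⟨fun w hw h0 => ?_, fun w hw => ?_⟩⟩
  · have h1 := lTensor_diracU_sq_of_mem_gr D ρ hw
    rw [h0, map_zero] at h1
    exact eq_zero_of_asAlgebraHom (splitRepX ρ) (hK k hk)
      ((smul_eq_zero.mp h1.symm).resolve_left (by norm_num))
  · obtain ⟨v, hv, e⟩ := exists_asAlgebraHom_eq (splitRepX ρ) _ (splitRepX_mem_gr ρ k) (hK k hk) hw
    -- The square maps `v` to `-2 w`, so one application to `-½ v` gives a preimage of `w`.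
    refine ⟨(diracU D ρ).lTensor (Pol V) ((-(1 / 2) : ℂ) • v),
      map_mem_gr (degX_diracU D ρ) (Submodule.smul_mem _ _ hv), ?_⟩
    rw [map_smul, map_smul, lTensor_diracU_sq_of_mem_gr D ρ hv, e, smul_smul]
    norm_num

end Bijectivity

/-! ### The index in category `𝒪` -/

section CategoryO

open CategoryTheory

variable {V : Type u} [AddCommGroup V] [Module ℂ V] [FiniteDimensional ℂ V]
  {τ : Type u} [AddCommGroup τ] [Module ℂ τ]
  {G : Subgroup (V ≃ₗ[ℂ] V)} [Finite G] (D : Datum G) (ρ : Representation ℂ G τ)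

omit [FiniteDimensional ℂ V] in
theorem homX_le_of_biHom_le {k : ℕ} {T : Submodule ℂ (Pol V ⊗[ℂ] (Sy V ⊗[ℂ] (τ ⊗[ℂ] Spin V)))}
    (h : ∀ m, ∀ a ≤ k, biHom V (τ ⊗[ℂ] Spin V) m a ≤ T) : homX V τ k ≤ T := by
  refine Submodule.span_le.mpr ?_
  rintro _ ⟨p, a, b, q, z, ω, rfl, hq, -, rfl⟩
  have hp : p ∈ ⨆ m, syPow (Module.Dual ℂ V) m := by rw [iSup_syPow]; trivial
  induction hp using Submodule.iSup_induction' with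
  | zero => rw [TensorProduct.zero_tmul]; exact zero_mem _
  | add p p' _ _ hp hp' => rw [TensorProduct.add_tmul]; exact add_mem hp hp'
  | mem m p hp => exact h m a (Nat.le_add_right a b) (tmul_mem_biHom hp hq _)

omit [FiniteDimensional ℂ V] in
theorem fil_le {X : Type*} [AddCommGroup X] [Module ℂ X] {N : Module.End ℂ X} {n : ℕ}
    {T : Submodule ℂ X} (h : ∀ k ≤ n, gr N k ≤ T) : fil N n ≤ T := by
  induction n with
  | zero => exact h 0 le_rfl
  | succ n ih => exact sup_le (ih fun k hk => h k (by omega)) (h (n + 1) le_rfl)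

/-- Being contained in a finitely generated module over a Noetherian ring suffices;
`exists_fg_biHom_le` supplies such a module, since total degree at most `n` bounds the degree in
`ℂ[𝔥*]` by `n`. -/
theorem catO_filX [FiniteDimensional ℂ τ] (ht : D.t ≠ 0) (n : ℕ) :
    catO D (ModuleCat.of (H D) (filX D ρ n)) := by
  refine ⟨prop_of_injective (filX D ρ n).subtype (Submodule.injective_subtype _)
    (locNilp_XMod D (tauS ρ)), ?_⟩
  obtain ⟨N, hN, h⟩ := exists_fg_biHom_le D (tauS ρ) ht n
  have hle : ∀ w ∈ filX D ρ n, w ∈ N := fun w hw => by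
    let T : Submodule ℂ (XMod D (tauS ρ)) := N.restrictScalars ℂ
    exact fil_le (N := degX V τ) (T := T) (fun k hk => (gr_degX_le k).trans
      (homX_le_of_biHom_le fun m a ha w hw => h m a (ha.trans hk) w hw)) hw
  have := isNoetherianRing_polAlg D
  have : IsNoetherian (polAlg D) N := isNoetherian_of_fg_of_noetherian N hN
  exact Module.Finite.of_injective (((filX D ρ n).subtype.restrictScalars (polAlg D)).codRestrict N
    fun w => hle w.1 w.2) fun w w' e => Subtype.ext
      (congrArg (fun v : N => (v : XMod D (tauS ρ))) e)

/-- The truncation `F = filX D ρ K` replaces `⊤`, because `index_eq_cls_MObj` needs its even and odd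
parts in category `𝒪`. Above degree `K` the leading part `B` of `-D_τ = A + B` is bijective, and
hence `D_τ` is bijective modulo `F`. -/
theorem index_eq_cls_MObj_catO [FiniteDimensional ℂ τ] (ht : D.t ≠ 0) :
    ∃ (hk : catO D (kerObj D ρ)) (hc : catO D (cokerObj D ρ)) (hM : catO D (MObj D ρ)),
      K0.cls (kerObj D ρ) hk - K0.cls (cokerObj D ρ) hc = K0.cls (MObj D ρ) hM := by
  obtain ⟨K, hK⟩ := exists_bijective_diracU D ρ ht
  have hneg : ∀ w : XMod D (tauS ρ), -dirac D ρ w =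
      (∑ j, (gam V τ ((yb V).coord j)).lTensor (Pol V) ∘ₗ Qy _ (yb V j)) w +
        (diracU D ρ).lTensor (Pol V) w := fun w =>
    neg_eq_iff_eq_neg.mpr (diracLin_eq D ρ w)
  refine index_eq_cls_MObj D ρ (catO D) (filX D ρ K) (fun w hw => par_mem_filX D ρ hw)
    (fun w hw => deRham_mem_filX D ρ hw) (inclM_mem_filX D ρ K) (fun w hw h =>
      deRham_exact D ρ hw h) (fun w hw => dirac_mem_filX D ρ hw) (fun w hw => ?_) (fun w => ?_)
    (prop_of_injective (N := filX D ρ K)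
      (((XEven D ρ).subtype.comp (Submodule.subtype _)).codRestrict _ fun w => w.2)
      (fun w w' e => Subtype.ext (Subtype.ext
        (congrArg (fun v : filX D ρ K => (v : XMod D (tauS ρ))) e))) (catO_filX D ρ ht K))
    (prop_of_injective (N := filX D ρ K)
      (((XOdd D ρ).subtype.comp (Submodule.subtype _)).codRestrict _ fun w => w.2)
      (fun w w' e => Subtype.ext (Subtype.ext
        (congrArg (fun v : filX D ρ K => (v : XMod D (tauS ρ))) e))) (catO_filX D ρ ht K))
  · have h1 := (filX D ρ K).neg_mem hw
    rw [hneg] at h1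
    exact mem_fil_of_map_mem_fil iSup_gr_degX degX_gam_Qy (degX_diracU D ρ)
      (fun k hk => (hK k hk).1) h1
  · obtain ⟨v, hv⟩ := exists_sub_map_mem_fil iSup_gr_degX degX_gam_Qy (fun k hk => (hK k hk).2)
      (w : Pol V ⊗[ℂ] (Sy V ⊗[ℂ] (τ ⊗[ℂ] Spin V)))
    have h1 : ∀ v : XMod D (tauS ρ), dirac D ρ (-v) =
        (∑ j, (gam V τ ((yb V).coord j)).lTensor (Pol V) ∘ₗ Qy _ (yb V j)) v +
          (diracU D ρ).lTensor (Pol V) v := fun v => ((dirac D ρ).map_neg v).trans (hneg v)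
    exact ⟨-(v : XMod D (tauS ρ)), (congrArg (fun v => w - v ∈ filX D ρ K) (h1 v)).mpr hv⟩

theorem globalIndex_mem_range [FiniteDimensional ℂ τ] :
    globalIndex D ρ ∈ (K0.incl (catO_le D)).range := by
  rw [globalIndex_eq]
  -- For `t = 0` the finiteness argument is not available, but the class is zero in `K_0(𝒪^ln)`.
  by_cases ht : D.t = 0
  · rw [K0.cls_locNilp_eq_zero]
    exact zero_mem _
  · obtain ⟨-, -, hM, -⟩ := index_eq_cls_MObj_catO D ρ ht
    exact ⟨K0.cls (MObj D ρ) hM, K0.incl_cls _ _ _⟩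

/-- The underlying space `ℂ[𝔥] ⊗ τ` and the operators of `y` and `g` on it involve neither `t`, `c`
nor the eigenvectors, so the identity map works. -/
theorem exists_MMod_equiv (D' : Datum G) : ∃ e : MMod D ρ ≃ₗ[ℂ] MMod D' ρ,
    (∀ (y : V) (m : MMod D ρ), e (H.of D (.y y) • m) = H.of D' (.y y) • e m) ∧
    ∀ (g : G) (m : MMod D ρ), e (H.of D (.g g) • m) = H.of D' (.g g) • e m := by
  let e : MMod D ρ ≃ₗ[ℂ] MMod D' ρ := LinearEquiv.refl ℂ (Pol V ⊗[ℂ] τ)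
  exact ⟨e, fun y m => (MMod.of_smul D ρ (.y y) m).trans (MMod.of_smul D' ρ (.y y) m).symm,
    fun g m => (MMod.of_smul D ρ (.g g) m).trans (MMod.of_smul D' ρ (.g g) m).symm⟩

end CategoryO

end RCA

end

theorem propositionp {V : Type u} [AddCommGroup V] [Module ℂ V] [FiniteDimensional ℂ V]
    (G : Subgroup (V ≃ₗ[ℂ] V)) [Finite G]
    (hG : Subgroup.closure {s | s ∈ G ∧ RCA.IsReflection s} = G)
    (hirr : (RCA.std G).IsIrreducible) (D : RCA.Datum G)
    {τ : Type u} [AddCommGroup τ] [Module ℂ τ] (ρ : Representation ℂ G τ)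
    (hρ : ρ.IsIrreducible) :
    RCA.globalIndex D ρ = RCA.K0.cls (RCA.MObj D ρ) (RCA.locNilp_M D ρ) ∧
    RCA.globalIndex D ρ ∈ (RCA.K0.incl (RCA.catO_le D)).range ∧
    (∀ (P : CategoryTheory.ObjectProperty (ModuleCat.{u} (RCA.H D))) [P.IsSerreClass],
      P (RCA.XEvenObj D ρ) → P (RCA.XOddObj D ρ) →
      ∃ (hk : P (RCA.kerObj D ρ)) (hc : P (RCA.cokerObj D ρ)) (hM : P (RCA.MObj D ρ)),
        RCA.K0.cls (RCA.kerObj D ρ) hk - RCA.K0.cls (RCA.cokerObj D ρ) hc =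
          RCA.K0.cls (RCA.MObj D ρ) hM) ∧
    (D.t ≠ 0 →
      ∃ (hk : RCA.catO D (RCA.kerObj D ρ)) (hc : RCA.catO D (RCA.cokerObj D ρ))
        (hM : RCA.catO D (RCA.MObj D ρ)),
        RCA.K0.cls (RCA.kerObj D ρ) hk - RCA.K0.cls (RCA.cokerObj D ρ) hc =
          RCA.K0.cls (RCA.MObj D ρ) hM) ∧
    (∀ D' : RCA.Datum G, ∃ e : RCA.MMod D ρ ≃ₗ[ℂ] RCA.MMod D' ρ,
      (∀ (y : V) (m : RCA.MMod D ρ),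
        e (RCA.H.of D (.y y) • m) = RCA.H.of D' (.y y) • e m) ∧
      ∀ (g : G) (m : RCA.MMod D ρ),
        e (RCA.H.of D (.g g) • m) = RCA.H.of D' (.g g) • e m) := by
  -- Finite dimensionality of `τ` enters through the finite generation in `catO_filX`.
  have := RCA.finiteDimensional_of_isIrreducible ρ hρ
  exact ⟨RCA.globalIndex_eq D ρ, RCA.globalIndex_mem_range D ρ,
    fun P _ hE hO => RCA.index_eq_cls_MObj_of_XMod D ρ P hE hO,
    RCA.index_eq_cls_MObj_catO D ρ, RCA.exists_MMod_equiv D ρ⟩
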